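/- All groups are finite. For a prime $p$ and a group $G$, let $c_p(G)$ be the number of composition factors of $G$ of order $p$. A subgroup of $\mathrm{GL}(d,q)$ is called imprimitive if it is irreducible and permutes the summands of some decomposition of $\mathbb F_q^d$ as a direct sum of at least two nonzero subspaces. If $\Gamma\le\mathrm{GL}(d,q)$, then $\Gamma\wr C_p$ (with $C_p$ acting regularly on $p$ points) is regarded as a subgroup of $\mathrm{GL}(dp,q)$ consisting of block-monomial matrices. **Lemma.** Let $p$ be a prime, $r\ge1$, $q$ a prime power (not necessarily a power of $p$), $\Gamma_1$ an irreducible subgroup of $\mathrm{GL}(r,q)$, and $\Gamma_n=\Gamma_{n-1}\wr C_p\le\mathrm{GL}(d_n,q)$ for $n\ge2$, where $d_n=rp^{n-1}$. If $\Gamma_1\neq1$, then $\Gamma_n$ is irreducible for all $n\ge1$ and imprimitive for all $n\ge2$. Moreover (also if $\Gamma_1=1$), for all $n\ge1$, $$c_p(\Gamma_n)=\frac{\varepsilon d_n-1}{p-1},\qquad\text{where}\qquad \varepsilon=\frac{c_p(\Gamma_1)(p-1)+1}{r}.$$ **Examples.** In each case $\Gamma_1$ is the group given below, considered over $\mathbb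 F_q$, and $\Gamma_n=\Gamma_{n-1}\wr C_p$ for $n\ge 2$. 1. Let $q$ be a power of a prime $p$. The group $\Gamma_1=\Gamma\mathrm L(1,p^p)\cong\mathrm{GL}(1,p^p)\rtimes C_p$ is an absolutely irreducible subgroup of $\mathrm{GL}(p,p)$ with $c_p(\Gamma_1)=1$. For every $n\ge1$ the group $\Gamma_n\le\mathrm{GL}(d_n,q)$, $d_n=p^n$, is irreducible and $c_p(\Gamma_n)=(d_n-1)/(p-1)$. 2. Let $q=2^f$ with $f\geq 1$ even. The group $\Gamma_1=\mathrm{GU}(3,2)\cong 3^{1+2}\rtimes\mathrm{SL}(2,3)$ is an absolutely irreducible subgroup of $\mathrm{GL}(3,2^2)$ with $c_2(\Gamma_1)=3$, and $\mathbb F_4$ embeds in $\mathbb F_q$. Taking $p=2$, for every $n\ge1$ the group $\Gamma_n\le\mathrm{GL}(d_n,q)$, $d_n=3\cdot2^{n-1}$, is irreducible and $c_2(\Gamma_n)=\frac43d_n-1$. 3. Let $p=2^m+1$ be a Fermat prime and $q$ a power of $p$. There is an extraspecial group of order $2^{1+2m}$ and type $-$ (that is, the quadratic form $xZ(E)\mapsto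 x^2\in Z(E)\cong\mathbb F_2$ on $E/Z(E)$ is nondegenerate with maximal totally singular subspaces of dimension $m-1$). For every such group $E$, let $P$ be any Sylow $p$-subgroup of the orthogonal group $\mathrm{GO}^-(2m,2)$ of this form. Then $|P|=p$, the action of $P$ on $E/Z(E)$ lifts to an action of $P$ on $E$ by automorphisms, and for every such lift the group $\Gamma_1=E\rtimes P$ satisfies $c_p(\Gamma_1)=1$ and is isomorphic to an absolutely irreducible subgroup of $\mathrm{GL}(2^m,p)=\mathrm{GL}(p-1,p)$ such that, for every $n\ge1$, the group $\Gamma_n\le\mathrm{GL}(d_n,q)$, $d_n=(p-1)p^{n-1}$, is irreducible and $c_p(\Gamma_n)=(\varepsilon d_n-1)/(p-1)$ with $\varepsilon=p/(p-1)$. **Sharpness.** Let $q=p^f$ with $p$ prime and $f\ge1$, and let $\varepsilon_q=\frac43$ if $p=2$ and $f$ is even, $\varepsilon_q=\frac p{p-1}$ if $p$ is a Fermat prime (a prime of the form $2^{2^k}+1$, $k\ge0$), and $\varepsilon_q=1$ otherwise. Then for infinitely many $d$ there is an irreducible subgroup $G\le\mathrm{GL}(d,q)$ with $$c_p(G)=\frac{\varepsilon_qd-1}{p-1}.$$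 -/

import Mathlib

open scoped MatrixGroups

/-! ### Composition factors of groups -/

/-- `H` is a maximal proper normal subgroup of `K`, that is, `H` is normal in `K` and `K / H` is
simple. -/
def IsMaximalNormalIn {G : Type*} [Group G] (H K : Subgroup G) : Prop :=
  H < K ∧ (H.subgroupOf K).Normal ∧
    ∀ N : Subgroup G, H ≤ N → N ≤ K → (N.subgroupOf K).Normal → N = H ∨ N = K

theorem IsMaximalNormalIn.le_normalizer {G : Type*} [Group G] {H K : Subgroup G}
    (h : IsMaximalNormalIn H K) : K ≤ Subgroup.normalizer (H : Set G) :=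
  (Subgroup.normal_subgroupOf_iff_le_normalizer h.1.le).1 h.2.1

theorem IsMaximalNormalIn.sup_eq {G : Type*} [Group G] {x y z : Subgroup G}
    (hx : IsMaximalNormalIn x z) (hy : IsMaximalNormalIn y z) (hne : x ≠ y) : x ⊔ y = z := by
  have hle : x ⊔ y ≤ z := sup_le hx.1.le hy.1.le
  have hn : ((x ⊔ y).subgroupOf z).Normal :=
    (Subgroup.normal_subgroupOf_iff_le_normalizer hle).2
      ((le_inf hx.le_normalizer hy.le_normalizer).trans
        (Subgroup.normalizer_inf_normalizer_le_normalizer_sup x y))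
  rcases hx.2.2 _ le_sup_left hle hn with h | h
  · have hyx : y ≤ x := by rw [← h]; exact le_sup_right
    rcases hy.2.2 x hyx hx.1.le hx.2.1 with h' | h'
    · exact absurd h' hne
    · exact absurd h' hx.1.ne
  · exact h

theorem IsMaximalNormalIn.inf_left {G : Type*} [Group G] {x y : Subgroup G}
    (_ : IsMaximalNormalIn x (x ⊔ y)) (hy : IsMaximalNormalIn y (x ⊔ y)) :
    IsMaximalNormalIn (x ⊓ y) x := by
  have hxy : x ≤ Subgroup.normalizer (y : Set G) := le_sup_left.trans hy.le_normalizer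
  refine ⟨lt_of_le_of_ne inf_le_left ?_, ?_, ?_⟩
  · intro h
    exact hy.1.ne (sup_eq_right.2 (inf_eq_left.1 h)).symm
  · rw [Subgroup.normal_subgroupOf_iff_le_normalizer inf_le_left]
    exact (le_inf Subgroup.le_normalizer hxy).trans Subgroup.inf_normalizer_le_normalizer_inf
  · intro N h1 h2 h3
    have hN : x ≤ Subgroup.normalizer (N : Set G) :=
      (Subgroup.normal_subgroupOf_iff_le_normalizer h2).1 h3
    have hle : N ⊔ y ≤ x ⊔ y := sup_le_sup_right h2 y
    have hn : ((N ⊔ y).subgroupOf (x ⊔ y)).Normal := by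
      rw [Subgroup.normal_subgroupOf_iff_le_normalizer hle]
      exact sup_le ((le_inf hN hxy).trans
        (Subgroup.normalizer_inf_normalizer_le_normalizer_sup N y))
        (le_sup_right.trans Subgroup.le_normalizer)
    rcases hy.2.2 _ le_sup_right hle hn with h | h
    · left
      exact le_antisymm (le_inf h2 (by rw [← h]; exact le_sup_left)) h1
    · right
      refine le_antisymm h2 fun a ha => ?_
      have ha' : a ∈ ((N ⊔ y : Subgroup G) : Set G) := by
        rw [h]; exact (le_sup_left : x ≤ x ⊔ y) ha
      rw [Subgroup.coe_mul_of_left_le_normalizer_right N y (h2.trans hxy)] at ha'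
      obtain ⟨b, hb, c, hc, rfl⟩ := ha'
      have hcx : c ∈ x := by simpa using x.mul_mem (x.inv_mem (h2 hb)) ha
      exact N.mul_mem hb (h1 ⟨hcx, hc⟩)

theorem IsMaximalNormalIn.relIndex_sup {G : Type*} [Group G] {x y : Subgroup G}
    (h : IsMaximalNormalIn x (x ⊔ y)) : x.relIndex (x ⊔ y) = x.relIndex y := by
  have hx : ((x.subgroupOf (x ⊔ y))).Normal := h.2.1
  have h1 := Subgroup.relIndex_sup_left (y.subgroupOf (x ⊔ y)) (x.subgroupOf (x ⊔ y))
  rwa [← Subgroup.subgroupOf_sup le_sup_left le_sup_right,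
    Subgroup.relIndex_subgroupOf le_rfl, Subgroup.relIndex_subgroupOf le_sup_right] at h1

/-- Subgroups of a group form a Jordan–Hölder lattice, the relation being "maximal normal
subgroup of". -/
@[reducible] def subgroupJordanHolder (G : Type*) [Group G] :
    JordanHolderLattice (Subgroup G) where
  IsMaximal := IsMaximalNormalIn
  lt_of_isMaximal h := h.1
  sup_eq_of_isMaximal := IsMaximalNormalIn.sup_eq
  isMaximal_inf_left_of_isMaximal_sup := IsMaximalNormalIn.inf_left

section CompositionFactors

attribute [local instance] subgroupJordanHolder

theorem relIndex_eq_of_iso {G : Type*} [Group G] {a b : Subgroup G × Subgroup G}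
    (h : JordanHolderLattice.Iso a b) : a.1.relIndex a.2 = b.1.relIndex b.2 := by
  refine JordanHolderLattice.Iso.rel (fun a b => a.1.relIndex a.2 = b.1.relIndex b.2)
    rfl Eq.symm Eq.trans ?_ h
  intro x y hxy
  have h1 : x.relIndex (x ⊔ y) = x.relIndex y := IsMaximalNormalIn.relIndex_sup hxy
  show x.relIndex (x ⊔ y) = (x ⊓ y).relIndex y
  rw [Subgroup.inf_relIndex_right, h1]

/-- A (full) composition series of the group `G`: `1 = H₀ ◁ H₁ ◁ ⋯ ◁ Hₙ = G` with simple factors. -/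
def IsFullSeries {G : Type*} [Group G] (s : CompositionSeries (Subgroup G)) : Prop :=
  s.head = ⊥ ∧ s.last = ⊤

/-- The number of factors of order `p` in a composition series. -/
noncomputable def primeFactorCount (p : ℕ) {G : Type*} [Group G]
    (s : CompositionSeries (Subgroup G)) : ℕ :=
  Nat.card {i : Fin s.length // (s i.castSucc).relIndex (s i.succ) = p}

/-- `c_p(G)`: the number of composition factors of `G` of order `p`. By the Jordan–Hölder theorem,
every composition series gives the same number, see `cp_eq_primeFactorCount`. -/
noncomputable def cp (p : ℕ) (G : Type*) [Group G] : ℕ :=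
  sSup {k | ∃ s : CompositionSeries (Subgroup G), IsFullSeries s ∧ primeFactorCount p s = k}

theorem cp_eq_primeFactorCount (p : ℕ) {G : Type*} [Group G] (s : CompositionSeries (Subgroup G))
    (hs : IsFullSeries s) : cp p G = primeFactorCount p s := by
  have key : ∀ t : CompositionSeries (Subgroup G), IsFullSeries t →
      primeFactorCount p t = primeFactorCount p s := by
    intro t ht
    obtain ⟨f, hf⟩ := CompositionSeries.jordan_holder t s (ht.1.trans hs.1.symm)
      (ht.2.trans hs.2.symm)
    have hrel : ∀ i, (t i.castSucc).relIndex (t i.succ)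
        = (s (f i).castSucc).relIndex (s (f i).succ) := fun i => by
      have h := relIndex_eq_of_iso (hf i)
      exact h
    exact Nat.card_congr (f.subtypeEquiv fun i => by rw [hrel i])
  have : {k | ∃ s : CompositionSeries (Subgroup G), IsFullSeries s ∧ primeFactorCount p s = k}
      = {primeFactorCount p s} := by
    ext k
    constructor
    · rintro ⟨t, ht, rfl⟩
      exact key t ht
    · rintro rfl
      exact ⟨s, hs, rfl⟩
  rw [cp, this, csSup_singleton]

end CompositionFactors

/-! ### Linear groups -/

/-- The natural representation of a matrix group `Γ ≤ GL(ι, F)` on column vectors. -/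
noncomputable def naturalRep {ι F : Type*} [Fintype ι] [DecidableEq ι] [Field F]
    (Γ : Subgroup (GL ι F)) : Representation F Γ (ι → F) :=
  (Matrix.toLinAlgEquiv' (R := F) (n := ι) : Matrix ι ι F →* ((ι → F) →ₗ[F] (ι → F))).comp
    ((Units.coeHom (Matrix ι ι F)).comp Γ.subtype)

/-- `Γ ≤ GL(ι, F)` is irreducible: the natural module is nonzero and has no proper nonzero
`Γ`-invariant subspace. -/
def IsIrreducibleGroup {ι F : Type*} [Fintype ι] [DecidableEq ι] [Field F]
    (Γ : Subgroup (GL ι F)) : Prop :=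
  (naturalRep Γ).IsIrreducible

/-- The image of `Γ ≤ GL(ι, k)` in `GL(ι, F)` under a field embedding `k → F`. -/
def extendScalars {ι k F : Type*} [Fintype ι] [DecidableEq ι] [Field k] [Field F]
    (i : k →+* F) (Γ : Subgroup (GL ι k)) : Subgroup (GL ι F) :=
  Γ.map (Matrix.GeneralLinearGroup.map i)

/-- `Γ ≤ GL(ι, F)` is absolutely irreducible. -/
def IsAbsolutelyIrreducibleGroup {ι F : Type*} [Fintype ι] [DecidableEq ι] [Field F]
    (Γ : Subgroup (GL ι F)) : Prop :=
  IsIrreducibleGroup (extendScalars (algebraMap F (AlgebraicClosure F)) Γ)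

/-- `Γ ≤ GL(ι, F)` is imprimitive: it is irreducible, and the natural module is the direct sum of
at least two nonzero subspaces that are permuted by `Γ`. -/
def IsImprimitiveGroup {ι F : Type*} [Fintype ι] [DecidableEq ι] [Field F]
    (Γ : Subgroup (GL ι F)) : Prop :=
  IsIrreducibleGroup Γ ∧ ∃ (k : ℕ) (W : Fin k → Submodule F (ι → F)),
    2 ≤ k ∧ (∀ i, W i ≠ ⊥) ∧ DirectSum.IsInternal W ∧
      ∀ (g : Γ) (i : Fin k), ∃ j, (W i).map (naturalRep Γ g) = W j

/-! ### Wreath products with a cyclic group of order `p` -/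

/-- The wreath product `Γ ≀ C` of `Γ ≤ GL(ι, F)` with a finite group `C` in its regular action, as
a group of block-monomial matrices: the pair `(f, c)` is the matrix whose only nonzero blocks are
`f(c x) ∈ Γ` in position `(c x, x)`, `x ∈ C`. -/
def wreathHom {ι F : Type*} [Fintype ι] [DecidableEq ι] [Field F] (Γ : Subgroup (GL ι F))
    (C : Type*) [Group C] [Fintype C] [DecidableEq C] :
    (RegularWreathProduct Γ C) →* GL (ι × C) F :=
  MonoidHom.toHomUnits
    { toFun := fun w => Matrix.of fun a b =>
        if a.2 = w.right * b.2 then ((w.left a.2 : GL ι F) : Matrix ι ι F) a.1 b.1 else 0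
      map_one' := by
        ext ⟨i, x⟩ ⟨j, y⟩
        by_cases hxy : x = y <;> simp [Matrix.one_apply, hxy]
      map_mul' := by
        intro v w
        ext ⟨i, x⟩ ⟨j, y⟩
        simp only [Matrix.of_apply, Matrix.mul_apply, Fintype.sum_prod_type,
          RegularWreathProduct.mul_left, RegularWreathProduct.mul_right, Pi.mul_apply]
        rw [Finset.sum_comm, Finset.sum_eq_single (v.right⁻¹ * x)]
        · by_cases h : x = v.right * w.right * y
          · have h' : v.right⁻¹ * x = w.right * y := by rw [h]; group
            simp [h, Matrix.mul_apply, mul_assoc]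
          · have h' : ¬ v.right⁻¹ * x = w.right * y := by
              intro h'
              exact h (by rw [mul_assoc, ← h']; group)
            simp [h, h']
        · intro c _ hc
          have : ¬ x = v.right * c := by
            rintro rfl
            exact hc (by group)
          simp [this]
        · simp }

/-- The group of all `e`-relabelled matrices of `Γ`. -/
def reindexGroup {ι κ F : Type*} [Fintype ι] [DecidableEq ι] [Fintype κ] [DecidableEq κ] [Field F]
    (e : ι ≃ κ) (Γ : Subgroup (GL ι F)) : Subgroup (GL κ F) :=
  Γ.map (Units.map (Matrix.reindexAlgEquiv F F e : Matrix ι ι F →* Matrix κ κ F))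

/-- `Γ ≀ C_p` as a subgroup of `GL(d p, F)`, for `Γ ≤ GL(d, F)`. -/
def wreathCyclic (p : ℕ) [NeZero p] {d : ℕ} {F : Type*} [Field F]
    (Γ : Subgroup (GL (Fin d) F)) : Subgroup (GL (Fin (d * p)) F) :=
  reindexGroup
    (((Equiv.refl (Fin d)).prodCongr
      (Multiplicative.toAdd.trans (ZMod.finEquiv p).symm.toEquiv)).trans finProdFinEquiv)
    (wreathHom Γ (Multiplicative (ZMod p))).range

/-- The `n`-fold iterated wreath product `(⋯(Γ ≀ C_p) ≀ ⋯) ≀ C_p` as a subgroup of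
`GL(r p ^ n, F)`, for `Γ ≤ GL(r, F)`. -/
def wreathTower (p : ℕ) [NeZero p] {r : ℕ} {F : Type*} [Field F] (Γ : Subgroup (GL (Fin r) F)) :
    (n : ℕ) → Subgroup (GL (Fin (r * p ^ n)) F)
  | 0 => reindexGroup (finCongr (by simp)) Γ
  | n + 1 => reindexGroup (finCongr (by rw [pow_succ, mul_assoc]))
      (wreathCyclic p (wreathTower p Γ n))

/-! ### The base groups -/

/-- `ΓL(1, K)`, for a field extension `K` of `k`, as a group of `k`-linear bijections of `K`: the
`K`-semilinear ones (for any automorphism of `K`). -/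
def gammaLOne (k K : Type*) [Field k] [Field K] [Algebra k K] :
    Subgroup (LinearMap.GeneralLinearGroup k K) where
  carrier := {g | ∃ σ : K ≃+* K, ∀ c x : K, (g : K →ₗ[k] K) (c * x) = σ c * (g : K →ₗ[k] K) x}
  one_mem' := ⟨RingEquiv.refl K, fun c x => by simp⟩
  mul_mem' := by
    rintro g h ⟨σ, hσ⟩ ⟨τ, hτ⟩
    exact ⟨τ.trans σ, fun c x => by simp [hσ, hτ]⟩
  inv_mem' := by
    rintro g ⟨σ, hσ⟩
    refine ⟨σ.symm, fun c x => ?_⟩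
    have hinv : ∀ y, (g : K →ₗ[k] K) ((g⁻¹ : (K →ₗ[k] K)ˣ).1 y) = y := fun y => by
      rw [← Module.End.mul_apply, Units.mul_inv, Module.End.one_apply]
    have hinv' : ∀ y, (g⁻¹ : (K →ₗ[k] K)ˣ).1 ((g : K →ₗ[k] K) y) = y := fun y => by
      rw [← Module.End.mul_apply, Units.inv_mul, Module.End.one_apply]
    rw [← hinv' (σ.symm c * _), hσ, hinv, RingEquiv.apply_symm_apply]

/-- The matrix group of a group of linear bijections with respect to a basis. -/
noncomputable def matrixGroup {ι k V : Type*} [Fintype ι] [DecidableEq ι] [Field k]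
    [AddCommGroup V] [Module k V] (b : Module.Basis ι k V)
    (Γ : Subgroup (LinearMap.GeneralLinearGroup k V)) : Subgroup (GL ι k) :=
  Γ.map (Units.map (LinearMap.toMatrixAlgEquiv b : (V →ₗ[k] V) →* Matrix ι ι k))

/-- The general unitary group `GU(n, p) ≤ GL(n, p²)`, `p` prime: the matrices `A` over the field of
order `p²` with `A Āᵀ = 1`, where the bar is the entrywise map `x ↦ x ^ p`. -/
noncomputable def unitaryGU (n p : ℕ) [Fact p.Prime] :
    Subgroup (GL (Fin n) (GaloisField p 2)) where
  carrier := {A | (A : Matrix (Fin n) (Fin n) (GaloisField p 2)) *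
    ((A : Matrix (Fin n) (Fin n) (GaloisField p 2)).map
      (frobenius (GaloisField p 2) p)).transpose = 1}
  one_mem' := by simp
  mul_mem' := by
    intro A B hA hB
    simp only [Set.mem_ofPred_eq] at hA hB ⊢
    rw [Units.val_mul, Matrix.map_mul, Matrix.transpose_mul, mul_assoc,
      ← mul_assoc (B : Matrix (Fin n) (Fin n) (GaloisField p 2)), hB, one_mul, hA]
  inv_mem' := by
    intro A hA
    simp only [Set.mem_ofPred_eq] at hA ⊢
    have h1 : ((A : Matrix (Fin n) (Fin n) (GaloisField p 2)).map
        (frobenius (GaloisField p 2) p)).transpose = (A⁻¹ : GL (Fin n) (GaloisField p 2)).1 := by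
      rw [← one_mul (Matrix.transpose _), ← Units.inv_mul A, mul_assoc, hA, mul_one]
    have h2 : ((A : Matrix (Fin n) (Fin n) (GaloisField p 2)).map
        (frobenius (GaloisField p 2) p)).transpose *
        ((A⁻¹ : GL (Fin n) (GaloisField p 2)).1.map (frobenius (GaloisField p 2) p)).transpose
          = 1 := by
      rw [← Matrix.transpose_mul, ← Matrix.map_mul, Units.inv_mul]
      simp
    rwa [h1] at h2

/-- `E` is an extraspecial `p`-group. -/
def IsExtraspecial (p : ℕ) (E : Type*) [Group E] : Prop :=
  IsPGroup p E ∧ Nat.card (Subgroup.center E) = p ∧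
    commutator E = Subgroup.center E ∧ frattini E = Subgroup.center E

/-- A quadratic form over `𝔽₂` of type `-` in dimension `2m`, `m ≥ 1`: it is nondegenerate and its
totally singular subspaces have maximal dimension `m - 1`. -/
def IsMinusType (m : ℕ) {V : Type*} [AddCommGroup V] [Module (ZMod 2) V]
    (Q : QuadraticForm (ZMod 2) V) : Prop :=
  1 ≤ m ∧ Module.finrank (ZMod 2) V = 2 * m ∧
    (∀ x, (∀ y, QuadraticMap.polar Q x y = 0) → x = 0) ∧
    IsGreatest {k | ∃ W : Submodule (ZMod 2) V, (∀ x ∈ W, Q x = 0) ∧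
      Module.finrank (ZMod 2) W = k} (m - 1)

/-- The orthogonal group of a quadratic form: `GO^-(2m, 2)` if the form is over `𝔽₂`, of type `-`
and in dimension `2m`. -/
def isometryGroup {k V : Type*} [Field k] [AddCommGroup V] [Module k V] (Q : QuadraticForm k V) :
    Subgroup (V ≃ₗ[k] V) where
  carrier := {g | ∀ x, Q (g x) = Q x}
  one_mem' := fun x => rfl
  mul_mem' := by
    intro g h hg hh x
    exact (hg (h x)).trans (hh x)
  inv_mem' := by
    intro g hg x
    have h := hg (g⁻¹ x)
    have h2 : g (g⁻¹ x) = x := g.apply_symm_apply x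
    rw [h2] at h
    exact h.symm

/-- `π` identifies `E / Z(E)` with `V` in such a way that the squaring map of `E` becomes the
quadratic form `Q` (where `Z(E)` has order `2`): `x² = 1` if and only if `Q (x Z(E)) = 0`. -/
def IsSquaringForm {E V : Type*} [Group E] [AddCommGroup V] [Module (ZMod 2) V]
    (π : E →* Multiplicative V) (Q : QuadraticForm (ZMod 2) V) : Prop :=
  Function.Surjective π ∧ π.ker = Subgroup.center E ∧
    ∀ x, x ^ 2 = 1 ↔ Q (π x).toAdd = 0

/-- `E` is an extraspecial group of order `2^(1+2m)` and type `-`, as witnessed by its squaring form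
`Q` on `E / Z(E) ≅ V` (via `π`). -/
def IsExtraspecialMinus (m : ℕ) {E V : Type*} [Group E] [AddCommGroup V] [Module (ZMod 2) V]
    (π : E →* Multiplicative V) (Q : QuadraticForm (ZMod 2) V) : Prop :=
  IsExtraspecial 2 E ∧ Nat.card E = 2 ^ (1 + 2 * m) ∧ IsSquaringForm π Q ∧ IsMinusType m Q

/-- An action `φ` of a group `P` of isometries of `Q` on `E` by automorphisms that induces the given
action of `P` on `E / Z(E) ≅ V`. -/
def IsLiftedAction {E V : Type*} [Group E] [AddCommGroup V] [Module (ZMod 2) V]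
    (π : E →* Multiplicative V) {Q : QuadraticForm (ZMod 2) V}
    {P : Subgroup (isometryGroup Q)} (φ : P →* MulAut E) : Prop :=
  ∀ (g : P) (x : E), (π (φ g x)).toAdd = (g : isometryGroup Q).1 (π x).toAdd

/-! ### The constant -/

/-- `p` is a Fermat prime: a prime of the form `2 ^ 2 ^ n + 1`. -/
def IsFermatPrime (p : ℕ) : Prop := p.Prime ∧ ∃ n, p = Nat.fermatNumber n

open Classical in
/-- The constant `ε_q` for `q = p ^ f`. -/
noncomputable def epsilonQ (p f : ℕ) : ℚ :=
  if p = 2 ∧ Even f then 4 / 3 else if IsFermatPrime p then p / (p - 1) else 1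

/-! By Jordan–Hölder, `cp` is additive along extensions. The base of `Γ ≀ C_p` is `p` copies of `Γ`
with quotient of order `p`, so `c_p` passes from `a` to `p a + 1`. Equivalently `a (p - 1) + 1` is
multiplied by `p`, exactly as the dimension is, and the ratio `ε` stays constant (`cp_wreathTower`).
For irreducibility, a nontrivial irreducible `Γ` fixes no nonzero vector. Hence for a nonzero block
of a vector in an invariant subspace, `(g - 1)` applied to that block alone, for suitable `g`, is a
nonzero element of the subspace supported there. Irreducibility of `Γ` fills the block and the top
group carries it to the others.

For the examples, irreducibility over all required fields comes from one criterion that survives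
field embeddings: the matrices of `Γ` span the full matrix algebra.

For `ΓL(1, p^p)`, Dedekind independence and a dimension count show that the maps `c σ` span all
endomorphisms (`span_gammaLOne_eq_top`). For `GU(3,2)`, explicit Heisenberg and Weil matrices over
the field of order four embed a group of order 648 in it. There are only 648 orthonormal bases, so
this is everything (`unitaryGU_mulEquiv`).

For `E ⋊ P`, an algebra spanned by the image of `E`, with the central involution acting as `-1`, is
central simple of dimension `|E / Z|`. By Wedderburn it is a matrix algebra over `𝔽_p`. An
automorphism of `E` of order `p` is induced by a matrix `U` with `U ^ p` a scalar `c`. As `c ^ p =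
c` in `𝔽_p`, dividing `U` by `c` extends the representation to `P` (`exists_semidirect_rep`). The
Sylow order is `p` because the isometries are transitive on `2 ^ (m - 1) (2 ^ m + 1)` nonsingular
vectors, while `p` divides `|GL(2m, 2)|` just once. A single isometry lifts to `E` by a fibre
product argument (`exists_lift_isometry`).

Sharpness follows since the three towers realise the three values of `ε_q`. -/

/-! ### Counting composition factors -/

/-- There is a chain of maximal normal inclusions from `H` to `K` with exactly `n` factors of
order `p`. -/
inductive FactorChain (p : ℕ) {G : Type*} [Group G] (H : Subgroup G) : Subgroup G → ℕ → Prop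
  | refl : FactorChain p H H 0
  | step {K L : Subgroup G} {n : ℕ} : FactorChain p H K n → IsMaximalNormalIn K L →
      FactorChain p H L (n + if K.relIndex L = p then 1 else 0)

namespace FactorChain

variable {p : ℕ} {G : Type*} [Group G]

/-- Unrolls the inductive chain into an indexed one, the shape that `CompositionSeries` requires. -/
theorem exists_sequence {H K : Subgroup G} {n : ℕ} (h : FactorChain p H K n) :
    ∃ (l : ℕ) (f : ℕ → Subgroup G), f 0 = H ∧ f l = K ∧
      (∀ i < l, IsMaximalNormalIn (f i) (f (i + 1))) ∧
      ((Finset.range l).filter fun i => (f i).relIndex (f (i + 1)) = p).card = n := by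
  induction h with
  | refl => exact ⟨0, fun _ => H, rfl, rfl, by simp, by simp⟩
  | @step K L n _ hKL ih =>
    obtain ⟨l, f, h0, hl, hf, hn⟩ := ih
    obtain ⟨g, hg, hgl⟩ : ∃ g : ℕ → Subgroup G, (∀ i ≤ l, g i = f i) ∧ g (l + 1) = L :=
      -- Values of `f` beyond index `l` carry no information, so overwriting at `l + 1` is harmless.
      ⟨Function.update f (l + 1) L, fun i hi => Function.update_of_ne (by omega) _ _, by simp⟩
    refine ⟨l + 1, g, (hg 0 (by omega)).trans h0, hgl, ?_, ?_⟩
    · intro i hi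
      rcases Nat.lt_succ_iff_lt_or_eq.1 hi with hi | rfl
      · rw [hg i hi.le, hg (i + 1) hi]
        exact hf i hi
      · rwa [hg i le_rfl, hgl, hl]
    · rw [Finset.range_add_one, Finset.filter_insert, hg l le_rfl, hgl, hl]
      have : ((Finset.range l).filter fun i => (g i).relIndex (g (i + 1)) = p)
          = (Finset.range l).filter fun i => (f i).relIndex (f (i + 1)) = p := by
        refine Finset.filter_congr fun i hi => ?_
        rw [Finset.mem_range] at hi
        rw [hg i hi.le, hg (i + 1) hi]
      rw [this]
      split_ifs with hp
      · rw [Finset.card_insert_of_notMem (by simp), hn]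
      · rw [hn, add_zero]

/-- By Jordan–Hölder any single chain computes `cp`; this is how the later counts reach its
definition. -/
theorem cp_eq {n : ℕ} (h : FactorChain p (⊥ : Subgroup G) ⊤ n) : cp p G = n := by
  obtain ⟨l, f, h0, hl, hf, hn⟩ := h.exists_sequence
  let _ := subgroupJordanHolder G
  let s : CompositionSeries (Subgroup G) :=
    { length := l
      toFun := fun i => f i
      step := fun i => hf i i.2 }
  rw [cp_eq_primeFactorCount p s ⟨h0, hl⟩, ← hn]
  change Nat.card {i : Fin l // (f i).relIndex (f (i + 1)) = p} = _
  rw [Nat.card_eq_fintype_card, Fintype.card_subtype]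
  refine Finset.card_bij (fun i _ => i.val) ?_ ?_ ?_
  · intro i hi
    simpa using hi
  · intro i _ j _ hij
    exact Fin.ext hij
  · intro i hi
    rw [Finset.mem_filter, Finset.mem_range] at hi
    exact ⟨⟨i, hi.1⟩, by simpa using hi.2, rfl⟩

theorem trans {H K L : Subgroup G} {m n : ℕ} (h : FactorChain p H K m)
    (h' : FactorChain p K L n) : FactorChain p H L (m + n) := by
  induction h' with
  | refl => exact h
  | step _ hKL ih => rw [← add_assoc]; exact ih.step hKL

end FactorChain

/-! ### Transport of chains along homomorphisms -/

/-- Normalizers in the ambient group behave better under images and preimages than normality inside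
a subgroup. -/
theorem isMaximalNormalIn_iff {G : Type*} [Group G] {H K : Subgroup G} :
    IsMaximalNormalIn H K ↔ H < K ∧ K ≤ Subgroup.normalizer (H : Set G) ∧
      ∀ N : Subgroup G, H ≤ N → N ≤ K → K ≤ Subgroup.normalizer (N : Set G) → N = H ∨ N = K := by
  constructor
  · exact fun h => ⟨h.1, h.le_normalizer, fun N h1 h2 h3 =>
      h.2.2 N h1 h2 ((Subgroup.normal_subgroupOf_iff_le_normalizer h2).2 h3)⟩
  · exact fun h => ⟨h.1, (Subgroup.normal_subgroupOf_iff_le_normalizer h.1.le).2 h.2.1,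
      fun N h1 h2 h3 =>
        h.2.2 N h1 h2 ((Subgroup.normal_subgroupOf_iff_le_normalizer h2).1 h3)⟩

theorem IsMaximalNormalIn.map {G Q : Type*} [Group G] [Group Q] {f : G →* Q}
    (hf : Function.Injective f) {H K : Subgroup G} (h : IsMaximalNormalIn H K) :
    IsMaximalNormalIn (H.map f) (K.map f) := by
  rw [isMaximalNormalIn_iff] at h ⊢
  refine ⟨(Subgroup.map_lt_map_iff_of_injective hf).2 h.1,
    (Subgroup.map_mono h.2.1).trans (Subgroup.le_normalizer_map f), fun N h1 h2 h3 => ?_⟩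
  have hN : (N.comap f).map f = N :=
    Subgroup.map_comap_eq_self (h2.trans (Subgroup.map_le_range f K))
  have key := h.2.2 (N.comap f) (Subgroup.map_le_iff_le_comap.1 h1) ?_ ?_
  · rw [← hN]
    exact key.imp (congrArg _) (congrArg _)
  · rw [← Subgroup.comap_map_eq_self_of_injective hf K]
    exact Subgroup.comap_mono h2
  · exact (Subgroup.map_le_iff_le_comap.1 h3).trans (Subgroup.le_normalizer_comap f)

theorem IsMaximalNormalIn.comap {G Q : Type*} [Group G] [Group Q] {f : G →* Q}
    (hf : Function.Surjective f) {H K : Subgroup Q} (h : IsMaximalNormalIn H K) :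
    IsMaximalNormalIn (H.comap f) (K.comap f) := by
  rw [isMaximalNormalIn_iff] at h ⊢
  refine ⟨(Subgroup.comap_lt_comap_of_surjective hf).2 h.1,
    (Subgroup.comap_mono h.2.1).trans (Subgroup.le_normalizer_comap f), fun N h1 h2 h3 => ?_⟩
  -- Correspondence theorem: `N` contains a preimage, hence the kernel, and is recovered from its
  -- image.
  have hN : (N.map f).comap f = N := by
    refine Subgroup.comap_map_eq_self ((?_ : f.ker ≤ H.comap f).trans h1)
    rw [← MonoidHom.comap_bot]
    exact Subgroup.comap_mono bot_le
  have key := h.2.2 (N.map f) ?_ (Subgroup.map_le_iff_le_comap.2 h2) ?_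
  · rw [← hN]
    exact key.imp (congrArg _) (congrArg _)
  · rw [← Subgroup.map_comap_eq_self_of_surjective hf H]
    exact Subgroup.map_mono h1
  · rw [← Subgroup.map_comap_eq_self_of_surjective hf K]
    exact (Subgroup.map_mono h3).trans (Subgroup.le_normalizer_map f)

theorem Subgroup.relIndex_map_map_eq_of_injective {G Q : Type*} [Group G] [Group Q] {f : G →* Q}
    (hf : Function.Injective f) (H K : Subgroup G) :
    (H.map f).relIndex (K.map f) = H.relIndex K := by
  rw [← Subgroup.relIndex_comap, Subgroup.comap_map_eq_self_of_injective hf]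

theorem Subgroup.relIndex_comap_comap_of_surjective {G Q : Type*} [Group G] [Group Q] {f : G →* Q}
    (hf : Function.Surjective f) (H K : Subgroup Q) :
    (H.comap f).relIndex (K.comap f) = H.relIndex K := by
  rw [Subgroup.relIndex_comap, Subgroup.map_comap_eq_self_of_surjective hf]

namespace FactorChain

variable {p : ℕ} {G Q : Type*} [Group G] [Group Q]

theorem map {f : G →* Q} (hf : Function.Injective f) {H K : Subgroup G} {n : ℕ}
    (h : FactorChain p H K n) : FactorChain p (H.map f) (K.map f) n := by
  induction h with
  | refl => exact refl
  | @step K L n _ hKL ih =>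
    rw [← Subgroup.relIndex_map_map_eq_of_injective hf K L]
    exact ih.step (hKL.map hf)

theorem comap {f : G →* Q} (hf : Function.Surjective f) {H K : Subgroup Q} {n : ℕ}
    (h : FactorChain p H K n) : FactorChain p (H.comap f) (K.comap f) n := by
  induction h with
  | refl => exact refl
  | @step K L n _ hKL ih =>
    rw [← Subgroup.relIndex_comap_comap_of_surjective hf K L]
    exact ih.step (hKL.comap hf)

/-- Among the proper subgroups of `K` that `K` normalizes, a maximal one gives a simple top factor;
well-founded induction continues below it. -/
theorem exists_bot (p : ℕ) [Finite G] (K : Subgroup G) :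
    ∃ n, FactorChain p (⊥ : Subgroup G) K n := by
  induction K using WellFoundedLT.induction with
  | ind K ih =>
    by_cases hK : K = ⊥
    · exact ⟨0, hK ▸ refl⟩
    · let S : Set (Subgroup G) := {H | H < K ∧ K ≤ Subgroup.normalizer (H : Set G)}
      have hbot : (⊥ : Subgroup G) ∈ S := by
        refine ⟨bot_lt_iff_ne_bot.2 hK, ?_⟩
        rw [Subgroup.normalizer_eq_top]
        exact le_top
      obtain ⟨H, hH⟩ := (Set.toFinite S).exists_maximal ⟨_, hbot⟩
      obtain ⟨n, hn⟩ := ih H hH.prop.1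
      refine ⟨_, hn.step (isMaximalNormalIn_iff.2 ⟨hH.prop.1, hH.prop.2, fun N h1 h2 h3 => ?_⟩)⟩
      rcases h2.eq_or_lt with h | h
      · exact Or.inr h
      · exact Or.inl (le_antisymm (hH.le_of_ge ⟨h, h3⟩ h1) h1)

theorem exists_cp (p : ℕ) (G : Type*) [Group G] [Finite G] :
    FactorChain p (⊥ : Subgroup G) ⊤ (cp p G) := by
  obtain ⟨n, hn⟩ := exists_bot p (⊤ : Subgroup G)
  rwa [hn.cp_eq]

theorem eq_zero_of_not_dvd [Finite G] {H K : Subgroup G} {n : ℕ} (h : FactorChain p H K n)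
    (hp : ¬ p ∣ Nat.card G) : n = 0 := by
  induction h with
  | refl => rfl
  | @step K L n _ hKL ih =>
    rw [ih, if_neg]
    rintro rfl
    exact hp ((Subgroup.relIndex_dvd_card K L).trans (Subgroup.card_subgroup_dvd_card L))

end FactorChain

/-! ### Additivity of the number of factors of order p -/

section Additivity

variable {p : ℕ} {G Q : Type*} [Group G] [Group Q]

/-- A chain of the kernel, pushed along the inclusion, is continued by the preimage of a chain of
the quotient. -/
theorem cp_eq_ker_add [Finite G] {f : G →* Q} (hf : Function.Surjective f) :
    cp p G = cp p f.ker + cp p Q := by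
  have := Finite.of_surjective f hf
  refine FactorChain.cp_eq (FactorChain.trans (K := f.ker) ?_ ?_)
  · have h := (FactorChain.exists_cp p f.ker).map f.ker.subtype_injective
    rwa [Subgroup.map_bot, ← MonoidHom.range_eq_map, Subgroup.range_subtype] at h
  · have h := (FactorChain.exists_cp p Q).comap hf
    rwa [MonoidHom.comap_bot, Subgroup.comap_top] at h

theorem cp_congr [Finite G] (e : G ≃* Q) : cp p G = cp p Q := by
  have h := (FactorChain.exists_cp p G).map (f := e.toMonoidHom) e.injective
  rw [Subgroup.map_bot, Subgroup.map_top_of_surjective _ e.surjective] at h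
  exact h.cp_eq.symm

theorem cp_eq_zero_of_not_dvd [Finite G] (hp : ¬ p ∣ Nat.card G) : cp p G = 0 :=
  (FactorChain.exists_cp p G).eq_zero_of_not_dvd hp

theorem cp_eq_one_of_card_eq [Fact p.Prime] (hG : Nat.card G = p) : cp p G = 1 := by
  have : Fact (Nat.card G).Prime := hG ▸ ‹_›
  have hfin : Finite G := Nat.finite_of_card_ne_zero this.out.ne_zero
  have hs : IsMaximalNormalIn (⊥ : Subgroup G) ⊤ := by
    have : Nontrivial G := Finite.one_lt_card_iff_nontrivial.1 this.out.one_lt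
    exact isMaximalNormalIn_iff.2 ⟨bot_lt_top, by rw [Subgroup.normalizer_eq_top],
      fun N _ _ _ => Subgroup.eq_bot_or_eq_top_of_prime_card N⟩
  have h := (FactorChain.refl (p := p) (H := (⊥ : Subgroup G))).step hs
  rw [if_pos (by rw [Subgroup.relIndex_top_right, Subgroup.index_bot, hG])] at h
  exact h.cp_eq

theorem cp_eq_of_subsingleton [Subsingleton G] : cp p G = 0 := by
  refine FactorChain.cp_eq ?_
  rw [Subsingleton.elim (⊤ : Subgroup G) ⊥]
  exact FactorChain.refl

theorem cp_prod [Finite G] [Finite Q] : cp p (G × Q) = cp p G + cp p Q := by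
  rw [cp_eq_ker_add (p := p) (f := MonoidHom.fst G Q) Prod.fst_surjective, add_comm]
  congr 1
  refine (cp_congr
    { toFun := fun b => ⟨((1 : G), b), (rfl : (1 : G) = 1)⟩
      invFun := fun z => z.1.2
      left_inv := fun b => rfl
      right_inv := ?_
      map_mul' := fun x y => Subtype.ext (Prod.ext (one_mul (1 : G)).symm rfl) }).symm
  rintro ⟨⟨a, b⟩, h⟩
  obtain rfl : a = 1 := h
  rfl

theorem cp_pi_fin [Finite G] (n : ℕ) : cp p (Fin n → G) = n * cp p G := by
  induction n with
  | zero => rw [cp_eq_of_subsingleton, zero_mul]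
  | succ n ih =>
    have e : (Fin (n + 1) → G) ≃* G × (Fin n → G) :=
      { (Fin.consEquiv fun _ => G).symm with map_mul' := fun _ _ => rfl }
    rw [cp_congr e, cp_prod, ih]
    ring

theorem cp_pi (ι : Type*) [Finite ι] [Finite G] : cp p (ι → G) = Nat.card ι * cp p G := by
  rw [← cp_pi_fin]
  exact cp_congr (MulEquiv.arrowCongr (Finite.equivFin ι) (MulEquiv.refl G))

/-- The kernel of the projection to the top group is the base group `Q → G`. -/
theorem cp_regularWreathProduct [Finite G] [Finite Q] :
    cp p (RegularWreathProduct G Q) = Nat.card Q * cp p G + cp p Q := by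
  have hs : Function.Surjective (RegularWreathProduct.rightHom (D := G) (Q := Q)) :=
    fun q => ⟨⟨1, q⟩, rfl⟩
  rw [cp_eq_ker_add hs, ← cp_pi]
  congr 1
  refine (cp_congr
    { toFun := fun f => ⟨⟨f, 1⟩, rfl⟩
      invFun := fun w => w.1.left
      left_inv := fun f => rfl
      right_inv := ?_
      map_mul' := ?_ }).symm
  · rintro ⟨⟨f, q⟩, h⟩
    obtain rfl : q = 1 := h
    rfl
  · intro f g
    ext <;> simp

theorem cp_semidirectProduct [Finite G] [Finite Q] (φ : Q →* MulAut G) :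
    cp p (G ⋊[φ] Q) = cp p G + cp p Q := by
  have : Finite (G ⋊[φ] Q) := Finite.of_equiv _ SemidirectProduct.equivProd.symm
  rw [cp_eq_ker_add SemidirectProduct.rightHom_surjective]
  congr 1
  rw [← SemidirectProduct.range_inl_eq_ker_rightHom]
  exact (cp_congr (MonoidHom.ofInjective SemidirectProduct.inl_injective)).symm

theorem cp_eq_of_card_eq_pow [hp : Fact p.Prime] (n : ℕ) :
    ∀ (G : Type*) [Group G], Nat.card G = p ^ n → cp p G = n := by
  induction n with
  | zero =>
    intro G _ hG
    have := (Nat.card_eq_one_iff_unique.1 hG).1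
    exact cp_eq_of_subsingleton
  | succ n ih =>
    intro G _ hG
    have hfin : Finite G := Nat.finite_of_card_ne_zero (hG ▸ (pow_pos hp.out.pos _).ne')
    obtain ⟨H, hH⟩ := Sylow.exists_subgroup_card_pow_prime p (G := G) (n := n)
      (hG ▸ pow_dvd_pow p n.le_succ)
    have hi : H.index = p := by
      have := H.card_mul_index
      rw [hH, hG, pow_succ] at this
      exact Nat.eq_of_mul_eq_mul_left (pow_pos hp.out.pos n) this
    -- A subgroup whose index is the smallest prime divisor of the group order is normal.
    have hN : H.Normal := Subgroup.normal_of_index_eq_minFac_card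
      (by rw [hG, hi, Nat.Prime.pow_minFac hp.out n.succ_ne_zero])
    rw [cp_eq_ker_add (QuotientGroup.mk'_surjective H), QuotientGroup.ker_mk', ih H hH,
      cp_eq_one_of_card_eq (by rw [← hi]; rfl)]

end Additivity

/-! ### Irreducible matrix groups -/

section Irreducible

variable {ι κ F : Type*} [Fintype ι] [DecidableEq ι] [Fintype κ] [DecidableEq κ] [Field F]

theorem naturalRep_apply (Γ : Subgroup (GL ι F)) (g : Γ) (v : ι → F) :
    naturalRep Γ g v = (g : GL ι F).1.mulVec v := rfl

/-- Trades subrepresentations for invariant subspaces; `Nonempty ι` encodes that the module is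
nonzero. -/
theorem isIrreducibleGroup_iff {Γ : Subgroup (GL ι F)} :
    IsIrreducibleGroup Γ ↔ Nonempty ι ∧ ∀ W : Submodule F (ι → F),
      (∀ g ∈ Γ, ∀ w ∈ W, g.1.mulVec w ∈ W) → W = ⊥ ∨ W = ⊤ := by
  constructor
  · intro h
    refine ⟨?_, fun W hW => ?_⟩
    · by_contra hι
      rw [not_nonempty_iff] at hι
      obtain ⟨a, b, hab⟩ := h.toNontrivial
      refine hab (Subrepresentation.toSubmodule_injective ?_)
      exact Subsingleton.elim _ _
    · let S : Subrepresentation (naturalRep Γ) := ⟨W, fun g w hw => hW g g.2 w hw⟩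
      exact (h.eq_bot_or_eq_top S).imp (congrArg Subrepresentation.toSubmodule)
        (congrArg Subrepresentation.toSubmodule)
  · rintro ⟨hι, h⟩
    refine { exists_pair_ne := ⟨⊥, ⊤, fun h => ?_⟩, eq_bot_or_eq_top := fun S => ?_ }
    · have h' : (⊥ : Submodule F (ι → F)) = ⊤ := congrArg Subrepresentation.toSubmodule h
      exact bot_ne_top h'
    · exact (h S.toSubmodule fun g hg w hw => S.apply_mem_toSubmodule ⟨g, hg⟩ hw).imp
        (fun h => Subrepresentation.toSubmodule_injective h)
        (fun h => Subrepresentation.toSubmodule_injective h)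

/-- If the matrices in `Γ` span the full matrix algebra, then `Γ` is irreducible over every
extension of the ground field. -/
theorem isIrreducibleGroup_extendScalars_of_span_eq_top [Nonempty ι] {k : Type*} [Field k]
    {Γ : Subgroup (GL ι k)}
    (h : Submodule.span k {A : Matrix ι ι k | ∃ g ∈ Γ, (g : Matrix ι ι k) = A} = ⊤) (i : k →+* F) :
    IsIrreducibleGroup (extendScalars i Γ) := by
  refine isIrreducibleGroup_iff.2 ⟨‹_›, fun W hW => ?_⟩
  -- Invariance under `Γ` extends linearly to every matrix with entries in the small field; the
  -- matrix units among them suffice.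
  have key : ∀ A : Matrix ι ι k, ∀ w ∈ W, (A.map i).mulVec w ∈ W := by
    intro A w hw
    have hA : A ∈ Submodule.span k {A : Matrix ι ι k | ∃ g ∈ Γ, (g : Matrix ι ι k) = A} :=
      h ▸ Submodule.mem_top
    induction hA using Submodule.span_induction with
    | mem A hA =>
      obtain ⟨g, hg, rfl⟩ := hA
      exact hW _ (Subgroup.mem_map_of_mem _ hg) w hw
    | zero => simp
    | add A B _ _ hA hB =>
      rw [Matrix.map_add _ (map_add i), Matrix.add_mulVec]
      exact W.add_mem hA hB
    | smul c A _ hA =>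
      have : (c • A).map i = i c • A.map i := by
        ext
        simp
      rw [this, Matrix.smul_mulVec]
      exact W.smul_mem _ hA
  refine or_iff_not_imp_left.2 fun hbot => ?_
  obtain ⟨w, hw, hw0⟩ := W.ne_bot_iff.1 hbot
  obtain ⟨b, hb⟩ := Function.ne_iff.1 hw0
  refine Submodule.eq_top_iff_forall_basis_mem (Pi.basisFun F ι) |>.2 fun a => ?_
  -- The matrix unit moves the nonzero coordinate `w b` to place `a` and kills the rest; rescaling
  -- gives the `a`-th basis vector.
  have h1 := W.smul_mem (w b)⁻¹ (key (Matrix.single a b 1) w hw)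
  convert h1 using 1
  ext c
  rw [Matrix.map_single, map_one, Matrix.single_mulVec]
  by_cases hca : c = a
  · subst hca
    simpa using (inv_mul_cancel₀ hb).symm
  · simp [hca]

theorem isAbsolutelyIrreducibleGroup_of_span_eq_top [Nonempty ι] {Γ : Subgroup (GL ι F)}
    (h : Submodule.span F {A : Matrix ι ι F | ∃ g ∈ Γ, (g : Matrix ι ι F) = A} = ⊤) :
    IsAbsolutelyIrreducibleGroup Γ :=
  isIrreducibleGroup_extendScalars_of_span_eq_top h _

theorem extendScalars_mulEquiv {k : Type*} [Field k] (i : k →+* F) (Γ : Subgroup (GL ι k)) :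
    Nonempty (Γ ≃* extendScalars i Γ) :=
  ⟨Γ.equivMapOfInjective _ (Units.map_injective (Matrix.map_injective i.injective))⟩

/-! ### Relabelling -/

/-- Relabelling of coordinate vectors. -/
def reindexVec (F : Type*) [Field F] (e : ι ≃ κ) : (ι → F) ≃ₗ[F] (κ → F) := LinearEquiv.funCongrLeft F F e.symm

theorem reindex_mulVec (e : ι ≃ κ) (A : Matrix ι ι F) (v : ι → F) :
    (Matrix.reindexAlgEquiv F F e A).mulVec (reindexVec F e v) = reindexVec F e (A.mulVec v) := by
  ext i
  simp only [reindexVec, Matrix.mulVec, dotProduct, LinearEquiv.funCongrLeft_apply,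
    LinearMap.funLeft_apply, Matrix.coe_reindexAlgEquiv, Matrix.reindex_apply,
    Matrix.submatrix_apply]
  exact Equiv.sum_comp e.symm fun j => A (e.symm i) j * v j

theorem reindexGroup_mulEquiv (e : ι ≃ κ) (Γ : Subgroup (GL ι F)) :
    Nonempty (Γ ≃* reindexGroup e Γ) :=
  ⟨Γ.equivMapOfInjective _ (Units.map_injective (Matrix.reindexAlgEquiv F F e).injective)⟩

theorem IsIrreducibleGroup.reindex {Γ : Subgroup (GL ι F)} (h : IsIrreducibleGroup Γ) (e : ι ≃ κ) :
    IsIrreducibleGroup (reindexGroup e Γ) := by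
  rw [isIrreducibleGroup_iff] at h ⊢
  refine ⟨h.1.map e, fun W hW => ?_⟩
  have hWe : (W.comap (reindexVec F e).toLinearMap).map (reindexVec F e).toLinearMap = W :=
    Submodule.map_comap_eq_self (by simp)
  have hinv : ∀ g ∈ Γ, ∀ w ∈ W.comap (reindexVec F e).toLinearMap,
      g.1.mulVec w ∈ W.comap (reindexVec F e).toLinearMap := by
    intro g hg w hw
    change reindexVec F e (g.1.mulVec w) ∈ W
    rw [← reindex_mulVec]
    exact hW _ (Subgroup.mem_map_of_mem _ hg) _ hw
  rcases h.2 _ hinv with h | h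
  · left; rw [← hWe, h, Submodule.map_bot]
  · right; rw [← hWe, h, Submodule.map_top, LinearEquiv.range]

theorem IsImprimitiveGroup.reindex {Γ : Subgroup (GL ι F)} (h : IsImprimitiveGroup Γ) (e : ι ≃ κ) :
    IsImprimitiveGroup (reindexGroup e Γ) := by
  obtain ⟨hirr, k, W, hk, hW, hint, hperm⟩ := h
  refine ⟨hirr.reindex e, k, fun i => (W i).map (reindexVec F e).toLinearMap, hk, fun i => ?_, ?_, ?_⟩
  · simpa using hW i
  · rw [DirectSum.isInternal_submodule_iff_iSupIndep_and_iSup_eq_top] at hint ⊢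
    refine ⟨hint.1.map_orderIso (Submodule.orderIsoMapComap (reindexVec F e)), ?_⟩
    rw [← Submodule.map_iSup, hint.2, Submodule.map_top, LinearEquiv.range]
  · rintro ⟨_, g, hg, rfl⟩ i
    obtain ⟨j, hj⟩ := hperm ⟨g, hg⟩ i
    refine ⟨j, ?_⟩
    change ((W i).map _).map _ = (W j).map _
    rw [← hj, ← Submodule.map_comp, ← Submodule.map_comp]
    congr 1
    exact LinearMap.ext fun v => reindex_mulVec e g.1 v

end Irreducible

/-! ### Wreath products -/

section Wreath

variable {ι F : Type*} [Fintype ι] [DecidableEq ι] [Field F] {Γ : Subgroup (GL ι F)}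
  {C : Type*} [Group C] [Fintype C] [DecidableEq C]

theorem wreathHom_mulVec (w : RegularWreathProduct Γ C) (u : ι × C → F) (i : ι) (x : C) :
    (wreathHom Γ C w).1.mulVec u (i, x) =
      (w.left x : GL ι F).1.mulVec (fun j => u (j, w.right⁻¹ * x)) i := by
  change ∑ b : ι × C, (if x = w.right * b.2 then ((w.left x : GL ι F) : Matrix ι ι F) i b.1
    else 0) * u b = _
  rw [Fintype.sum_prod_type_right, Finset.sum_eq_single (w.right⁻¹ * x)]
  · simp [Matrix.mulVec, dotProduct]
  · intro c _ hc
    have : ¬ x = w.right * c := by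
      rintro rfl
      exact hc (by group)
    simp [this]
  · simp

theorem wreathHom_injective [Nonempty ι] : Function.Injective (wreathHom Γ C) := by
  intro v w h
  have h' : ∀ (i j : ι) (x y : C),
      (if x = v.right * y then ((v.left x : GL ι F) : Matrix ι ι F) i j else 0) =
      if x = w.right * y then ((w.left x : GL ι F) : Matrix ι ι F) i j else 0 := fun i j x y =>
    congrFun (congrFun (congrArg (fun g : GL (ι × C) F => (g : Matrix (ι × C) (ι × C) F)) h) (i, x)) (j, y)
  have hr : v.right = w.right := by
    by_contra hne
    obtain ⟨i⟩ := ‹Nonempty ι›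
    -- If the top components differed, the block of `v` in position `(v.right, 1)` would be zero in
    -- the matrix of `w`, although it is invertible.
    have h0 : ((v.left v.right : GL ι F) : Matrix ι ι F).mulVec (Pi.single i 1) = 0 := by
      ext j
      have := h' j i v.right 1
      simpa [hne] using this
    have h1 := congrArg ((v.left v.right : GL ι F)⁻¹.1.mulVec) h0
    rw [Matrix.mulVec_mulVec, Units.inv_mul, Matrix.one_mulVec, Matrix.mulVec_zero] at h1
    simpa using congrFun h1 i
  refine RegularWreathProduct.ext (funext fun x => ?_) hr
  ext i j
  simpa [hr] using h' i j x (v.right⁻¹ * x)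

/-- The vector with block `v` at position `c` and zero elsewhere. -/
def blockVec (F : Type*) [Field F] {ι C : Type*} [DecidableEq C] (c : C) :
    (ι → F) →ₗ[F] (ι × C → F) where
  toFun v a := if a.2 = c then v a.1 else 0
  map_add' u v := by
    ext a
    by_cases h : a.2 = c <;> simp [h]
  map_smul' r v := by
    ext a
    by_cases h : a.2 = c <;> simp [h]

theorem blockVec_apply {ι C : Type*} [DecidableEq C] (c x : C) (v : ι → F) (i : ι) :
    blockVec F c v (i, x) = if x = c then v i else 0 := rfl

theorem sum_blockVec {ι C : Type*} [DecidableEq C] [Fintype C] (u : ι × C → F) :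
    ∑ c, blockVec F c (fun i => u (i, c)) = u := by
  ext ⟨i, x⟩
  rw [Finset.sum_apply]
  simp [blockVec_apply]

theorem wreathHom_blockVec (w : RegularWreathProduct Γ C) (c : C) (v : ι → F) :
    (wreathHom Γ C w).1.mulVec (blockVec F c v) =
      blockVec F (w.right * c) ((w.left (w.right * c) : GL ι F).1.mulVec v) := by
  ext ⟨i, x⟩
  rw [wreathHom_mulVec, blockVec_apply]
  by_cases h : x = w.right * c
  · subst h
    simp [blockVec_apply]
  · have h' : ¬ w.right⁻¹ * x = c := by
      rintro rfl
      exact h (by group)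
    simp only [blockVec_apply, h, h', if_false]
    exact congrFun (Matrix.mulVec_zero _) i

/-- The common fixed vectors form an invariant subspace, which can be everything only if `Γ` is
trivial. -/
theorem exists_mulVec_ne (hΓ : IsIrreducibleGroup Γ) (h1 : Γ ≠ ⊥) {v : ι → F} (hv : v ≠ 0) :
    ∃ g ∈ Γ, g.1.mulVec v ≠ v := by
  by_contra! hfix
  let W : Submodule F (ι → F) :=
    { carrier := {u | ∀ g ∈ Γ, g.1.mulVec u = u}
      zero_mem' := fun g _ => Matrix.mulVec_zero _
      add_mem' := fun {a b} ha hb g hg => by rw [Matrix.mulVec_add, ha g hg, hb g hg]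
      smul_mem' := fun c a ha g hg => by rw [Matrix.mulVec_smul, ha g hg] }
  rcases (isIrreducibleGroup_iff.1 hΓ).2 W (fun g hg w hw => by rwa [hw g hg]) with h | h
  · have : v ∈ W := hfix
    rw [h, Submodule.mem_bot] at this
    exact hv this
  · refine h1 (Γ.eq_bot_iff_forall.2 fun g hg => Units.ext (Matrix.toLin'.injective ?_))
    refine LinearMap.ext fun u => ?_
    have hu : u ∈ W := h ▸ Submodule.mem_top
    simpa using hu g hg

/-- Nontriviality of `Γ` isolates a block, irreducibility of `Γ` fills it, and the regular top
action reaches all blocks. -/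
theorem isIrreducibleGroup_wreathHom_range (hΓ : IsIrreducibleGroup Γ) (h1 : Γ ≠ ⊥) :
    IsIrreducibleGroup (wreathHom Γ C).range := by
  have hι := (isIrreducibleGroup_iff.1 hΓ).1
  refine isIrreducibleGroup_iff.2 ⟨inferInstance, fun W hW => or_iff_not_imp_left.2 fun hbot => ?_⟩
  replace hW : ∀ (w : RegularWreathProduct Γ C), ∀ u ∈ W, (wreathHom Γ C w).1.mulVec u ∈ W :=
    fun w u hu => hW _ ⟨w, rfl⟩ u hu
  obtain ⟨u, hu, hu0⟩ := W.ne_bot_iff.1 hbot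
  obtain ⟨⟨i, c⟩, hic⟩ := Function.ne_iff.1 hu0
  obtain ⟨g, hg, hgv⟩ := exists_mulVec_ne hΓ h1 (v := fun j => u (j, c)) (fun h => hic (congrFun h i))
  -- The base element equal to `g` at `c` and to `1` elsewhere changes only block `c` of `u`;
  -- subtracting `u` leaves a vector supported there.
  have hmem : blockVec F c (g.1.mulVec (fun j => u (j, c)) - fun j => u (j, c)) ∈ W := by
    convert W.sub_mem (hW ⟨Function.update 1 c ⟨g, hg⟩, 1⟩ u hu) hu using 1
    ext ⟨j, x⟩
    rw [Pi.sub_apply, wreathHom_mulVec, blockVec_apply]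
    by_cases hx : x = c
    · subst hx
      simp
    · simp [hx]
  have hc : W.comap (blockVec F c) = ⊤ := by
    refine ((isIrreducibleGroup_iff.1 hΓ).2 _ fun g hg v hv => ?_).resolve_left fun h => ?_
    · have := hW ⟨fun _ => ⟨g, hg⟩, 1⟩ _ hv
      rw [wreathHom_blockVec] at this
      simpa using this
    · have : _ ∈ W.comap (blockVec F c) := hmem
      rw [h, Submodule.mem_bot, sub_eq_zero] at this
      exact hgv this
  have hx : ∀ (x : C) (v : ι → F), blockVec F x v ∈ W := by
    intro x v
    have hv : v ∈ W.comap (blockVec F c) := hc ▸ Submodule.mem_top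
    -- The pure top element `x c⁻¹` translates block `c` to block `x`.
    have := hW ⟨1, x * c⁻¹⟩ _ hv
    rw [wreathHom_blockVec] at this
    simpa using this
  refine eq_top_iff.2 fun v _ => ?_
  rw [← sum_blockVec v]
  exact W.sum_mem fun x _ => hx x _

theorem isImprimitiveGroup_wreathHom_range (hΓ : IsIrreducibleGroup Γ) (h1 : Γ ≠ ⊥)
    (hC : 2 ≤ Fintype.card C) : IsImprimitiveGroup (wreathHom Γ C).range := by
  obtain ⟨i⟩ := (isIrreducibleGroup_iff.1 hΓ).1
  let e := Fintype.equivFin C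
  refine ⟨isIrreducibleGroup_wreathHom_range hΓ h1, Fintype.card C,
    fun k => LinearMap.range (blockVec F (ι := ι) (e.symm k)), hC, fun k h => ?_, ?_, ?_⟩
  · have hm : blockVec F (e.symm k) (Pi.single i 1 : ι → F) ∈ (⊥ : Submodule F (ι × C → F)) :=
      h ▸ LinearMap.mem_range_self _ _
    have := congrFun ((Submodule.mem_bot F).1 hm) (i, e.symm k)
    simp [blockVec_apply] at this
  · rw [DirectSum.isInternal_submodule_iff_iSupIndep_and_iSup_eq_top]
    constructor
    · rw [iSupIndep_def]
      intro k
      rw [Submodule.disjoint_def]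
      rintro _ ⟨v, rfl⟩ hv
      let Z : Submodule F (ι × C → F) :=
        { carrier := {u | ∀ j, u (j, e.symm k) = 0}
          zero_mem' := fun _ => rfl
          add_mem' := fun {a b} ha hb j => by rw [Pi.add_apply, ha, hb, add_zero]
          smul_mem' := fun c a ha j => by rw [Pi.smul_apply, ha, smul_zero] }
      -- All other blocks lie in the space `Z` of vectors vanishing on block `k`, which meets block
      -- `k` trivially.
      have hZ : (⨆ j, ⨆ (_ : j ≠ k), LinearMap.range (blockVec F (ι := ι) (e.symm j))) ≤ Z := by
        refine iSup₂_le fun j hj => ?_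
        rintro _ ⟨u, rfl⟩ a
        rw [blockVec_apply, if_neg fun h => hj (e.symm.injective h.symm)]
      ext ⟨a, x⟩
      by_cases hx : x = e.symm k
      · subst hx
        exact hZ hv a
      · simp [blockVec_apply, hx]
    · refine eq_top_iff.2 fun u _ => ?_
      rw [← sum_blockVec u]
      refine Submodule.sum_mem _ fun c _ => ?_
      refine Submodule.mem_iSup_of_mem (e c) ?_
      rw [e.symm_apply_apply]
      exact LinearMap.mem_range_self _ _
  · rintro ⟨_, w, rfl⟩ k
    refine ⟨e (w.right * e.symm k), ?_⟩
    ext u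
    simp only [Submodule.mem_map, LinearMap.mem_range, exists_exists_eq_and, naturalRep_apply,
      wreathHom_blockVec, Equiv.symm_apply_apply]
    constructor
    · rintro ⟨v, rfl⟩
      exact ⟨_, rfl⟩
    · rintro ⟨v, rfl⟩
      refine ⟨(w.left (w.right * e.symm k) : GL ι F)⁻¹.1.mulVec v, ?_⟩
      rw [Matrix.mulVec_mulVec, Units.mul_inv, Matrix.one_mulVec]

end Wreath

theorem cp_reindexGroup (p : ℕ) {F : Type*} [Field F] [Finite F] {ι κ : Type*} [Fintype ι] [DecidableEq ι] [Fintype κ]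
    [DecidableEq κ] (e : ι ≃ κ) (Γ : Subgroup (GL ι F)) : cp p (reindexGroup e Γ) = cp p Γ := by
  obtain ⟨f⟩ := reindexGroup_mulEquiv e Γ
  exact (cp_congr f).symm

section Tower

variable (p : ℕ) [Fact p.Prime] {d : ℕ} {F : Type*} [Field F]

theorem isIrreducibleGroup_wreathCyclic {Γ : Subgroup (GL (Fin d) F)}
    (hΓ : IsIrreducibleGroup Γ) (h1 : Γ ≠ ⊥) : IsIrreducibleGroup (wreathCyclic p Γ) :=
  (isIrreducibleGroup_wreathHom_range hΓ h1).reindex _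

theorem isImprimitiveGroup_wreathCyclic {Γ : Subgroup (GL (Fin d) F)}
    (hΓ : IsIrreducibleGroup Γ) (h1 : Γ ≠ ⊥) : IsImprimitiveGroup (wreathCyclic p Γ) :=
  (isImprimitiveGroup_wreathHom_range hΓ h1 (by
    rw [Fintype.card_multiplicative, ZMod.card]
    exact (Fact.out : p.Prime).two_le)).reindex _

/-- Positive dimension matters here: for `d = 0` the matrix group is trivial while the wreath
product is not. -/
theorem wreathCyclic_mulEquiv [NeZero d] (Γ : Subgroup (GL (Fin d) F)) :
    Nonempty (RegularWreathProduct Γ (Multiplicative (ZMod p)) ≃* wreathCyclic p Γ) := by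
  obtain ⟨e⟩ := reindexGroup_mulEquiv (((Equiv.refl (Fin d)).prodCongr
      (Multiplicative.toAdd.trans (ZMod.finEquiv p).symm.toEquiv)).trans finProdFinEquiv)
    (wreathHom Γ (Multiplicative (ZMod p))).range
  exact ⟨(MonoidHom.ofInjective wreathHom_injective).trans e⟩

theorem cp_wreathCyclic [NeZero d] [Finite F] (Γ : Subgroup (GL (Fin d) F)) :
    cp p (wreathCyclic p Γ) = p * cp p Γ + 1 := by
  obtain ⟨e⟩ := wreathCyclic_mulEquiv p Γ
  have hc : Nat.card (Multiplicative (ZMod p)) = p := by simp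
  rw [← cp_congr e, cp_regularWreathProduct, hc, cp_eq_one_of_card_eq hc]

theorem wreathCyclic_ne_bot [NeZero d] {Γ : Subgroup (GL (Fin d) F)} (h1 : Γ ≠ ⊥) :
    wreathCyclic p Γ ≠ ⊥ := by
  obtain ⟨e⟩ := wreathCyclic_mulEquiv p Γ
  intro h
  obtain ⟨g, hg, hne⟩ := Γ.bot_or_exists_ne_one.resolve_left h1
  have : Subsingleton (wreathCyclic p Γ) := by rw [h]; infer_instance
  have h2 := e.injective (Subsingleton.elim (e ⟨fun _ => ⟨g, hg⟩, 1⟩) (e 1))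
  exact hne (congrArg Subtype.val (congrFun (congrArg RegularWreathProduct.left h2) 1))

theorem reindexGroup_ne_bot {ι κ : Type*} [Fintype ι] [DecidableEq ι] [Fintype κ] [DecidableEq κ]
    {Γ : Subgroup (GL ι F)} (h1 : Γ ≠ ⊥) (e : ι ≃ κ) : reindexGroup e Γ ≠ ⊥ := fun h =>
  h1 ((Subgroup.map_eq_bot_iff_of_injective Γ
    (Units.map_injective (Matrix.reindexAlgEquiv F F e).injective)).1 h)

variable {r : ℕ} {Γ : Subgroup (GL (Fin r) F)}

/-- Nontriviality must be carried up the tower because each irreducibility step needs it. -/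
theorem wreathTower_ne_bot [NeZero r] (h1 : Γ ≠ ⊥) (n : ℕ) : wreathTower p Γ n ≠ ⊥ := by
  induction n with
  | zero => exact reindexGroup_ne_bot h1 _
  | succ n ih =>
    have : NeZero (r * p ^ n) := ⟨mul_ne_zero (NeZero.ne r) (pow_ne_zero _ (NeZero.ne p))⟩
    exact reindexGroup_ne_bot (wreathCyclic_ne_bot p ih) _

theorem neZero_of_isIrreducibleGroup (hΓ : IsIrreducibleGroup Γ) : NeZero r :=
  ⟨by rintro rfl; exact (isIrreducibleGroup_iff.1 hΓ).1.elim fun i => i.elim0⟩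

theorem isIrreducibleGroup_wreathTower (hΓ : IsIrreducibleGroup Γ) (h1 : Γ ≠ ⊥) (n : ℕ) :
    IsIrreducibleGroup (wreathTower p Γ n) := by
  have := neZero_of_isIrreducibleGroup hΓ
  induction n with
  | zero => exact hΓ.reindex _
  | succ n ih => exact (isIrreducibleGroup_wreathCyclic p ih (wreathTower_ne_bot p h1 n)).reindex _

theorem isImprimitiveGroup_wreathTower (hΓ : IsIrreducibleGroup Γ) (h1 : Γ ≠ ⊥) {n : ℕ}
    (hn : 1 ≤ n) : IsImprimitiveGroup (wreathTower p Γ n) := by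
  have := neZero_of_isIrreducibleGroup hΓ
  obtain ⟨n, rfl⟩ := Nat.exists_eq_add_of_le' hn
  exact (isImprimitiveGroup_wreathCyclic p (isIrreducibleGroup_wreathTower p hΓ h1 n)
    (wreathTower_ne_bot p h1 n)).reindex _

/-- The recursion `a ↦ p a + 1` multiplies `a (p - 1) + 1` by `p`. -/
theorem cp_wreathTower [NeZero r] [Finite F] (Γ : Subgroup (GL (Fin r) F)) (n : ℕ) :
    (cp p (wreathTower p Γ n) : ℚ) = ((cp p Γ * (p - 1) + 1) * p ^ n - 1) / (p - 1) := by
  have hp : (p : ℚ) - 1 ≠ 0 := sub_ne_zero.2 (by exact_mod_cast (Fact.out : p.Prime).ne_one)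
  induction n with
  | zero =>
    have : wreathTower p Γ 0 = reindexGroup (finCongr (by simp)) Γ := rfl
    rw [this, cp_reindexGroup]
    field_simp
    ring
  | succ n ih =>
    have : NeZero (r * p ^ n) := ⟨mul_ne_zero (NeZero.ne r) (pow_ne_zero _ (NeZero.ne p))⟩
    have : wreathTower p Γ (n + 1) = reindexGroup (finCongr (by rw [pow_succ, mul_assoc]))
      (wreathCyclic p (wreathTower p Γ n)) := rfl
    rw [this, cp_reindexGroup, cp_wreathCyclic]
    push_cast
    rw [ih]
    field_simp
    ring

end Tower

/-- The common frame of the three examples: spanning gives irreducibility over `F`, and extending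
scalars does not change the abstract group. -/
theorem wreathTower_extendScalars_of_span_eq_top (p : ℕ) [Fact p.Prime] {r : ℕ} [NeZero r]
    {k F : Type*} [Field k] [Field F] [Finite F] {Γ : Subgroup (GL (Fin r) k)}
    (h : Submodule.span k {A : Matrix (Fin r) (Fin r) k | ∃ g ∈ Γ, (g : Matrix _ _ k) = A} = ⊤)
    (h1 : Γ ≠ ⊥) (i : k →+* F) (n : ℕ) :
    IsIrreducibleGroup (wreathTower p (extendScalars i Γ) n) ∧
    (cp p (wreathTower p (extendScalars i Γ) n) : ℚ) =
      ((cp p Γ * (p - 1) + 1) * p ^ n - 1) / (p - 1) := by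
  have h2 : extendScalars i Γ ≠ ⊥ := fun h => h1 ((Subgroup.map_eq_bot_iff_of_injective Γ
    (Units.map_injective (Matrix.map_injective i.injective))).1 h)
  have hk : Finite k := Finite.of_injective i i.injective
  obtain ⟨e⟩ := extendScalars_mulEquiv i Γ
  refine ⟨isIrreducibleGroup_wreathTower p
    (isIrreducibleGroup_extendScalars_of_span_eq_top h i) h2 n, ?_⟩
  rw [cp_wreathTower, ← cp_congr e]

/-! ### The groups `ΓL(1, K)` -/

section GammaL

variable (k K : Type*) [Field k] [Field K] [Algebra k K]

/-- Multiplication by units, as linear bijections. -/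
noncomputable def unitMulHom : Kˣ →* LinearMap.GeneralLinearGroup k K :=
  Units.map (Algebra.lmul k K).toRingHom.toMonoidHom

/-- Field automorphisms, as linear bijections. -/
def algEquivHom : (K ≃ₐ[k] K) →* LinearMap.GeneralLinearGroup k K :=
  (AlgEquiv.toLinearMapHom k K).toHomUnits

/-- The action of the Galois group on the units. -/
def algEquivUnitsHom : (K ≃ₐ[k] K) →* MulAut Kˣ where
  toFun σ := Units.mapEquiv σ.toMulEquiv
  map_one' := by ext; rfl
  map_mul' _ _ := by ext; rfl

/-- The semilinear bijections from the semidirect product of units and automorphisms. -/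
noncomputable def gammaLOneHom :
    Kˣ ⋊[algEquivUnitsHom k K] (K ≃ₐ[k] K) →* LinearMap.GeneralLinearGroup k K :=
  SemidirectProduct.lift (unitMulHom k K) (algEquivHom k K) (by
    intro σ
    ext u : 1
    refine eq_mul_inv_of_mul_eq (Units.ext (LinearMap.ext fun x => ?_))
    exact (map_mul σ (u : K) x).symm)

theorem gammaLOneHom_apply (w : Kˣ ⋊[algEquivUnitsHom k K] (K ≃ₐ[k] K)) (x : K) :
    (gammaLOneHom k K w).1 x = w.left * w.right x := rfl

theorem gammaLOneHom_injective : Function.Injective (gammaLOneHom k K) := by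
  refine (injective_iff_map_eq_one _).2 fun w hw => ?_
  have h : ∀ x, (w.left : K) * w.right x = x := fun x => by
    rw [← gammaLOneHom_apply, hw]
    rfl
  have h1 : (w.left : K) = 1 := by simpa using h 1
  refine SemidirectProduct.ext (Units.ext h1) (AlgEquiv.ext fun x => ?_)
  simpa [h1] using h x

theorem gammaLOneHom_range : (gammaLOneHom k K).range = gammaLOne k K := by
  ext T
  constructor
  · rintro ⟨w, rfl⟩
    refine ⟨w.right.toRingEquiv, fun c x => ?_⟩
    simp only [gammaLOneHom_apply, map_mul]
    exact mul_left_comm _ _ _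
  · rintro ⟨σ, hσ⟩
    have h0 : T.1 1 ≠ 0 := fun h => by
      have h1 : (T⁻¹).1 (T.1 1) = 1 := by
        rw [← Module.End.mul_apply, Units.inv_mul, Module.End.one_apply]
      rw [h, map_zero] at h1
      exact zero_ne_one h1
    -- For `c` in `k`, linearity and semilinearity give `c T(1) = σ(c) T(1)` with `T(1) ≠ 0`.
    have hk : ∀ c : k, σ (algebraMap k K c) = algebraMap k K c := fun c => by
      have h1 := hσ (algebraMap k K c) 1
      rw [← Algebra.smul_def, map_smul, Algebra.smul_def] at h1
      exact (mul_right_cancel₀ h0 h1).symm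
    -- Semilinearity at `1` gives `T(x) = σ(x) T(1)`, so the unit is `T(1)`.
    refine ⟨⟨Units.mk0 _ h0, AlgEquiv.ofRingEquiv (f := σ) hk⟩, Units.ext (LinearMap.ext fun x => ?_)⟩
    have := hσ x 1
    rw [mul_one] at this
    rw [gammaLOneHom_apply, this, mul_comm]
    rfl

theorem gammaLOne_mulEquiv :
    Nonempty (Kˣ ⋊[algEquivUnitsHom k K] (K ≃ₐ[k] K) ≃* gammaLOne k K) := by
  rw [← gammaLOneHom_range]
  exact ⟨MonoidHom.ofInjective (gammaLOneHom_injective k K)⟩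

/-- By Dedekind the `[K : k]` embeddings are `K`-independent in a space of `K`-dimension `[K : k]`.
So every endomorphism is a sum of terms `c σ`, and each nonzero term already belongs to `ΓL(1, K)`.
-/
theorem span_gammaLOne_eq_top [Finite K] :
    Submodule.span k {T : K →ₗ[k] K | ∃ g ∈ gammaLOne k K, g.1 = T} = ⊤ := by
  have : Finite k := Finite.of_injective _ (algebraMap k K).injective
  have hfin : Module.Finite k K := inferInstance
  have hspan : Submodule.span K (Set.range (AlgHom.toLinearMap : (K →ₐ[k] K) → K →ₗ[k] K)) = ⊤ := by
    have := Fintype.ofFinite (K →ₐ[k] K)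
    refine (linearIndependent_toLinearMap k K K).span_eq_top_of_card_eq_finrank' ?_
    rw [Module.finrank_linearMap_self, Fintype.card_eq_nat_card,
      FiniteField.natCard_algHom_of_finrank_dvd dvd_rfl]
  refine eq_top_iff.2 fun T _ => ?_
  have hT : T ∈ Submodule.span K (Set.range (AlgHom.toLinearMap : (K →ₐ[k] K) → K →ₗ[k] K)) :=
    hspan ▸ Submodule.mem_top
  rw [Finsupp.mem_span_range_iff_exists_finsupp] at hT
  obtain ⟨c, rfl⟩ := hT
  refine Submodule.sum_mem _ fun σ _ => ?_
  by_cases hc : c σ = 0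
  · simp [hc]
  · refine Submodule.subset_span ⟨gammaLOneHom k K ⟨Units.mk0 _ hc,
      AlgEquiv.ofBijective σ (Algebra.IsAlgebraic.algHom_bijective σ)⟩, ?_, ?_⟩
    · rw [← gammaLOneHom_range]
      exact ⟨_, rfl⟩
    · rfl

end GammaL

theorem span_matrixGroup_eq_top {ι k V : Type*} [Fintype ι] [DecidableEq ι]
    [Field k] [AddCommGroup V] [Module k V] (b : Module.Basis ι k V)
    {Γ : Subgroup (LinearMap.GeneralLinearGroup k V)}
    (h : Submodule.span k {T : V →ₗ[k] V | ∃ g ∈ Γ, g.1 = T} = ⊤) :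
    Submodule.span k {A : Matrix ι ι k | ∃ g ∈ matrixGroup b Γ, (g : Matrix ι ι k) = A} = ⊤ := by
  have h1 := congrArg (Submodule.map (LinearMap.toMatrixAlgEquiv b).toLinearMap) h
  have h2 : LinearMap.range (LinearMap.toMatrixAlgEquiv b).toLinearMap = ⊤ :=
    LinearMap.range_eq_top.2 (LinearMap.toMatrixAlgEquiv b).surjective
  rw [Submodule.map_span, Submodule.map_top, h2] at h1
  rw [← h1]
  congr 1
  ext A
  constructor
  · rintro ⟨_, ⟨g, hg, rfl⟩, rfl⟩
    exact ⟨_, ⟨g, hg, rfl⟩, rfl⟩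
  · rintro ⟨_, ⟨g, hg, rfl⟩, rfl⟩
    exact ⟨_, ⟨g, hg, rfl⟩, rfl⟩

theorem matrixGroup_mulEquiv {ι k V : Type*} [Fintype ι] [DecidableEq ι]
    [Field k] [AddCommGroup V] [Module k V] (b : Module.Basis ι k V)
    (Γ : Subgroup (LinearMap.GeneralLinearGroup k V)) : Nonempty (Γ ≃* matrixGroup b Γ) :=
  ⟨Γ.equivMapOfInjective _ (Units.map_injective (LinearMap.toMatrixAlgEquiv b).injective)⟩

/-! ### The group ΓL(1, p^p) over the prime field -/

section GaloisField

variable (p : ℕ) [Fact p.Prime]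

theorem zmodMulEquiv_galois : Nonempty ((GaloisField p p ≃ₐ[ZMod p] GaloisField p p) ≃*
    Multiplicative (ZMod p)) :=
  ⟨mulEquivOfCyclicCardEq (by
    rw [IsGalois.card_aut_eq_finrank, GaloisField.finrank p (NeZero.ne p)]
    simp)⟩

theorem gammaLOne_galoisField_mulEquiv :
    ∃ φ : Multiplicative (ZMod p) →* MulAut (GL (Fin 1) (GaloisField p p)),
      Nonempty (gammaLOne (ZMod p) (GaloisField p p) ≃*
        GL (Fin 1) (GaloisField p p) ⋊[φ] Multiplicative (ZMod p)) := by
  obtain ⟨e⟩ := gammaLOne_mulEquiv (ZMod p) (GaloisField p p)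
  obtain ⟨f⟩ := zmodMulEquiv_galois p
  let u : GL (Fin 1) (GaloisField p p) ≃* (GaloisField p p)ˣ :=
    Units.mapEquiv (Matrix.uniqueRingEquiv (m := Fin 1)).toMulEquiv
  exact ⟨_, ⟨e.symm.trans (SemidirectProduct.congr' u.symm f)⟩⟩

/-- The unit group has order `p ^ p - 1`, prime to `p`, so only the Galois group contributes. -/
theorem cp_gammaLOne_galoisField : cp p (gammaLOne (ZMod p) (GaloisField p p)) = 1 := by
  have hp : p.Prime := Fact.out
  obtain ⟨e⟩ := gammaLOne_mulEquiv (ZMod p) (GaloisField p p)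
  obtain ⟨f⟩ := zmodMulEquiv_galois p
  have hfin : Finite (GaloisField p p ≃ₐ[ZMod p] GaloisField p p) := Finite.of_equiv _ f.symm.toEquiv
  have hfin' : Finite ((GaloisField p p)ˣ ⋊[algEquivUnitsHom (ZMod p) (GaloisField p p)]
    (GaloisField p p ≃ₐ[ZMod p] GaloisField p p)) := Finite.of_equiv _ SemidirectProduct.equivProd.symm
  rw [← cp_congr e, cp_semidirectProduct, cp_eq_zero_of_not_dvd, cp_congr f, zero_add,
    cp_eq_one_of_card_eq (by simp)]
  rw [Nat.card_units, GaloisField.card p p hp.ne_zero]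
  intro h
  have h1 : p ∣ p ^ p := dvd_pow_self p hp.ne_zero
  have h2 := (Nat.dvd_sub_iff_right (Nat.one_le_pow _ _ hp.pos) h1).1 h
  exact hp.one_lt.ne' (Nat.dvd_one.1 h2)

theorem matrixGroup_gammaLOne_properties (b : Module.Basis (Fin p) (ZMod p) (GaloisField p p))
    (Γ : Subgroup (GL (Fin p) (ZMod p)))
    (hΓ : Γ = matrixGroup b (gammaLOne (ZMod p) (GaloisField p p))) :
    (∃ φ : Multiplicative (ZMod p) →* MulAut (GL (Fin 1) (GaloisField p p)),
      Nonempty (Γ ≃* GL (Fin 1) (GaloisField p p) ⋊[φ] Multiplicative (ZMod p))) ∧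
    Submodule.span (ZMod p) {A : Matrix (Fin p) (Fin p) (ZMod p) |
      ∃ g ∈ Γ, (g : Matrix _ _ (ZMod p)) = A} = ⊤ ∧ cp p Γ = 1 ∧ Γ ≠ ⊥ := by
  subst hΓ
  obtain ⟨e⟩ := matrixGroup_mulEquiv b (gammaLOne (ZMod p) (GaloisField p p))
  obtain ⟨φ, ⟨f⟩⟩ := gammaLOne_galoisField_mulEquiv p
  have hcp := (cp_congr e.symm).trans (cp_gammaLOne_galoisField p)
  refine ⟨⟨φ, ⟨e.symm.trans f⟩⟩, span_matrixGroup_eq_top b (span_gammaLOne_eq_top _ _), hcp,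
    fun h => ?_⟩
  rw [h, cp_eq_of_subsingleton] at hcp
  exact zero_ne_one hcp

end GaloisField

open scoped commutatorElement

/-! ### Faithful representations of groups with centre of order two and class two -/

section ConjSum

variable {k E R : Type*} [Field k] [Group E] [Fintype E] [Ring R] [Algebra k R]

/-- The sum of all conjugates of `a` under `E`. -/
def conjSum (ρ : E →* R) (a : R) : R := ∑ y, ρ y * a * ρ y⁻¹

theorem conjSum_add (ρ : E →* R) (a b : R) : conjSum ρ (a + b) = conjSum ρ a + conjSum ρ b := by
  simp [conjSum, mul_add, add_mul, Finset.sum_add_distrib]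

theorem conjSum_smul (ρ : E →* R) (c : k) (a : R) : conjSum ρ (c • a) = c • conjSum ρ a := by
  simp [conjSum, Finset.smul_sum]

theorem conjSum_zero (ρ : E →* R) : conjSum ρ 0 = 0 := by simp [conjSum]

theorem conjSum_of_commute (ρ : E →* R) {a : R} (h : ∀ y, ρ y * a = a * ρ y) :
    conjSum ρ a = (Nat.card E : R) * a := by
  have : ∀ y, ρ y * a * ρ y⁻¹ = a := fun y => by
    rw [h, mul_assoc, ← map_mul, mul_inv_cancel, map_one, mul_one]
  rw [conjSum, Finset.sum_congr rfl fun y _ => this y, Finset.sum_const, Finset.card_univ,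
    Nat.card_eq_fintype_card, nsmul_eq_mul]

variable {z : E}

omit [Fintype E] in
-- A noncentral `x` has a nontrivial commutator; this lies in the centre `{1, z}` and so is `z`.
theorem exists_conj_eq_mul (hZ : ∀ x ∈ Subgroup.center E, x = 1 ∨ x = z)
    (hc : commutator E ≤ Subgroup.center E) {x : E} (hx : x ∉ Subgroup.center E) :
    ∃ y, y * x * y⁻¹ = z * x := by
  rw [Subgroup.mem_center_iff] at hx
  push Not at hx
  obtain ⟨y, hy⟩ := hx
  refine ⟨y, ?_⟩
  have h1 : ⁅y, x⁆ ∈ Subgroup.center E :=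
    hc (Subgroup.commutator_mem_commutator (Subgroup.mem_top _) (Subgroup.mem_top _))
  rcases hZ _ h1 with h | h
  · exact absurd (commutatorElement_eq_one_iff_mul_comm.1 h) hy
  · rw [← h, commutatorElement_def]
    group

/-- Reindexing the sum by `y` with `y x y⁻¹ = z x` replaces `ρ x` by `-ρ x`, so the sum equals its
own negative. -/
theorem map_conj_sum_eq_zero (hZ : ∀ x ∈ Subgroup.center E, x = 1 ∨ x = z)
    (hc : commutator E ≤ Subgroup.center E) {ρ : E →* R} (hρ : ρ z = -1) (h2 : (2 : k) ≠ 0)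
    {x : E} (hx : x ∉ Subgroup.center E) : conjSum ρ (ρ x) = 0 := by
  obtain ⟨y, hy⟩ := exists_conj_eq_mul hZ hc hx
  have h : conjSum ρ (ρ x) = -conjSum ρ (ρ x) := by
    conv_lhs => rw [conjSum, ← Equiv.sum_comp (Equiv.mulRight y)]
    rw [conjSum, ← Finset.sum_neg_distrib]
    refine Finset.sum_congr rfl fun u _ => ?_
    have : u * y * x * (u * y)⁻¹ = u * (y * x * y⁻¹) * u⁻¹ := by group
    rw [Equiv.coe_mulRight, ← map_mul, ← map_mul, this, hy]
    simp [hρ]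
  rw [eq_neg_iff_add_eq_zero, ← two_smul k] at h
  exact (smul_eq_zero_iff_right h2).1 h

/-- For `a = ρ g` only the two elements `e` of the coset `g Z` survive, each contributing `|E| ρ g`.
The formula shows that a nonzero `a` has some nonzero `conjSum ρ (ρ e⁻¹ * a)`. -/
theorem conjSum_reconstruct (hz1 : z ≠ 1) (hz : z ∈ Subgroup.center E)
    (hZ : ∀ x ∈ Subgroup.center E, x = 1 ∨ x = z)
    (hc : commutator E ≤ Subgroup.center E) {ρ : E →* R} (hρ : ρ z = -1) (h2 : (2 : k) ≠ 0)
    {a : R} (ha : a ∈ Submodule.span k (Set.range ρ)) :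
    ∑ e, ρ e * conjSum ρ (ρ e⁻¹ * a) = (2 * Nat.card E : k) • a := by
  classical
  induction ha using Submodule.span_induction with
  | zero => simp [conjSum_zero]
  | add a b _ _ ha hb => simp only [mul_add, conjSum_add, Finset.sum_add_distrib, ha, hb, smul_add]
  | smul c a _ ha =>
    simp only [mul_smul_comm, conjSum_smul, ← Finset.smul_sum, ha]
    exact smul_comm _ _ _
  | mem a ha =>
    obtain ⟨g, rfl⟩ := ha
    have hcomm : ∀ c ∈ Subgroup.center E, ∀ y, ρ y * ρ c = ρ c * ρ y := fun c hc y => by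
      rw [← map_mul, ← map_mul, Subgroup.mem_center_iff.1 hc]
    have hterm : ∀ c ∈ Subgroup.center E,
        ρ (g * c) * conjSum ρ (ρ (g * c)⁻¹ * ρ g) = (Nat.card E : k) • ρ g := fun c hc => by
      have : (g * c)⁻¹ * g = c⁻¹ := by group
      rw [← map_mul, this, conjSum_of_commute ρ (hcomm _ (inv_mem hc)), Nat.cast_commute,
        ← mul_assoc, ← map_mul, mul_inv_cancel_right, Nat.cast_smul_eq_nsmul, nsmul_eq_mul,
        Nat.cast_commute]
    rw [← Equiv.sum_comp (Equiv.mulLeft g)]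
    simp only [Equiv.coe_mulLeft]
    rw [← Finset.sum_subset (Finset.subset_univ {1, z}), Finset.sum_pair hz1.symm,
      hterm 1 (one_mem _), hterm z hz, two_mul, add_smul]
    intro c _ hc'
    have : (g * c)⁻¹ * g = c⁻¹ := by group
    rw [← map_mul, this, map_conj_sum_eq_zero hZ hc hρ h2, mul_zero]
    intro hmem
    rcases hZ c (by simpa using inv_mem hmem) with h | h <;> simp [h] at hc'

/-- Every sum of conjugates is a scalar. -/
theorem conjSum_mem_scalar (hZ : ∀ x ∈ Subgroup.center E, x = 1 ∨ x = z)
    (hc : commutator E ≤ Subgroup.center E) {ρ : E →* R} (hρ : ρ z = -1) (h2 : (2 : k) ≠ 0)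
    {a : R} (ha : a ∈ Submodule.span k (Set.range ρ)) : ∃ c : k, conjSum ρ a = algebraMap k R c := by
  induction ha using Submodule.span_induction with
  | zero => exact ⟨0, by simp [conjSum_zero]⟩
  | add a b _ _ ha hb =>
    obtain ⟨c, hc⟩ := ha
    obtain ⟨d, hd⟩ := hb
    exact ⟨c + d, by rw [conjSum_add, hc, hd, map_add]⟩
  | smul c a _ ha =>
    obtain ⟨d, hd⟩ := ha
    exact ⟨c * d, by rw [conjSum_smul, hd, map_mul, Algebra.smul_def]⟩
  | mem a ha =>
    obtain ⟨g, rfl⟩ := ha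
    by_cases hg : g ∈ Subgroup.center E
    · have h1 : conjSum ρ (ρ g) = (Nat.card E : R) * ρ g := conjSum_of_commute ρ fun y => by
        rw [← map_mul, ← map_mul, Subgroup.mem_center_iff.1 hg]
      rcases hZ g hg with rfl | rfl
      · exact ⟨Nat.card E, by rw [h1, map_one, mul_one, map_natCast]⟩
      · exact ⟨-Nat.card E, by rw [h1, hρ, map_neg, map_natCast, mul_neg, mul_one]⟩
    · exact ⟨0, by rw [map_conj_sum_eq_zero hZ hc hρ h2 hg, map_zero]⟩

variable (hz1 : z ≠ 1) (hz : z ∈ Subgroup.center E)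
    (hZ : ∀ x ∈ Subgroup.center E, x = 1 ∨ x = z) (hc : commutator E ≤ Subgroup.center E)
    {ρ : E →* R} (hρ : ρ z = -1) (hE : (2 * Nat.card E : k) ≠ 0)
    (hspan : Submodule.span k (Set.range ρ) = ⊤)

include hz1 hz hZ hc hρ hE hspan

/-- A nonzero ideal is closed under conjugate sums, which are scalars; by `conjSum_reconstruct` one
of them is nonzero. -/
theorem isSimpleRing_of_span_eq_top [Nontrivial R] : IsSimpleRing R := by
  refine ⟨⟨fun I => or_iff_not_imp_left.2 fun hI => ?_⟩⟩
  have h2 : (2 : k) ≠ 0 := left_ne_zero_of_mul hE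
  obtain ⟨a, haI, ha0⟩ : ∃ a ∈ I, a ≠ 0 := by
    by_contra! h
    exact hI (le_bot_iff.1 fun x hx => (TwoSidedIdeal.mem_bot R).2 (h x hx))
  have hmem : ∀ x : R, x ∈ Submodule.span k (Set.range ρ) := fun x => hspan ▸ Submodule.mem_top
  obtain ⟨e, he⟩ : ∃ e, conjSum ρ (ρ e⁻¹ * a) ≠ 0 := by
    by_contra! h
    have := conjSum_reconstruct (k := k) hz1 hz hZ hc hρ h2 (hmem a)
    rw [Finset.sum_eq_zero fun e _ => by rw [h, mul_zero]] at this
    exact ha0 ((smul_eq_zero_iff_right hE).1 this.symm)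
  obtain ⟨c, hc'⟩ := conjSum_mem_scalar hZ hc hρ h2 (hmem (ρ e⁻¹ * a))
  have hcI : algebraMap k R c ∈ I := by
    rw [← hc', conjSum]
    exact sum_mem fun y _ => I.mul_mem_right _ _ (I.mul_mem_left _ _ (I.mul_mem_left _ _ haI))
  have hc0 : c ≠ 0 := by
    rintro rfl
    exact he (by rw [hc', map_zero])
  have h1 : (1 : R) ∈ I := by
    have := I.mul_mem_left (algebraMap k R c⁻¹) _ hcI
    rwa [← map_mul, inv_mul_cancel₀ hc0, map_one] at this
  exact I.one_mem_iff.1 h1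

omit hz1 hz in
-- A central element is its conjugate sum, a scalar, divided by `|E|`.
theorem exists_algebraMap_eq_of_commute {a : R} (ha : ∀ b : R, b * a = a * b) :
    ∃ c : k, a = algebraMap k R c := by
  have h2 : (2 : k) ≠ 0 := left_ne_zero_of_mul hE
  have hE' : (Nat.card E : k) ≠ 0 := right_ne_zero_of_mul hE
  obtain ⟨c, hc'⟩ := conjSum_mem_scalar (k := k) (a := a) hZ hc hρ h2 (hspan ▸ Submodule.mem_top)
  rw [conjSum_of_commute ρ fun y => ha _] at hc'
  refine ⟨(Nat.card E : k)⁻¹ * c, ?_⟩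
  rw [map_mul, ← hc', ← mul_assoc, ← map_natCast (algebraMap k R), ← map_mul, inv_mul_cancel₀ hE',
    map_one, one_mul]

omit hz1 hz in
-- Coset representatives of the centre give a basis. They span because `z` acts as `-1`; multiplying
-- a relation by `ρ (s w)⁻¹` and summing conjugates isolates the coefficient at `w`.
theorem finrank_eq_card_quotient [Nontrivial R] :
    Module.finrank k R = Nat.card (E ⧸ Subgroup.center E) := by
  classical
  have h2 : (2 : k) ≠ 0 := left_ne_zero_of_mul hE
  have hE' : (Nat.card E : k) ≠ 0 := right_ne_zero_of_mul hE
  have := Fintype.ofFinite (E ⧸ Subgroup.center E)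
  let s : E ⧸ Subgroup.center E → E := Quotient.out
  have hs : ∀ v, (s v : E ⧸ Subgroup.center E) = v := fun v => Quotient.out_eq v
  have hli : LinearIndependent k fun v => ρ (s v) := by
    rw [Fintype.linearIndependent_iff]
    intro c hc0 w
    have h1 : conjSum ρ (ρ (s w)⁻¹ * ∑ v, c v • ρ (s v)) = 0 := by rw [hc0, mul_zero, conjSum_zero]
    let f : R →ₗ[k] R := ⟨⟨conjSum ρ, conjSum_add ρ⟩, conjSum_smul ρ⟩
    change f _ = 0 at h1
    rw [Finset.mul_sum, map_sum, Finset.sum_eq_single w] at h1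
    · rw [mul_smul_comm, ← map_mul, inv_mul_cancel, map_one, map_smul] at h1
      have h3 : f 1 = algebraMap k R (Nat.card E) := by
        change conjSum ρ 1 = _
        rw [conjSum_of_commute ρ (by simp)]
        simp
      rw [h3, Algebra.smul_def, ← map_mul] at h1
      exact (mul_eq_zero.1 ((map_eq_zero_iff _ (algebraMap k R).injective).1 h1)).resolve_right hE'
    · intro v _ hv
      rw [mul_smul_comm, ← map_mul, map_smul]
      change c v • conjSum ρ _ = 0
      rw [map_conj_sum_eq_zero hZ hc hρ h2, smul_zero]
      intro h
      exact hv ((hs v).symm.trans ((QuotientGroup.eq.2 h).symm.trans (hs w)))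
    · simp
  have hsp : ⊤ ≤ Submodule.span k (Set.range fun v => ρ (s v)) := by
    rw [← hspan, Submodule.span_le]
    rintro _ ⟨g, rfl⟩
    have h1 : (s g)⁻¹ * g ∈ Subgroup.center E := QuotientGroup.eq.1 (hs g)
    have h3 : ρ g = ρ (s g) * ρ ((s g)⁻¹ * g) := by rw [← map_mul, mul_inv_cancel_left]
    have h4 : ρ (s g) ∈ Submodule.span k (Set.range fun v => ρ (s v)) :=
      Submodule.subset_span ⟨_, rfl⟩
    rw [SetLike.mem_coe, h3]
    rcases hZ _ h1 with h | h
    · rwa [h, map_one, mul_one]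
    · rw [h, hρ, mul_neg, mul_one]
      exact neg_mem h4
  rw [Module.finrank_eq_card_basis (Module.Basis.mk hli hsp), Nat.card_eq_fintype_card]

end ConjSum

/-! ### From an odd representation to a full matrix algebra -/

section MatrixRep

variable {k E : Type*} [Field k] [Group E] {z : E}

/-- The functions on `E` that change sign under translation by `z`. -/
def oddFunctions (k : Type*) [Field k] {E : Type*} [Group E] (z : E) : Submodule k (E → k) where
  carrier := {f | ∀ x, f (z * x) = -f x}
  zero_mem' := fun x => by simp
  add_mem' := fun {f g} hf hg x => by simp [hf x, hg x, add_comm]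
  smul_mem' := fun c f hf x => by simp [hf x]

/-- The action of `E` on odd functions by right translation. -/
def oddRep (k : Type*) [Field k] {E : Type*} [Group E] (z : E) :
    E →* Module.End k (oddFunctions k z) where
  toFun e :=
    { toFun := fun f => ⟨fun x => f.1 (x * e), fun x => by
        change f.1 (z * x * e) = -f.1 (x * e)
        rw [mul_assoc, f.2]⟩
      map_add' := fun f g => rfl
      map_smul' := fun c f => rfl }
  map_one' := by
    ext f x
    exact congrArg f.1 (mul_one x)
  map_mul' a b := by
    ext f x
    exact congrArg f.1 (mul_assoc x a b).symm

theorem oddRep_center (hz : z ∈ Subgroup.center E) : oddRep k z z = -1 := by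
  ext f x
  change f.1 (x * z) = -f.1 x
  rw [Subgroup.mem_center_iff.1 hz, f.2]

theorem nontrivial_oddFunctions (hz1 : z ≠ 1) (hz2 : z * z = 1) : Nontrivial (oddFunctions k z) := by
  classical
  -- The odd function `δ_1 - δ_z` is nonzero.
  have hm : (Pi.single 1 1 - Pi.single z 1 : E → k) ∈ oddFunctions k z := by
    intro x
    have h1 : z * x = 1 ↔ x = z := by
      rw [mul_eq_one_iff_eq_inv', eq_comm, inv_eq_of_mul_eq_one_left hz2, eq_comm]
    have h2 : z * x = z ↔ x = 1 := by simp
    simp only [Pi.sub_apply, Pi.single_apply, h1, h2, neg_sub]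
  refine ⟨⟨⟨_, hm⟩, 0, fun h => ?_⟩⟩
  have := congrFun (congrArg Subtype.val h) 1
  simp [hz1.symm] at this

/-- By Wedderburn's little theorem `D` is commutative, so its scalar matrices are central and come
from `k`. -/
theorem Matrix.exists_algEquiv_of_center_eq {k D : Type*} [Field k] [Finite k] [DivisionRing D]
    [Algebra k D] [Module.Finite k D] {n : ℕ} [NeZero n]
    (hcen : ∀ a : Matrix (Fin n) (Fin n) D, (∀ b, b * a = a * b) →
      ∃ c : k, a = algebraMap k (Matrix (Fin n) (Fin n) D) c) : Nonempty (D ≃ₐ[k] k) := by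
  have : Finite D := Module.finite_of_finite k
  let _ : Field D := { (inferInstance : DivisionRing D), littleWedderburn D with }
  refine ⟨(AlgEquiv.ofBijective (Algebra.ofId k D) ⟨(algebraMap k D).injective, fun d => ?_⟩).symm⟩
  obtain ⟨c, hc⟩ := hcen (Matrix.scalar (Fin n) d) fun b =>
    ((Matrix.scalar_commute d (fun _ => mul_comm _ _) b).eq).symm
  refine ⟨c, ?_⟩
  have := congrFun (congrFun hc 0) 0
  simpa [Matrix.algebraMap_matrix_apply, eq_comm] using this

/-- The image of `E` is closed under products, so its linear span is already the algebra it
generates. -/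
theorem exists_subalgebra_rep {R : Type*} [Ring R] [Algebra k R] {ρ₀ : E →* R}
    (hρ₀ : ρ₀ z = -1) : ∃ (A : Subalgebra k R) (ρ : E →* A), ρ z = -1 ∧
      Submodule.span k (Set.range ρ) = ⊤ := by
  let A : Subalgebra k R := Algebra.adjoin k (Set.range ρ₀)
  let ρ : E →* A := ρ₀.codRestrict A.toSubmonoid fun e => Algebra.subset_adjoin ⟨e, rfl⟩
  refine ⟨A, ρ, Subtype.ext hρ₀, eq_top_iff.2 fun a _ => ?_⟩
  have ha : (a : R) ∈ Submodule.span k (Set.range ρ₀) := by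
    have h1 := a.2
    rw [← Subalgebra.mem_toSubmodule, Algebra.adjoin_eq_span] at h1
    have h2 : (Submonoid.closure (Set.range ρ₀) : Set R) = Set.range ρ₀ := by
      rw [← MonoidHom.coe_mrange, Submonoid.closure_eq]
    rwa [h2] at h1
  have h3 : Set.range ρ₀ = A.val.toLinearMap '' Set.range ρ := by
    rw [← Set.range_comp]
    rfl
  rw [h3, ← Submodule.map_span] at ha
  obtain ⟨b, hb, hba⟩ := ha
  rwa [← Subtype.ext hba]

/-- Wedderburn–Artin writes the simple algebra `A` as matrices over `D`; its centre forces `D = k`,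
and its dimension `n ^ 2` forces the size `n`. -/
theorem exists_matrix_rep_of_span_eq_top [Finite k] [Finite E] {n : ℕ}
    (hz1 : z ≠ 1) (hz : z ∈ Subgroup.center E)
    (hZ : ∀ x ∈ Subgroup.center E, x = 1 ∨ x = z) (hc : commutator E ≤ Subgroup.center E)
    (hE : (2 * Nat.card E : k) ≠ 0) (hn : Nat.card (E ⧸ Subgroup.center E) = n ^ 2)
    {A : Type*} [Ring A] [Algebra k A] [Nontrivial A] [Module.Finite k A] {ρ : E →* A}
    (hρ : ρ z = -1) (hspan : Submodule.span k (Set.range ρ) = ⊤) :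
    ∃ ρ : E →* Matrix (Fin n) (Fin n) k, ρ z = -1 ∧
      Submodule.span k (Set.range ρ) = ⊤ := by
  have := Fintype.ofFinite E
  have hsimple := isSimpleRing_of_span_eq_top hz1 hz hZ hc hρ hE hspan
  have hfr := finrank_eq_card_quotient hZ hc hρ hE hspan
  have := IsArtinianRing.of_finite k A
  obtain ⟨m, hm, D, _, _, hD, ⟨e⟩⟩ := IsSimpleRing.exists_algEquiv_matrix_divisionRing_finite k A
  obtain ⟨f⟩ := Matrix.exists_algEquiv_of_center_eq (k := k) (D := D) (n := m) fun a ha => by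
    obtain ⟨c, hc⟩ := exists_algebraMap_eq_of_commute (a := e.symm a) hZ hc hρ hE hspan fun b => by
      apply e.injective
      simp [ha]
    exact ⟨c, by rw [← e.apply_symm_apply a, hc, e.commutes]⟩
  let g : A ≃ₐ[k] Matrix (Fin m) (Fin m) k := e.trans f.mapMatrix
  have hmn : m = n := by
    rw [g.toLinearEquiv.finrank_eq, hn, Module.finrank_matrix] at hfr
    simp only [Fintype.card_fin, Module.finrank_self, mul_one] at hfr
    exact Nat.pow_left_injective (two_ne_zero) (by simpa [sq] using hfr)
  subst hmn
  refine ⟨(g : A →* Matrix (Fin m) (Fin m) k).comp ρ, ?_, ?_⟩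
  · change g (ρ z) = -1
    rw [hρ, map_neg, map_one]
  · have : Set.range ((g : A →* Matrix (Fin m) (Fin m) k).comp ρ) =
        g.toLinearMap '' Set.range ρ := by
      rw [← Set.range_comp]
      rfl
    rw [this, ← Submodule.map_span, hspan, Submodule.map_top]
    exact LinearMap.range_eq_top.2 g.surjective

theorem exists_matrix_rep_of_hom [Finite k] [Finite E] {n : ℕ}
    (hz1 : z ≠ 1) (hz : z ∈ Subgroup.center E)
    (hZ : ∀ x ∈ Subgroup.center E, x = 1 ∨ x = z) (hc : commutator E ≤ Subgroup.center E)
    (hE : (2 * Nat.card E : k) ≠ 0) (hn : Nat.card (E ⧸ Subgroup.center E) = n ^ 2)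
    {R : Type*} [Ring R] [Algebra k R] [Nontrivial R] [Module.Finite k R] {ρ₀ : E →* R}
    (hρ₀ : ρ₀ z = -1) :
    ∃ ρ : E →* Matrix (Fin n) (Fin n) k, ρ z = -1 ∧
      Submodule.span k (Set.range ρ) = ⊤ := by
  obtain ⟨A, ρ, hρ, hspan⟩ := exists_subalgebra_rep (k := k) hρ₀
  exact exists_matrix_rep_of_span_eq_top hz1 hz hZ hc hE hn hρ hspan

theorem exists_matrix_rep [Finite k] [Finite E] {n : ℕ} (hz1 : z ≠ 1)
    (hz : z ∈ Subgroup.center E)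
    (hZ : ∀ x ∈ Subgroup.center E, x = 1 ∨ x = z) (hc : commutator E ≤ Subgroup.center E)
    (hE : (2 * Nat.card E : k) ≠ 0) (hn : Nat.card (E ⧸ Subgroup.center E) = n ^ 2) :
    ∃ ρ : E →* Matrix (Fin n) (Fin n) k, ρ z = -1 ∧
      Submodule.span k (Set.range ρ) = ⊤ := by
  have hz2 : z * z = 1 := (hZ _ (mul_mem hz hz)).resolve_right fun h => hz1 (by simpa using h)
  have := nontrivial_oddFunctions (k := k) hz1 hz2
  exact exists_matrix_rep_of_hom hz1 hz hZ hc hE hn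
    (R := Module.End k (oddFunctions k z)) (ρ₀ := oddRep k z) (oddRep_center hz)

end MatrixRep

/-! ### Extending a representation to a semidirect product -/

section Extend

variable {k E : Type*} [Field k] [Group E] {z : E} {n : ℕ}
  {ρ : E →* Matrix (Fin n) (Fin n) k}

theorem trace_eq_zero_of_notMem_center (hZ : ∀ x ∈ Subgroup.center E, x = 1 ∨ x = z)
    (hc : commutator E ≤ Subgroup.center E) (hρ : ρ z = -1) (h2 : (2 : k) ≠ 0) {x : E}
    (hx : x ∉ Subgroup.center E) : (ρ x).trace = 0 := by
  obtain ⟨y, hy⟩ := exists_conj_eq_mul hZ hc hx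
  have h1 : (ρ (y * x * y⁻¹)).trace = (ρ x).trace := by
    rw [map_mul, Matrix.trace_mul_comm, ← map_mul]
    congr 2
    group
  rw [hy, map_mul, hρ, neg_one_mul, Matrix.trace_neg, neg_eq_iff_add_eq_zero, ← two_mul] at h1
  exact (mul_eq_zero.1 h1).resolve_left h2

theorem exists_intertwiner_ne_zero [Fintype E] (hz1 : z ≠ 1) (hz : z ∈ Subgroup.center E)
    (hZ : ∀ x ∈ Subgroup.center E, x = 1 ∨ x = z)
    (hc : commutator E ≤ Subgroup.center E) (hρ : ρ z = -1) (hn : (2 * n : k) ≠ 0)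
    (α : MulAut E) :
    ∃ U : Matrix (Fin n) (Fin n) k, U ≠ 0 ∧ ∀ h, ρ (α h) * U = U * ρ h := by
  classical
  have h2 : (2 : k) ≠ 0 := left_ne_zero_of_mul hn
  let U : Matrix (Fin n) (Fin n) k → Matrix (Fin n) (Fin n) k :=
    fun T => ∑ e, ρ (α e) * T * ρ e⁻¹
  have hU : ∀ T h, ρ (α h) * U T = U T * ρ h := by
    intro T h
    simp only [U, Finset.mul_sum, Finset.sum_mul]
    refine Eq.trans ?_ (Equiv.sum_comp (Equiv.mulLeft h) fun e => ρ (α e) * T * ρ e⁻¹ * ρ h)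
    refine Finset.sum_congr rfl fun e _ => ?_
    have : e⁻¹ = (h * e)⁻¹ * h := by group
    conv_lhs => rw [this, map_mul ρ _ h]
    rw [Equiv.coe_mulLeft, map_mul α, map_mul ρ (α h)]
    simp only [mul_assoc]
  by_contra! hcon
  have hU0 : ∀ T, U T = 0 := fun T => by
    by_contra h
    obtain ⟨e, he⟩ := hcon _ h
    exact he (hU T e)
  -- Taking `T` to be the matrix unit at `(j, l)`, reading entry `(i, l)` and summing over `l`
  -- produces the trace.
  have hsum : ∑ e, (ρ e⁻¹).trace • ρ (α e) = 0 := by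
    ext i j
    have h1 : ∀ l, ∑ e, ρ (α e) i j * ρ e⁻¹ l l = 0 := fun l => by
      have := congrFun (congrFun (hU0 (Matrix.single j l 1)) i) l
      simp only [U, Matrix.sum_apply] at this
      refine Eq.trans ?_ this
      refine Finset.sum_congr rfl fun e _ => ?_
      rw [mul_assoc, Matrix.mul_apply, Finset.sum_eq_single j]
      · simp
      · intro b _ hb
        simp [hb]
      · simp
    simp only [Matrix.sum_apply, Matrix.smul_apply, smul_eq_mul, Matrix.trace, Matrix.diag,
      Finset.sum_mul, Matrix.zero_apply]
    rw [Finset.sum_comm]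
    exact Finset.sum_eq_zero fun l _ => by rw [← h1 l]; exact Finset.sum_congr rfl fun e _ => mul_comm _ _
  have hz2 : z⁻¹ = z := inv_eq_of_mul_eq_one_left
    ((hZ _ (mul_mem hz hz)).resolve_right fun h => hz1 (by simpa using h))
  have hαz : α z = z := by
    refine (hZ _ ?_).resolve_left fun h => hz1 (α.injective (by rw [h, map_one]))
    rw [Subgroup.mem_center_iff] at hz ⊢
    intro g
    obtain ⟨g, rfl⟩ := α.surjective g
    rw [← map_mul, hz, map_mul]
  -- Noncentral elements have trace zero. The terms at `1` and `z` are `n • 1` and `(-n) • (-1)`, so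
  -- the sum is `2n`, a contradiction.
  rw [← Finset.sum_subset (Finset.subset_univ {1, z}), Finset.sum_pair hz1.symm, hαz, hz2, hρ,
    inv_one, map_one, map_one, map_one, Matrix.trace_neg, Matrix.trace_one, Fintype.card_fin,
    smul_neg, neg_smul, neg_neg, ← add_smul, ← two_mul] at hsum
  · have hn0 : 0 < n := Nat.pos_of_ne_zero fun h => hn (by simp [h])
    have := congrFun (congrFun hsum ⟨0, hn0⟩) ⟨0, hn0⟩
    exact hn (by simpa using this)
  · intro c _ hc'
    rw [trace_eq_zero_of_notMem_center hZ hc hρ h2, zero_smul]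
    intro hmem
    rcases hZ c (by simpa using inv_mem hmem) with h | h <;> simp [h] at hc'

/-- Since `ρ` spans, every matrix can be moved across `U`, so the kernel of `U` is stable under all
matrices; as `U ≠ 0`, it is zero. -/
theorem exists_intertwiner [Fintype E] (hz1 : z ≠ 1) (hz : z ∈ Subgroup.center E)
    (hZ : ∀ x ∈ Subgroup.center E, x = 1 ∨ x = z)
    (hc : commutator E ≤ Subgroup.center E) (hρ : ρ z = -1) (hn : (2 * n : k) ≠ 0)
    (hspan : Submodule.span k (Set.range ρ) = ⊤) (α : MulAut E) :
    ∃ U : GL (Fin n) k, ∀ h, ρ (α h) * U.1 = U.1 * ρ h := by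
  obtain ⟨U, hU0, hU⟩ := exists_intertwiner_ne_zero hz1 hz hZ hc hρ hn α
  have hall : ∀ X : Matrix (Fin n) (Fin n) k, ∃ Y, Y * U = U * X := by
    intro X
    have hX : X ∈ Submodule.span k (Set.range ρ) := hspan ▸ Submodule.mem_top
    induction hX using Submodule.span_induction with
    | mem X hX =>
      obtain ⟨h, rfl⟩ := hX
      exact ⟨_, hU h⟩
    | zero => exact ⟨0, by simp⟩
    | add X X' _ _ h h' =>
      obtain ⟨Y, hY⟩ := h
      obtain ⟨Y', hY'⟩ := h'
      exact ⟨Y + Y', by rw [add_mul, mul_add, hY, hY']⟩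
    | smul c X _ h =>
      obtain ⟨Y, hY⟩ := h
      exact ⟨c • Y, by rw [Matrix.smul_mul, Matrix.mul_smul, hY]⟩
  have hinj : ∀ v, U.mulVec v = 0 → v = 0 := by
    intro v hv
    by_contra hv0
    obtain ⟨a, ha⟩ := Function.ne_iff.1 hv0
    -- A kernel vector with `v a ≠ 0` is carried by the matrix unit `(b, a)` to a multiple of the
    -- `b`-th basis vector, so column `b` of `U` vanishes.
    refine hU0 (Matrix.ext fun i b => ?_)
    obtain ⟨Y, hY⟩ := hall (Matrix.single b a 1)
    have h1 : U.mulVec ((Matrix.single b a (1 : k)).mulVec v) = 0 := by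
      rw [Matrix.mulVec_mulVec, ← hY, ← Matrix.mulVec_mulVec, hv, Matrix.mulVec_zero]
    have h2 : (Matrix.single b a (1 : k)).mulVec v = v a • Pi.single b 1 := by
      rw [Matrix.single_mulVec]
      ext c
      by_cases hcb : c = b
      · subst hcb; simp
      · simp [hcb]
    rw [h2, Matrix.mulVec_smul, Matrix.mulVec_single_one] at h1
    exact (mul_eq_zero.1 (congrFun h1 i)).resolve_left ha
  have hunit : IsUnit U := by
    rw [Matrix.isUnit_iff_isUnit_det, isUnit_iff_ne_zero]
    intro hdet
    obtain ⟨v, hv, hv0⟩ := Matrix.exists_mulVec_eq_zero_iff.2 hdet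
    exact hv (hinj v hv0)
  exact ⟨hunit.unit, hU⟩

theorem eq_scalar_of_commute_span (hspan : Submodule.span k (Set.range ρ) = ⊤)
    {A : Matrix (Fin n) (Fin n) k} (hA : ∀ h, ρ h * A = A * ρ h) : ∃ c : k, A = c • 1 := by
  have hall : ∀ X : Matrix (Fin n) (Fin n) k, X * A = A * X := by
    intro X
    have hX : X ∈ Submodule.span k (Set.range ρ) := hspan ▸ Submodule.mem_top
    induction hX using Submodule.span_induction with
    | mem X hX =>
      obtain ⟨h, rfl⟩ := hX
      exact hA h
    | zero => simp
    | add X X' _ _ h h' => rw [add_mul, mul_add, h, h']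
    | smul c X _ h => rw [Matrix.smul_mul, Matrix.mul_smul, h]
  obtain ⟨c, hc⟩ := Matrix.mem_range_scalar_of_commute_single (M := A) fun i j _ => hall _
  exact ⟨c, by rw [← hc, Matrix.scalar_apply, Matrix.smul_one_eq_diagonal]⟩

end Extend

/-! ### Extension over a group of order p, in the prime field -/

section Semidirect

variable {p : ℕ} [Fact p.Prime] {E : Type*} [Group E] {z : E} {n : ℕ}
  {ρ : E →* Matrix (Fin n) (Fin n) (ZMod p)}

/-- Since `α ^ p = 1`, the matrix `U ^ p` commutes with `ρ` and is a scalar `c`. The prime field is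
essential: `c ^ p = c` makes `(c⁻¹ U) ^ p = 1`. -/
theorem exists_intertwiner_pow_eq_one [Fintype E] (hz1 : z ≠ 1) (hz : z ∈ Subgroup.center E)
    (hZ : ∀ x ∈ Subgroup.center E, x = 1 ∨ x = z)
    (hc : commutator E ≤ Subgroup.center E) (hρ : ρ z = -1) (hn : (2 * n : ZMod p) ≠ 0)
    (hspan : Submodule.span (ZMod p) (Set.range ρ) = ⊤) {α : MulAut E} (hα : α ^ p = 1) :
    ∃ U : GL (Fin n) (ZMod p), U ^ p = 1 ∧ ∀ h, ρ (α h) * U.1 = U.1 * ρ h := by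
  obtain ⟨U, hU⟩ := exists_intertwiner hz1 hz hZ hc hρ hn hspan α
  have hpow : ∀ (i : ℕ) (h : E), ρ ((α ^ i) h) * U.1 ^ i = U.1 ^ i * ρ h := by
    intro i
    induction i with
    | zero => simp
    | succ i ih =>
      intro h
      rw [pow_succ, pow_succ, MulAut.mul_apply, ← mul_assoc, ih, mul_assoc, hU, mul_assoc]
  obtain ⟨c, hc'⟩ := eq_scalar_of_commute_span hspan (A := U.1 ^ p) fun h => by
    simpa [hα] using hpow p h
  have hn0 : 0 < n := Nat.pos_of_ne_zero fun h => hn (by simp [h])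
  have : Nonempty (Fin n) := ⟨⟨0, hn0⟩⟩
  have hc0 : c ≠ 0 := by
    rintro rfl
    rw [zero_smul] at hc'
    have := (U ^ p).isUnit
    rw [Units.val_pow_eq_pow_val, hc'] at this
    exact not_isUnit_zero this
  let s : GL (Fin n) (ZMod p) := Units.map (Matrix.scalar (Fin n)).toMonoidHom (Units.mk0 c hc0)⁻¹
  have hs : s.1 = c⁻¹ • (1 : Matrix (Fin n) (Fin n) (ZMod p)) := by
    change Matrix.scalar (Fin n) c⁻¹ = _
    rw [Matrix.scalar_apply, Matrix.smul_one_eq_diagonal]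
  refine ⟨s * U, Units.ext ?_, fun h => ?_⟩
  · rw [Units.val_pow_eq_pow_val, Units.val_mul, hs, smul_mul_assoc, one_mul, smul_pow, hc',
      ZMod.pow_card, smul_smul, inv_mul_cancel₀ hc0, one_smul, Units.val_one]
  · rw [Units.val_mul, hs, smul_mul_assoc, one_mul, mul_smul_comm, hU, smul_mul_assoc]

theorem exists_semidirect_rep [Finite E] {P : Type*} [Group P] (hP : Nat.card P = p)
    {φ : P →* MulAut E} (hφ : ∀ q, (∀ h, φ q h * h⁻¹ ∈ Subgroup.center E) → q = 1)
    (hz1 : z ≠ 1) (hz : z ∈ Subgroup.center E)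
    (hZ : ∀ x ∈ Subgroup.center E, x = 1 ∨ x = z)
    (hc : commutator E ≤ Subgroup.center E) (hE : (2 * Nat.card E : ZMod p) ≠ 0)
    (hn : (2 * n : ZMod p) ≠ 0) (hE2 : Nat.card (E ⧸ Subgroup.center E) = n ^ 2) :
    ∃ ρ : E ⋊[φ] P →* GL (Fin n) (ZMod p), Function.Injective ρ ∧
      Submodule.span (ZMod p) {A : Matrix (Fin n) (Fin n) (ZMod p) |
        ∃ g ∈ ρ.range, (g : Matrix _ _ (ZMod p)) = A} = ⊤ := by
  have := Fintype.ofFinite E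
  obtain ⟨ρ, hρ, hspan⟩ := exists_matrix_rep hz1 hz hZ hc hE hE2
  have : Fact (Nat.card P).Prime := hP ▸ ‹_›
  have : IsCyclic P := isCyclic_of_prime_card hP
  obtain ⟨q₀, hq₀⟩ := IsCyclic.exists_generator (α := P)
  have hord : orderOf q₀ = p := by rw [orderOf_eq_card_of_forall_mem_zpowers hq₀, hP]
  obtain ⟨U, hUp, hU⟩ := exists_intertwiner_pow_eq_one hz1 hz hZ hc hρ hn hspan (α := φ q₀)
    (by rw [← map_pow, ← hord, pow_orderOf_eq_one, map_one])
  have hdvd : orderOf U ∣ orderOf q₀ := hord ▸ orderOf_dvd_of_pow_eq_one hUp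
  let σ : P →* GL (Fin n) (ZMod p) := monoidHomOfForallMemZpowers hq₀ hdvd
  have hσ : σ q₀ = U := monoidHomOfForallMemZpowers_apply_gen hq₀ hdvd
  have hcompat : ∀ q, ρ.toHomUnits.comp (φ q).toMonoidHom =
      (MulAut.conj (σ q)).toMonoidHom.comp ρ.toHomUnits := by
    have h0 : ∀ q, (∀ h, ρ.toHomUnits (φ q h) = σ q * ρ.toHomUnits h * (σ q)⁻¹) := by
      intro q
      have : Finite P := Nat.finite_of_card_ne_zero (hP ▸ NeZero.ne p)
      obtain ⟨i, rfl⟩ := mem_powers_iff_mem_zpowers.2 (hq₀ q)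
      change ∀ h, ρ.toHomUnits (φ (q₀ ^ i) h) = σ (q₀ ^ i) * ρ.toHomUnits h * (σ (q₀ ^ i))⁻¹
      induction i with
      | zero => simp
      | succ i ih =>
        intro h
        have h1 : ρ.toHomUnits (φ q₀ h) = U * ρ.toHomUnits h * U⁻¹ :=
          eq_mul_inv_of_mul_eq (Units.ext (hU h))
        rw [pow_succ, map_mul, MulAut.mul_apply, ih, h1, map_mul, hσ]
        group
    exact fun q => MonoidHom.ext (h0 q)
  -- A central kernel element is `1`, as `ρ z = -1 ≠ 1`; a noncentral one has a conjugate `z x`,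
  -- again forcing `-1 = 1`.
  have hinj : Function.Injective ρ := by
    refine (injective_iff_map_eq_one _).2 fun x hx => ?_
    have hn0 : 0 < n := Nat.pos_of_ne_zero fun h => hn (by simp [h])
    have hne : (-1 : Matrix (Fin n) (Fin n) (ZMod p)) ≠ 1 := by
      intro h
      have h1 := congrFun (congrFun h ⟨0, hn0⟩) ⟨0, hn0⟩
      simp only [Matrix.neg_apply, Matrix.one_apply_eq, neg_eq_iff_add_eq_zero, one_add_one_eq_two]
        at h1
      exact left_ne_zero_of_mul hn h1
    by_cases hxc : x ∈ Subgroup.center E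
    · refine (hZ x hxc).resolve_right fun h => hne ?_
      rw [← hρ, ← h, hx]
    · obtain ⟨y, hy⟩ := exists_conj_eq_mul hZ hc hxc
      have := congrArg ρ hy
      rw [map_mul, map_mul, map_mul, hx, mul_one, mul_one, ← map_mul, mul_inv_cancel, map_one,
        hρ] at this
      exact absurd this.symm hne
  have hinj' : Function.Injective ρ.toHomUnits := fun x y h => hinj (congrArg Units.val h)
  refine ⟨SemidirectProduct.lift ρ.toHomUnits σ hcompat, ?_, ?_⟩
  · refine (injective_iff_map_eq_one _).2 fun w hw => ?_
    have hw' : ρ.toHomUnits w.left * σ w.right = 1 := hw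
    -- For `w` in the kernel, `w.right` acts on `E` as conjugation by `w.left⁻¹`, hence trivially
    -- modulo the centre.
    have hq : w.right = 1 := hφ _ fun h => by
      have h1 := DFunLike.congr_fun (hcompat w.right) h
      have h2 : σ w.right = ρ.toHomUnits w.left⁻¹ := by
        rw [map_inv]
        exact eq_inv_of_mul_eq_one_right hw'
      have h3 : φ w.right h = w.left⁻¹ * h * w.left⁻¹⁻¹ := hinj' (by
        rw [map_mul, map_mul, map_inv ρ.toHomUnits w.left⁻¹, ← h2]
        exact h1)
      rw [h3]
      exact hc (Subgroup.commutator_mem_commutator (Subgroup.mem_top w.left⁻¹) (Subgroup.mem_top h))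
    rw [hq, map_one, mul_one] at hw'
    exact SemidirectProduct.ext (hinj' (by rw [hw', SemidirectProduct.one_left, map_one])) hq
  · refine eq_top_iff.2 (hspan ▸ Submodule.span_mono ?_)
    rintro _ ⟨e, rfl⟩
    exact ⟨_, ⟨SemidirectProduct.inl e, rfl⟩, by simp⟩

end Semidirect

/-! ### Quadratic forms of minus type over the field of two elements -/

section MinusType

theorem ZMod.two_eq_zero_or_one (a : ZMod 2) : a = 0 ∨ a = 1 := by
  revert a
  decide

/-- The nontrivial additive character of `ZMod 2`. -/
def signChar (a : ZMod 2) : ℤ := if a = 0 then 1 else -1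

theorem signChar_add (a b : ZMod 2) : signChar (a + b) = signChar a * signChar b := by
  revert a b
  decide

variable {V : Type*} [AddCommGroup V] [Module (ZMod 2) V]

theorem ZMod.add_self_eq_zero (v : V) : v + v = 0 := by
  rw [← two_smul (ZMod 2), show (2 : ZMod 2) = 0 from rfl, zero_smul]

theorem sum_signChar_eq [Fintype V] (f : V →ₗ[ZMod 2] ZMod 2) :
    ∑ v, signChar (f v) = if f = 0 then (Fintype.card V : ℤ) else 0 := by
  split_ifs with hf
  · simp [hf, signChar]
  · obtain ⟨w, hw⟩ : ∃ w, f w = 1 := by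
      by_contra! h
      exact hf (LinearMap.ext fun v => (ZMod.two_eq_zero_or_one (f v)).resolve_right (h v))
    have h1 : ∑ v, signChar (f v) = ∑ v, -signChar (f v) := by
      rw [← Equiv.sum_comp (Equiv.addRight w)]
      refine Finset.sum_congr rfl fun v _ => ?_
      rw [Equiv.coe_addRight, map_add, hw, signChar_add]
      simp [signChar]
    rw [Finset.sum_neg_distrib] at h1
    omega

variable (Q : QuadraticForm (ZMod 2) V)

theorem polar_self_eq_zero (v : V) : QuadraticMap.polar Q v v = 0 := by
  rw [QuadraticMap.polar_self, two_smul]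
  exact CharTwo.add_self_eq_zero _

theorem map_add_eq (u v : V) : Q (u + v) = Q u + Q v + QuadraticMap.polar Q u v :=
  QuadraticMap.map_add Q u v

/-- The polar form as a functional in the second variable. -/
def polarRight (u : V) : V →ₗ[ZMod 2] ZMod 2 := Q.polarBilin u

theorem polarRight_apply (u v : V) : polarRight Q u v = QuadraticMap.polar Q u v := rfl

/-- The orthogonal complement with respect to the polar form. -/
def polarOrthogonal (W : Submodule (ZMod 2) V) : Submodule (ZMod 2) V where
  carrier := {x | ∀ w ∈ W, QuadraticMap.polar Q x w = 0}
  zero_mem' := fun w _ => by simp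
  add_mem' := fun ha hb w hw => by rw [QuadraticMap.polar_add_left, ha w hw, hb w hw, add_zero]
  smul_mem' := fun c a ha w hw => by rw [QuadraticMap.polar_smul_left, ha w hw, smul_zero]

open Classical in
theorem sum_signChar_polar [Fintype V] (W : Submodule (ZMod 2) V) (x : V) :
    ∑ w : W, signChar (QuadraticMap.polar Q x w) =
      if x ∈ polarOrthogonal Q W then (Fintype.card W : ℤ) else 0 := by
  have h := sum_signChar_eq ((polarRight Q x).comp W.subtype)
  have h0 : (polarRight Q x).comp W.subtype = 0 ↔ x ∈ polarOrthogonal Q W := by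
    constructor
    · exact fun h w hw => LinearMap.congr_fun h ⟨w, hw⟩
    · exact fun h => LinearMap.ext fun w => h w w.2
  simp only [h0] at h
  exact h

open Classical in
-- The signs of the polar form on `V × W` are summed in both orders; by nondegeneracy only `w = 0`
-- contributes in the second.
theorem card_mul_card_polarOrthogonal [Fintype V]
    (hQ : ∀ x, (∀ y, QuadraticMap.polar Q x y = 0) → x = 0) (W : Submodule (ZMod 2) V) :
    Nat.card W * Nat.card (polarOrthogonal Q W) = Nat.card V := by
  have h1 : ∑ x : V, ∑ w : W, signChar (QuadraticMap.polar Q x w) =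
      (Nat.card W * Nat.card (polarOrthogonal Q W) : ℤ) := by
    simp only [sum_signChar_polar]
    rw [← Finset.sum_filter, Finset.sum_const, nsmul_eq_mul, mul_comm]
    simp only [Nat.card_eq_fintype_card]
    rw [Fintype.card_subtype (fun x => x ∈ polarOrthogonal Q W)]
  have h2 : ∑ x : V, ∑ w : W, signChar (QuadraticMap.polar Q x w) = (Nat.card V : ℤ) := by
    rw [Finset.sum_comm, Finset.sum_eq_single 0]
    · simp [signChar]
    · intro w _ hw
      have h3 := sum_signChar_eq (polarRight Q (w : V))
      rw [if_neg] at h3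
      · rw [← h3]
        refine Finset.sum_congr rfl fun x _ => ?_
        rw [polarRight_apply, QuadraticMap.polar_comm]
      · exact fun h => hw (Subtype.ext (hQ _ fun y => LinearMap.congr_fun h y))
    · simp
  exact_mod_cast h1.symm.trans h2

/-- A sum over the whole space reduces to the orthogonal complement of a totally singular
subspace. -/
theorem sum_signChar_quadratic [Fintype V] {W : Submodule (ZMod 2) V} (hW : ∀ x ∈ W, Q x = 0)
    [DecidablePred (· ∈ polarOrthogonal Q W)] :
    ∑ x, signChar (Q x) = ∑ x with x ∈ polarOrthogonal Q W, signChar (Q x) := by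
  classical
  -- Averaging over translates by `W` leaves the full sum unchanged, while the inner sum over `W`
  -- vanishes unless `x` is orthogonal to `W`.
  have h1 : (Fintype.card W : ℤ) * ∑ x, signChar (Q x) =
      Fintype.card W * ∑ x with x ∈ polarOrthogonal Q W, signChar (Q x) := by
    have h2 : ∑ w : W, ∑ x, signChar (Q (x + w)) = (Fintype.card W : ℤ) * ∑ x, signChar (Q x) := by
      have h3 : ∀ w : W, ∑ x, signChar (Q (x + w)) = ∑ x, signChar (Q x) := fun w =>
        Equiv.sum_comp (Equiv.addRight (w : V)) fun x => signChar (Q x)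
      simp [h3]
    rw [← h2, Finset.sum_comm, Finset.mul_sum, Finset.sum_filter]
    refine Finset.sum_congr rfl fun x _ => ?_
    have h3 : ∀ w : W, signChar (Q (x + w)) = signChar (Q x) *
        signChar (QuadraticMap.polar Q x w) := fun w => by
      rw [map_add_eq, hW w w.2, add_zero, signChar_add]
    simp only [h3, ← Finset.mul_sum, sum_signChar_polar]
    split_ifs <;> ring
  exact mul_left_cancel₀ (by exact_mod_cast Fintype.card_ne_zero) h1

theorem card_submodule_eq_pow [Finite V] (W : Submodule (ZMod 2) V) :
    Nat.card W = 2 ^ Module.finrank (ZMod 2) W := by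
  rw [Module.natCard_eq_pow_finrank (K := ZMod 2), Nat.card_zmod]

/-- Adjoining a singular vector to a totally singular subspace. -/
theorem exists_totallySingular_sup [Finite V] {W : Submodule (ZMod 2) V} (hW : ∀ x ∈ W, Q x = 0)
    {x : V} (hx : x ∈ polarOrthogonal Q W) (hxW : x ∉ W) (hQx : Q x = 0) :
    ∃ W' : Submodule (ZMod 2) V, (∀ x ∈ W', Q x = 0) ∧
      Module.finrank (ZMod 2) W' = Module.finrank (ZMod 2) W + 1 := by
  refine ⟨W ⊔ Submodule.span (ZMod 2) {x}, fun y hy => ?_, ?_⟩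
  · obtain ⟨w, hw, c, rfl⟩ := Submodule.mem_sup.1 hy |> fun ⟨w, hw, u, hu, h⟩ =>
      (⟨w, hw, _, by rw [(Submodule.mem_span_singleton.1 hu).choose_spec, h]⟩ :
        ∃ w ∈ W, ∃ c : ZMod 2, w + c • x = y)
    rw [map_add_eq, hW w hw, QuadraticMap.map_smul, hQx, QuadraticMap.polar_smul_right,
      QuadraticMap.polar_comm, hx w hw]
    simp
  · exact Submodule.finrank_sup_span_singleton hxW

variable {Q} {m : ℕ}

theorem IsMinusType.finite (h : IsMinusType m Q) : Finite V := by
  have : Module.Finite (ZMod 2) V :=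
    Module.finite_of_finrank_pos (by rw [h.2.1]; have := h.1; omega)
  exact Module.finite_of_finite (ZMod 2)

theorem IsMinusType.finrank_lt (h : IsMinusType m Q) {W : Submodule (ZMod 2) V}
    (hW : ∀ x ∈ W, Q x = 0) : Module.finrank (ZMod 2) W < m := by
  have := h.2.2.2.2 ⟨W, hW, rfl⟩
  have := h.1
  omega

theorem IsMinusType.card_eq (h : IsMinusType m Q) : Nat.card V = 2 ^ (2 * m) := by
  have := h.finite
  rw [Module.natCard_eq_pow_finrank (K := ZMod 2), h.2.1, Nat.card_zmod]

/-- The number of nonsingular vectors of a form of minus type. -/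
theorem IsMinusType.two_mul_card_nonsingular (h : IsMinusType m Q) :
    2 * Nat.card {v : V // Q v = 1} = 2 ^ m * (2 ^ m + 1) := by
  classical
  have := h.finite
  have := Fintype.ofFinite V
  obtain ⟨W, hW, hWm⟩ := h.2.2.2.1
  obtain ⟨l, rfl⟩ : ∃ l, m = l + 1 := ⟨m - 1, by have := h.1; omega⟩
  have hWo : W ≤ polarOrthogonal Q W := fun x hx w hw => by
    have := map_add_eq Q x w
    rw [hW _ (W.add_mem hx hw), hW x hx, hW w hw] at this
    simpa using this.symm
  have hcW : Nat.card W = 2 ^ l := by rw [card_submodule_eq_pow, hWm]; rfl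
  have hco : Nat.card (polarOrthogonal Q W) = 2 ^ (l + 2) := by
    have h1 := card_mul_card_polarOrthogonal Q h.2.2.1 W
    rw [hcW, h.card_eq] at h1
    refine Nat.eq_of_mul_eq_mul_left (pow_pos two_pos l) (h1.trans ?_)
    rw [← pow_add]
    congr 1
    ring
  -- A singular vector here would enlarge `W` beyond the maximal dimension.
  have hone : ∀ x ∈ polarOrthogonal Q W, x ∉ W → Q x = 1 := fun x hx hxW => by
    refine (ZMod.two_eq_zero_or_one _).resolve_left fun hQx => ?_
    obtain ⟨W', hW', hr⟩ := exists_totallySingular_sup Q hW hx hxW hQx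
    have := h.finrank_lt hW'
    omega
  have hs1 : ∑ x with x ∈ polarOrthogonal Q W, signChar (Q x) = 2 ^ l - (2 ^ (l + 2) - 2 ^ l) := by
    have h3 : ∀ x ∈ polarOrthogonal Q W, signChar (Q x) = 2 * (if x ∈ W then 1 else 0) - 1 := by
      intro x hx
      by_cases hxW : x ∈ W
      · simp [hxW, hW x hxW, signChar]
      · simp [hxW, hone x hx hxW, signChar]
    rw [Finset.sum_congr rfl fun x hx => h3 x (Finset.mem_filter.1 hx).2, Finset.sum_sub_distrib,
      ← Finset.mul_sum, Finset.sum_boole, Finset.filter_filter]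
    have h4 : (Finset.univ.filter fun x => x ∈ polarOrthogonal Q W ∧ x ∈ W).card = 2 ^ l := by
      rw [← hcW, Nat.card_eq_fintype_card, Fintype.card_subtype]
      congr 1
      ext x
      simpa using fun hx => hWo hx
    have h5 : (Finset.univ.filter fun x => x ∈ polarOrthogonal Q W).card = 2 ^ (l + 2) := by
      rw [← hco, Nat.card_eq_fintype_card, Fintype.card_subtype]
    rw [h4, Finset.sum_const, h5]
    push_cast
    ring
  have hs2 : ∑ x, signChar (Q x) = 2 ^ (2 * (l + 1)) - 2 * Nat.card {v : V // Q v = 1} := by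
    have h3 : ∀ x, signChar (Q x) = 1 - 2 * (if Q x = 1 then 1 else 0) := by
      intro x
      rcases ZMod.two_eq_zero_or_one (Q x) with hx | hx <;> simp [hx, signChar]
    simp only [h3, Finset.sum_sub_distrib, ← Finset.mul_sum]
    rw [Finset.sum_boole, Nat.card_eq_fintype_card, Fintype.card_subtype]
    have h4 := h.card_eq
    rw [Nat.card_eq_fintype_card] at h4
    simp [h4]
  have h5 := (sum_signChar_quadratic Q hW).symm.trans hs2
  rw [hs1] at h5
  have h6 : (2 * Nat.card {v : V // Q v = 1} : ℤ) = 2 ^ (l + 1) * (2 ^ (l + 1) + 1) := by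
    have : (2 : ℤ) ^ (2 * (l + 1)) = 2 ^ (l + 1) * 2 ^ (l + 1) := by rw [two_mul, pow_add]
    rw [this] at h5
    rw [pow_add (2 : ℤ) l 2] at h5
    linear_combination h5
  exact_mod_cast h6

end MinusType

/-! ### Transitivity of isometries and the Sylow order -/

section Isometries

variable {V : Type*} [AddCommGroup V] [Module (ZMod 2) V] (Q : QuadraticForm (ZMod 2) V)

theorem transvection_involutive (v : V) :
    Function.Involutive (LinearMap.id + (polarRight Q v).smulRight v : V →ₗ[ZMod 2] V) := by
  intro x
  simp only [LinearMap.add_apply, LinearMap.id_apply, LinearMap.smulRight_apply, map_add, map_smul,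
    polarRight_apply, polar_self_eq_zero, zero_smul, add_zero, add_assoc, ZMod.add_self_eq_zero]

/-- The orthogonal transvection with respect to a nonsingular vector. -/
def orthogonalTransvection {v : V} (hv : Q v = 1) : isometryGroup Q :=
  ⟨LinearEquiv.ofInvolutive _ (transvection_involutive Q v), fun x => by
    change Q (x + QuadraticMap.polar Q v x • v) = Q x
    rw [map_add_eq, QuadraticMap.map_smul, hv, QuadraticMap.polar_smul_right,
      QuadraticMap.polar_comm Q x v]
    generalize QuadraticMap.polar Q v x = a
    generalize Q x = b
    revert a b
    decide⟩

theorem orthogonalTransvection_smul {v : V} (hv : Q v = 1) (x : V) :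
    orthogonalTransvection Q hv • x = x + QuadraticMap.polar Q v x • v := rfl

variable {Q} {m : ℕ}

/-- The vector `u + v` is nonsingular, and its transvection swaps `u` and `v`. -/
theorem mem_orbit_of_polar_eq_one {u v : V} (hu : Q u = 1) (hv : Q v = 1)
    (huv : QuadraticMap.polar Q u v = 1) : v ∈ MulAction.orbit (isometryGroup Q) u := by
  have h : Q (u + v) = 1 := by rw [map_add_eq, hu, hv, huv]; decide
  refine ⟨orthogonalTransvection Q h, ?_⟩
  change orthogonalTransvection Q h • u = v
  rw [orthogonalTransvection_smul, QuadraticMap.polar_add_left, polar_self_eq_zero,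
    QuadraticMap.polar_comm, huv, zero_add, one_smul, ← add_assoc, ZMod.add_self_eq_zero, zero_add]

theorem exists_polar_eq_one_eq_one (hQ : ∀ x, (∀ y, QuadraticMap.polar Q x y = 0) → x = 0)
    {u v : V} (hu : u ≠ 0) (hv : v ≠ 0) :
    ∃ w, QuadraticMap.polar Q u w = 1 ∧ QuadraticMap.polar Q v w = 1 := by
  have key : ∀ x : V, x ≠ 0 → ∃ a, QuadraticMap.polar Q x a = 1 := fun x hx => by
    by_contra! h
    exact hx (hQ x fun y => (ZMod.two_eq_zero_or_one _).resolve_right (h y))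
  obtain ⟨a, ha⟩ := key u hu
  obtain ⟨b, hb⟩ := key v hv
  rcases ZMod.two_eq_zero_or_one (QuadraticMap.polar Q v a) with h1 | h1
  · rcases ZMod.two_eq_zero_or_one (QuadraticMap.polar Q u b) with h2 | h2
    · exact ⟨a + b, by rw [QuadraticMap.polar_add_right, ha, h2, add_zero],
        by rw [QuadraticMap.polar_add_right, hb, h1, zero_add]⟩
    · exact ⟨b, h2, hb⟩
  · exact ⟨a, ha, h1⟩

/-- Otherwise each `w` with both polar values `1` is singular. Then the complement of `u, v, w` is
totally singular, and with `w` has dimension at least `2m - 2`, so `m ≤ 1`. But `u + v` is singular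
and nonzero, so `m ≥ 2`. -/
theorem IsMinusType.exists_common_neighbour (h : IsMinusType m Q) {u v : V} (hu : Q u = 1)
    (hv : Q v = 1) (hne : u ≠ v) (huv : QuadraticMap.polar Q u v = 0) :
    ∃ w, Q w = 1 ∧ QuadraticMap.polar Q u w = 1 ∧ QuadraticMap.polar Q v w = 1 := by
  have := h.finite
  by_contra! hcon
  have hs : ∀ w, QuadraticMap.polar Q u w = 1 → QuadraticMap.polar Q v w = 1 → Q w = 0 :=
    fun w h1 h2 => (ZMod.two_eq_zero_or_one _).resolve_right fun h3 => hcon w h3 h1 h2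
  have hm2 : 2 ≤ m := by
    have h0 : Q (u + v) = 0 := by rw [map_add_eq, hu, hv, huv]; decide
    have h1 : u + v ≠ 0 := fun h1 => hne (by
      rw [← add_zero u, ← ZMod.add_self_eq_zero v, ← add_assoc, h1, zero_add])
    have h2 := h.finrank_lt (W := Submodule.span (ZMod 2) {u + v}) fun x hx => by
      obtain ⟨c, rfl⟩ := Submodule.mem_span_singleton.1 hx
      rw [QuadraticMap.map_smul, h0, smul_zero]
    rw [finrank_span_singleton h1] at h2
    exact h2
  obtain ⟨w, hw1, hw2⟩ := exists_polar_eq_one_eq_one h.2.2.1 (u := u) (v := v)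
    (by rintro rfl; simp at hu) (by rintro rfl; simp at hv)
  let f : V →ₗ[ZMod 2] (Fin 3 → ZMod 2) :=
    LinearMap.pi ![polarRight Q u, polarRight Q v, polarRight Q w]
  have hf : ∀ x ∈ LinearMap.ker f, QuadraticMap.polar Q u x = 0 ∧ QuadraticMap.polar Q v x = 0 ∧
      QuadraticMap.polar Q w x = 0 := fun x hx =>
    ⟨congrFun hx 0, congrFun hx 1, congrFun hx 2⟩
  have hker : ∀ x ∈ LinearMap.ker f, Q x = 0 := fun x hx => by
    obtain ⟨h1, h2, h3⟩ := hf x hx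
    have h4 := hs (w + x) (by rw [QuadraticMap.polar_add_right, hw1, h1, add_zero])
      (by rw [QuadraticMap.polar_add_right, hw2, h2, add_zero])
    rwa [map_add_eq, hs w hw1 hw2, h3, zero_add, add_zero] at h4
  obtain ⟨W, hW, hWr⟩ := exists_totallySingular_sup Q hker (x := w) (fun x hx => (hf x hx).2.2)
    (fun hwk => by simpa [hw1] using (hf w hwk).1) (hs w hw1 hw2)
  have h1 := f.finrank_range_add_finrank_ker
  have h2 : Module.finrank (ZMod 2) (LinearMap.range f) ≤ 3 := by
    simpa using Submodule.finrank_le (LinearMap.range f)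
  have h3 := h.finrank_lt hW
  rw [h.2.1] at h1
  omega

/-- Any two nonsingular vectors are joined by at most two steps of polar value `1`. -/
theorem IsMinusType.orbit_eq (h : IsMinusType m Q) {u : V} (hu : Q u = 1) :
    MulAction.orbit (isometryGroup Q) u = {v | Q v = 1} := by
  ext v
  constructor
  · rintro ⟨g, rfl⟩
    exact (g.2 u).trans hu
  · intro hv
    by_cases hne : u = v
    · exact hne ▸ MulAction.mem_orbit_self u
    · rcases ZMod.two_eq_zero_or_one (QuadraticMap.polar Q u v) with h1 | h1
      · obtain ⟨w, hw, h2, h3⟩ := h.exists_common_neighbour hu hv hne h1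
        have h4 := mem_orbit_of_polar_eq_one hu hw h2
        have h5 := mem_orbit_of_polar_eq_one hw hv ((QuadraticMap.polar_comm Q w v).trans h3)
        rwa [← MulAction.orbit_eq_iff.2 h4]
      · exact mem_orbit_of_polar_eq_one hu hv h1

theorem finite_linearEquiv {k V : Type*} [Field k] [AddCommGroup V] [Module k V] [Finite V] :
    Finite (V ≃ₗ[k] V) := DFunLike.finite _

theorem IsMinusType.dvd_card_isometryGroup (h : IsMinusType m Q) {p : ℕ} (hp : p.Prime)
    (hpm : p = 2 ^ m + 1) : p ∣ Nat.card (isometryGroup Q) := by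
  have := h.finite
  have := finite_linearEquiv (k := ZMod 2) (V := V)
  have hc := h.two_mul_card_nonsingular
  have hpos : 0 < Nat.card {v : V // Q v = 1} := by
    by_contra h0
    rw [Nat.eq_zero_of_not_pos h0] at hc
    simp at hc
  obtain ⟨⟨u, hu⟩⟩ := (Nat.card_pos_iff.1 hpos).1
  have h1 : Nat.card {v : V // Q v = 1} ∣ Nat.card (isometryGroup Q) := by
    have h2 := Nat.card_congr (MulAction.orbitEquivQuotientStabilizer (isometryGroup Q) u)
    rw [h.orbit_eq hu] at h2
    change Nat.card {v : V // Q v = 1} = _ at h2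
    rw [h2]
    exact Subgroup.card_quotient_dvd_card _
  have h2 : p ∣ 2 * Nat.card {v : V // Q v = 1} := by
    rw [hc, ← hpm]
    exact dvd_mul_left _ _
  refine ((hp.dvd_mul.1 h2).resolve_left fun h3 => ?_).trans h1
  have h4 := (Nat.prime_dvd_prime_iff_eq hp Nat.prime_two).1 h3
  have h5 := Nat.one_lt_two_pow (n := m) (by have := h.1; omega)
  omega

/-- As `2 ^ m ≡ -1`, for `j = m + i` a divisor `p` of `2 ^ j - 1` would divide `2 ^ i + 1 < p`;
smaller `j` are excluded by size. -/
theorem not_dvd_two_pow_sub_one {p : ℕ} (hpm : p = 2 ^ m + 1) {j : ℕ}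
    (hj0 : 0 < j) (hj : j < 2 * m) : ¬ p ∣ 2 ^ j - 1 := by
  intro hd
  have h1 : 1 ≤ 2 ^ j := Nat.one_le_two_pow
  by_cases hjm : j ≤ m
  · have h2 : 2 ^ j ≤ 2 ^ m := Nat.pow_le_pow_right two_pos hjm
    have h3 : 1 < 2 ^ j := Nat.one_lt_two_pow hj0.ne'
    have := Nat.le_of_dvd (by omega) hd
    omega
  · obtain ⟨i, rfl⟩ : ∃ i, j = m + i := ⟨j - m, by omega⟩
    have h2 : 2 ^ i < 2 ^ m := Nat.pow_lt_pow_right one_lt_two (by omega)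
    have h3 : 2 ^ i * p = (2 ^ (m + i) - 1) + (2 ^ i + 1) := by
      rw [hpm, mul_add, mul_one, ← pow_add, add_comm i m]
      omega
    have h4 : p ∣ 2 ^ i + 1 := (Nat.dvd_add_right hd).1 (h3 ▸ dvd_mul_left p _)
    have := Nat.le_of_dvd (Nat.succ_pos _) h4
    omega

theorem sq_not_dvd_card_GL {p : ℕ} (hp : p.Prime) (hpm : p = 2 ^ m + 1) (hm : 1 ≤ m) :
    ¬ p ^ 2 ∣ Nat.card (GL (Fin (2 * m)) (ZMod 2)) := by
  have hp2 : ∀ i, ¬ p ∣ 2 ^ i := fun i h => by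
    have h4 := (Nat.prime_dvd_prime_iff_eq hp Nat.prime_two).1 (hp.dvd_of_dvd_pow h)
    have h5 := Nat.one_lt_two_pow (n := m) (by omega)
    omega
  rw [Matrix.card_GL_field, ZMod.card]
  obtain ⟨l, hl⟩ : ∃ l, 2 * m = l + 1 := ⟨2 * m - 1, by omega⟩
  rw [hl, Fin.prod_univ_succ]
  intro h
  -- The first factor `2 ^ (2m) - 1` of the order supplies the only `p`; the others are `2 ^ j (2 ^
  -- (2m - j) - 1)` with `0 < j < 2m`.
  have h1 : 2 ^ (l + 1) - 2 ^ ((0 : Fin (l + 1)) : ℕ) = p * (2 ^ m - 1) := by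
    have e : 2 ^ (l + 1) = 2 ^ m * 2 ^ m := by rw [← hl, two_mul, pow_add]
    obtain ⟨a, ha⟩ : ∃ a, 2 ^ m = a + 1 := ⟨2 ^ m - 1, by have := Nat.one_le_two_pow (n := m); omega⟩
    have e2 : (a + 1) * (a + 1) = (a + 1 + 1) * a + 1 := by ring
    rw [Fin.val_zero, pow_zero, e, hpm, ha, e2, Nat.add_sub_cancel, Nat.add_sub_cancel]
  rw [h1, sq, mul_assoc, Nat.mul_dvd_mul_iff_left hp.pos] at h
  rcases hp.dvd_mul.1 h with h | h
  · exact not_dvd_two_pow_sub_one hpm (j := m) hm (by omega) h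
  · obtain ⟨i, -, hi⟩ := (hp.prime.dvd_finsetProd_iff _).1 h
    rw [Fin.val_succ] at hi
    have h2 : 2 ^ (l + 1) - 2 ^ (i + 1 : ℕ) = 2 ^ (i + 1 : ℕ) * (2 ^ (l - i) - 1) := by
      rw [Nat.mul_sub, ← pow_add, mul_one]
      congr 2
      omega
    rw [h2] at hi
    rcases hp.dvd_mul.1 hi with h | h
    · exact hp2 _ h
    · exact not_dvd_two_pow_sub_one hpm (by omega) (by omega) h

theorem IsMinusType.card_sylow (h : IsMinusType m Q) {p : ℕ} [hp : Fact p.Prime]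
    (hpm : p = 2 ^ m + 1) (P : Sylow p (isometryGroup Q)) : Nat.card P = p := by
  have := h.finite
  have := finite_linearEquiv (k := ZMod 2) (V := V)
  have hfin : Module.Finite (ZMod 2) V := Module.finite_of_finrank_pos (by
    rw [h.2.1]; have := h.1; omega)
  have h0 : Nat.card (isometryGroup Q) ∣ Nat.card (GL (Fin (2 * m)) (ZMod 2)) := by
    have e1 := LinearMap.GeneralLinearGroup.generalLinearEquiv (ZMod 2) V
    let b := Module.finBasisOfFinrankEq (ZMod 2) V h.2.1
    have e2 := Units.mapEquiv (LinearMap.toMatrixAlgEquiv b).toMulEquiv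
    rw [← Nat.card_congr (e1.symm.trans e2).toEquiv]
    exact Subgroup.card_subgroup_dvd_card _
  rw [P.card_eq_multiplicity]
  have h1 : (Nat.card (isometryGroup Q)).factorization p = 1 := by
    have hne : Nat.card (isometryGroup Q) ≠ 0 := Nat.card_pos.ne'
    refine le_antisymm ?_ ?_
    · by_contra h2
      exact sq_not_dvd_card_GL hp.out hpm h.1
        (((hp.out.pow_dvd_iff_le_factorization hne).2 (by omega)).trans h0)
    · exact (hp.out.dvd_iff_one_le_factorization hne).1 (h.dvd_card_isometryGroup hp.out hpm)
  rw [h1, pow_one]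

end Isometries

/-! ### Lifting isometries to automorphisms of extraspecial groups -/

theorem exists_addHom_ne_zero_of_module (K : Type*) [Field K] {M : Type*} [AddCommGroup M]
    [Module K M] {a : M} (ha : a ≠ 0) : ∃ f : M →+ K, f a ≠ 0 := by
  obtain ⟨f, hf⟩ := Module.Projective.exists_dual_ne_zero K ha
  exact ⟨f.toAddMonoidHom, hf⟩

theorem exists_addHom_zmod_ne_zero {p : ℕ} [Fact p.Prime] {M : Type*} [AddCommGroup M]
    (h : ∀ x : M, p • x = 0) {a : M} (ha : a ≠ 0) : ∃ f : M →+ ZMod p, f a ≠ 0 :=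
  @exists_addHom_ne_zero_of_module (ZMod p) _ M _ (AddCommGroup.zmodModule h) a ha

/-- If `N` contains all commutators and `p`-th powers, then the elements outside `N` are detected
by homomorphisms to the group of order `p` that are trivial on `N`. -/
theorem exists_hom_zmod_ne_one {p : ℕ} [Fact p.Prime] {X : Type*} [Group X] (N : Subgroup X)
    (hN : commutator X ≤ N) (h : ∀ x, x ^ p ∈ N) {a : X} (ha : a ∉ N) :
    ∃ χ : X →* Multiplicative (ZMod p), (∀ x ∈ N, χ x = 1) ∧ χ a ≠ 1 := by
  have hnormal : N.Normal := Subgroup.Normal.of_commutator_le X hN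
  let _ : CommGroup (X ⧸ N) :=
    { (inferInstance : Group (X ⧸ N)) with
      mul_comm := by
        rintro ⟨x⟩ ⟨y⟩
        refine QuotientGroup.eq.2 (hN ?_)
        have : (x * y)⁻¹ * (y * x) = ⁅y⁻¹, x⁻¹⁆ := by
          rw [commutatorElement_def]
          group
        rw [this]
        exact Subgroup.commutator_mem_commutator (Subgroup.mem_top _) (Subgroup.mem_top _) }
  have ha' : Additive.ofMul (a : X ⧸ N) ≠ 0 := fun h0 => ha ((QuotientGroup.eq_one_iff a).1 h0)
  obtain ⟨f, hf⟩ := exists_addHom_zmod_ne_zero (p := p) (M := Additive (X ⧸ N)) (by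
    rintro ⟨x⟩
    exact (QuotientGroup.eq_one_iff (x ^ p)).2 (h x)) ha'
  refine ⟨(AddMonoidHom.toMultiplicativeRight f).comp (QuotientGroup.mk' N), fun x hx => ?_, hf⟩
  change Multiplicative.ofAdd (f (Additive.ofMul (x : X ⧸ N))) = 1
  rw [(QuotientGroup.eq_one_iff x).2 hx, ofMul_one, map_zero, ofAdd_zero]

/-- A commutator is a product of conjugates of squares and their inverses. -/
theorem commutator_le_of_sq_mem {X : Type*} [Group X] {N : Subgroup X} [hN : N.Normal]
    (h : ∀ x, x ^ 2 ∈ N) : commutator X ≤ N := by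
  refine Subgroup.commutator_le.2 fun a _ b _ => ?_
  have : ⁅a, b⁆ = (a * b) ^ 2 * (b⁻¹ * (a ^ 2)⁻¹ * b) * (b ^ 2)⁻¹ := by
    rw [commutatorElement_def]
    simp only [sq]
    group
  rw [this]
  exact mul_mem (mul_mem (h _) (by simpa using hN.conj_mem _ (inv_mem (h a)) b⁻¹)) (inv_mem (h b))

section Lift

variable {E V : Type*} [Group E] [Finite E] [AddCommGroup V] [Module (ZMod 2) V] {z : E}
  {π : E →* Multiplicative V} {Q : QuadraticForm (ZMod 2) V}

/-- On the fibre product `D` of pairs with `π y = g (π x)`, invariance of `Q` gives `x ^ 2 = y ^ 2`.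
So `D` modulo the diagonal centre `N` is elementary abelian. A character trivial on `N` but not on
`(1, z)` has as kernel the graph of the required automorphism. -/
theorem exists_lift_isometry (hz1 : z ≠ 1) (hz : z ∈ Subgroup.center E)
    (hZ : ∀ x ∈ Subgroup.center E, x = 1 ∨ x = z) (hπ : IsSquaringForm π Q)
    (g : isometryGroup Q) :
    ∃ α : MulAut E, ∀ x, (π (α x)).toAdd = g.1 (π x).toAdd := by
  obtain ⟨hsurj, hker, hsq⟩ := hπ
  have hmem : ∀ x, x ∈ Subgroup.center E ↔ (π x).toAdd = 0 := fun x => by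
    rw [← hker]
    exact Iff.rfl
  let D : Subgroup (E × E) :=
    { carrier := {w | (π w.2).toAdd = g.1 (π w.1).toAdd}
      one_mem' := by simp
      mul_mem' := by
        intro a b ha hb
        simp only [Set.mem_ofPred_eq] at ha hb ⊢
        simp only [Prod.snd_mul, Prod.fst_mul, map_mul, toAdd_mul, map_add, ha, hb]
      inv_mem' := by
        intro a ha
        simp only [Set.mem_ofPred_eq] at ha ⊢
        simp only [Prod.snd_inv, Prod.fst_inv, map_inv, toAdd_inv, map_neg, ha] }
  have hD : ∀ w : E × E, w ∈ D ↔ (π w.2).toAdd = g.1 (π w.1).toAdd := fun w => Iff.rfl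
  have hsqc : ∀ x : E, x ^ 2 ∈ Subgroup.center E := fun x => by
    rw [hmem, map_pow, toAdd_pow, two_smul]
    exact ZMod.add_self_eq_zero _
  let N : Subgroup D :=
    { carrier := {w | w.1.1 = w.1.2 ∧ w.1.1 ∈ Subgroup.center E}
      one_mem' := ⟨rfl, one_mem _⟩
      mul_mem' := fun {a b} ha hb => ⟨congrArg₂ (· * ·) ha.1 hb.1, mul_mem ha.2 hb.2⟩
      inv_mem' := fun {a} ha => ⟨congrArg _ ha.1, inv_mem ha.2⟩ }
  have hNsq : ∀ w : D, w ^ 2 ∈ N := by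
    rintro ⟨⟨x, y⟩, hw⟩
    refine ⟨?_, hsqc x⟩
    change x ^ 2 = y ^ 2
    have hiff : x ^ 2 = 1 ↔ y ^ 2 = 1 := by
      rw [hsq, hsq, (hD _).1 hw, g.2]
    rcases hZ _ (hsqc x) with h1 | h1
    · rw [h1, hiff.1 h1]
    · rcases hZ _ (hsqc y) with h2 | h2
      · exact absurd (h1.symm.trans (hiff.2 h2)) hz1
      · rw [h1, h2]
  have hNn : N.Normal := by
    refine ⟨fun n hn w => ⟨?_, ?_⟩⟩
    · change w.1.1 * n.1.1 * w.1.1⁻¹ = w.1.2 * n.1.2 * w.1.2⁻¹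
      rw [← hn.1, Subgroup.mem_center_iff.1 hn.2, Subgroup.mem_center_iff.1 hn.2]
      simp
    · change w.1.1 * n.1.1 * w.1.1⁻¹ ∈ _
      rw [Subgroup.mem_center_iff.1 hn.2]
      simpa using hn.2
  have hNc : commutator D ≤ N := commutator_le_of_sq_mem hNsq
  have hz1D : ((1 : E), z) ∈ D := by
    rw [hD, (hmem z).1 hz]
    simp
  obtain ⟨χ, hχN, hχ⟩ := exists_hom_zmod_ne_one (p := 2) N hNc hNsq (a := ⟨(1, z), hz1D⟩)
    fun h => hz1 h.1.symm
  have hdich : ∀ c : Multiplicative (ZMod 2), c = 1 ∨ c = Multiplicative.ofAdd 1 := by decide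
  -- The candidates over `x` are `y` and `y z`; `χ` takes different values on them.
  have hex : ∀ x, ∃ y, ∃ h : (x, y) ∈ D, χ ⟨(x, y), h⟩ = 1 := by
    intro x
    obtain ⟨y, hy⟩ := hsurj (Multiplicative.ofAdd (g.1 (π x).toAdd))
    have hxy : (x, y) ∈ D := by rw [hD, hy]; rfl
    rcases hdich (χ ⟨(x, y), hxy⟩) with h1 | h1
    · exact ⟨y, hxy, h1⟩
    · refine ⟨y * z, ?_⟩
      have hmul := D.mul_mem hxy hz1D
      rw [Prod.mk_mul_mk, mul_one] at hmul
      refine ⟨hmul, ?_⟩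
      have h2 : (⟨(x, y * z), hmul⟩ : D) = ⟨(x, y), hxy⟩ * ⟨(1, z), hz1D⟩ :=
        Subtype.ext (Prod.ext (mul_one x).symm rfl)
      rw [h2, map_mul, h1, (hdich _).resolve_left hχ]
      rfl
  have huniq : ∀ y (h : (1, y) ∈ D), χ ⟨(1, y), h⟩ = 1 → y = 1 := by
    intro y h h1
    have hy : y ∈ Subgroup.center E := by
      rw [hmem, (hD _).1 h]
      simp
    refine (hZ y hy).resolve_right ?_
    rintro rfl
    exact hχ h1
  choose f hfD hf using hex
  have heq : ∀ x y (h : (x, y) ∈ D), χ ⟨(x, y), h⟩ = 1 → f x = y := by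
    intro x y h h1
    have h2 := D.mul_mem (D.inv_mem (hfD x)) h
    have h3 : ((x, f x)⁻¹ * (x, y) : E × E) = (1, (f x)⁻¹ * y) := by simp
    rw [h3] at h2
    refine inv_mul_eq_one.1 (huniq _ h2 ?_)
    have h4 : (⟨(1, (f x)⁻¹ * y), h2⟩ : D) = ⟨(x, f x), hfD x⟩⁻¹ * ⟨(x, y), h⟩ :=
      Subtype.ext h3.symm
    rw [h4, map_mul, map_inv, hf, h1, inv_one, one_mul]
  let α : E →* E := MonoidHom.mk' f fun x y => by
    refine heq _ _ (D.mul_mem (hfD x) (hfD y)) ?_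
    have h4 : (⟨(x, f x) * (y, f y), D.mul_mem (hfD x) (hfD y)⟩ : D) =
      ⟨(x, f x), hfD x⟩ * ⟨(y, f y), hfD y⟩ := rfl
    exact h4 ▸ (by rw [map_mul, hf, hf, one_mul])
  have hinj : Function.Injective α := by
    refine (injective_iff_map_eq_one _).2 fun x hx => ?_
    change f x = 1 at hx
    have h1 := (hD _).1 (hfD x)
    simp only [hx, map_one, toAdd_one] at h1
    have hxc : x ∈ Subgroup.center E := (hmem x).2 (g.1.map_eq_zero_iff.1 h1.symm)
    refine (hZ x hxc).resolve_right ?_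
    rintro rfl
    have hxx : (x, x) ∈ D := by
      rw [hD, (hmem x).1 hz]
      simp
    have h2 : χ ⟨(x, x), hxx⟩ = 1 := hχN _ ⟨rfl, hz⟩
    exact hz1 ((heq x x hxx h2).symm.trans hx)
  exact ⟨MulEquiv.ofBijective α (Finite.injective_iff_bijective.1 hinj), fun x => (hD _).1 (hfD x)⟩

/-- If `α` lifts a generator, `α ^ p` moves elements only by `1` or `z` and has square `1`. As `p +
1` is even, `α ^ (p + 1)` has `p`-th power `1`, and it lifts the same generator. -/
theorem exists_lift_action (hz1 : z ≠ 1) (hz : z ∈ Subgroup.center E)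
    (hZ : ∀ x ∈ Subgroup.center E, x = 1 ∨ x = z) (hπ : IsSquaringForm π Q)
    {p : ℕ} [hp : Fact p.Prime] (hp2 : p ≠ 2) {P : Subgroup (isometryGroup Q)}
    (hP : Nat.card P = p) : ∃ φ : P →* MulAut E, IsLiftedAction π φ := by
  have : Fact (Nat.card P).Prime := hP ▸ ‹_›
  have : IsCyclic P := isCyclic_of_prime_card hP
  obtain ⟨q₀, hq₀⟩ := IsCyclic.exists_generator (α := P)
  have hord : orderOf q₀ = p := by rw [orderOf_eq_card_of_forall_mem_zpowers hq₀, hP]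
  have hq₀p : q₀ ^ p = 1 := hord ▸ pow_orderOf_eq_one q₀
  obtain ⟨α, hα⟩ := exists_lift_isometry hz1 hz hZ hπ (q₀ : isometryGroup Q)
  have hmem : ∀ x, x ∈ Subgroup.center E ↔ (π x).toAdd = 0 := fun x => by
    rw [← hπ.2.1]
    exact Iff.rfl
  have hpow : ∀ (β : MulAut E) (q : P), (∀ x, (π (β x)).toAdd = (q : isometryGroup Q).1 (π x).toAdd) →
      ∀ (i : ℕ) (x : E), (π ((β ^ i) x)).toAdd = ((q ^ i : P) : isometryGroup Q).1 (π x).toAdd := by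
    intro β q hβ i
    induction i with
    | zero => intro x; simp
    | succ i ih =>
      intro x
      rw [pow_succ, MulAut.mul_apply, ih, hβ, pow_succ]
      rfl
  have hcen : ∀ (β : MulAut E), β z = z := fun β => by
    refine (hZ _ ?_).resolve_left fun h => hz1 (β.injective (by rw [h, map_one]))
    rw [Subgroup.mem_center_iff] at hz ⊢
    intro g
    obtain ⟨g, rfl⟩ := β.surjective g
    rw [← map_mul, hz, map_mul]
  have hz2 : z * z = 1 := (hZ _ (mul_mem hz hz)).resolve_right fun h => hz1 (by simpa using h)
  have hα2 : (α ^ p) ^ 2 = 1 := by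
    ext x
    have hx : (α ^ p) x * x⁻¹ ∈ Subgroup.center E := by
      rw [hmem, map_mul, map_inv, toAdd_mul, toAdd_inv, hpow α q₀ hα, hq₀p]
      simp
    rw [sq, MulAut.mul_apply, MulAut.one_apply]
    rcases hZ _ hx with h | h
    · rw [mul_inv_eq_one.1 h, mul_inv_eq_one.1 h]
    · rw [mul_inv_eq_iff_eq_mul] at h
      rw [h, map_mul, hcen, h, ← mul_assoc, hz2, one_mul]
  obtain ⟨l, hl⟩ : ∃ l, p + 1 = 2 * l := by
    obtain ⟨l, hl⟩ := (hp.out.odd_of_ne_two hp2)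
    exact ⟨l + 1, by omega⟩
  have hβp : (α ^ (p + 1)) ^ p = 1 := by
    rw [← pow_mul, mul_comm, pow_mul, hl, pow_mul, hα2, one_pow]
  have hβ : ∀ x, (π ((α ^ (p + 1)) x)).toAdd = (q₀ : isometryGroup Q).1 (π x).toAdd := fun x => by
    rw [hpow α q₀ hα, pow_succ, hq₀p, one_mul]
  have hdvd : orderOf (α ^ (p + 1)) ∣ orderOf q₀ := by
    rw [hord]
    exact orderOf_dvd_of_pow_eq_one hβp
  refine ⟨monoidHomOfForallMemZpowers hq₀ hdvd, fun q x => ?_⟩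
  have : Finite P := Nat.finite_of_card_ne_zero (hP ▸ NeZero.ne p)
  obtain ⟨i, rfl⟩ := mem_powers_iff_mem_zpowers.2 (hq₀ q)
  change (π (monoidHomOfForallMemZpowers hq₀ hdvd (q₀ ^ i) x)).toAdd = _
  rw [map_pow, monoidHomOfForallMemZpowers_apply_gen]
  exact hpow _ _ hβ i x

end Lift

/-! ### Extraspecial groups -/

/-- Each element outside the centre is avoided by a maximal subgroup of index `p`. Conversely, if a
maximal `M` missed part of the centre, `M` and the centre would generate `E`, so all commutators,
hence the centre, would lie in `M`. -/
theorem isExtraspecial_of {p : ℕ} [hp : Fact p.Prime] {E : Type*} [Group E]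
    (hE : IsPGroup p E) (hcard : Nat.card (Subgroup.center E) = p)
    (hcomm : commutator E = Subgroup.center E) (hpow : ∀ x : E, x ^ p ∈ Subgroup.center E) :
    IsExtraspecial p E := by
  refine ⟨hE, hcard, hcomm, le_antisymm (fun x hx => ?_) (le_iInf₂ fun M hM => ?_)⟩
  · by_contra hxc
    obtain ⟨χ, -, hχ⟩ := exists_hom_zmod_ne_one (p := p) (Subgroup.center E) hcomm.le hpow hxc
    have hco : IsCoatom χ.ker := by
      have : Fact (Nat.card (Multiplicative (ZMod p))).Prime := ⟨by simpa using hp.out⟩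
      have hr : χ.range = ⊤ := by
        refine (Subgroup.eq_bot_or_eq_top_of_prime_card χ.range).resolve_left fun h => hχ ?_
        have : χ x ∈ χ.range := ⟨x, rfl⟩
        rwa [h, Subgroup.mem_bot] at this
      have hi : χ.ker.index = p := by
        rw [Subgroup.index_ker, hr]
        simp
      refine ⟨fun h => hp.out.one_lt.ne (by rw [← hi, h, Subgroup.index_top]), fun M hM => ?_⟩
      rw [← Subgroup.index_eq_one]
      have hd := Subgroup.index_dvd_of_le hM.le
      rw [hi] at hd
      refine ((Nat.dvd_prime hp.out).1 hd).resolve_right fun h => hM.ne ?_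
      have h1 := Subgroup.relIndex_mul_index hM.le
      rw [hi, h] at h1
      refine le_antisymm hM.le (Subgroup.relIndex_eq_one.1 ?_)
      exact Nat.eq_of_mul_eq_mul_right hp.out.pos (by rw [h1, one_mul])
    exact hχ (frattini_le_coatom hco hx)
  · by_contra hle
    have htop : M ⊔ Subgroup.center E = ⊤ := hM.2 _ (left_lt_sup.2 hle)
    have hc : commutator E ≤ M := by
      refine Subgroup.commutator_le.2 fun a _ b _ => ?_
      have key : ∀ a : E, ∃ c ∈ M, ∃ d ∈ Subgroup.center E, c * d = a := fun a =>
        Subgroup.mem_sup_of_normal_right.1 (htop ▸ Subgroup.mem_top a)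
      obtain ⟨c, hc, d, hd, rfl⟩ := key a
      obtain ⟨c', hc', d', hd', rfl⟩ := key b
      rw [Subgroup.mem_center_iff] at hd hd'
      have : ⁅c * d, c' * d'⁆ = ⁅c, c'⁆ := by
        rw [commutatorElement_def, commutatorElement_def, mul_inv_rev, mul_inv_rev]
        calc c * d * (c' * d') * (d⁻¹ * c⁻¹) * (d'⁻¹ * c'⁻¹)
            = c * (d * (c' * d') * d⁻¹) * c⁻¹ * (d'⁻¹ * c'⁻¹) := by group
          _ = c * c' * (d' * c⁻¹ * d'⁻¹) * c'⁻¹ := by rw [← hd]; group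
          _ = c * c' * c⁻¹ * c'⁻¹ := by rw [← hd']; group
      rw [this]
      exact mul_mem (mul_mem (mul_mem hc hc') (inv_mem hc)) (inv_mem hc')
    exact hle (hcomm ▸ hc)

/-- The central extension of `V` by `ZMod p` with the bilinear cocycle `β`. -/
@[ext]
structure CentralExt {p : ℕ} {V : Type*} [AddCommGroup V] [Module (ZMod p) V]
    (β : V →ₗ[ZMod p] V →ₗ[ZMod p] ZMod p) where
  /-- The component in `V`. -/
  vec : V
  /-- The central component. -/
  cen : ZMod p

namespace CentralExt

variable {p : ℕ} {V : Type*} [AddCommGroup V] [Module (ZMod p) V]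
  {β : V →ₗ[ZMod p] V →ₗ[ZMod p] ZMod p}

instance : Mul (CentralExt β) := ⟨fun x y => ⟨x.vec + y.vec, x.cen + y.cen + β x.vec y.vec⟩⟩
instance : One (CentralExt β) := ⟨⟨0, 0⟩⟩
instance : Inv (CentralExt β) := ⟨fun x => ⟨-x.vec, -x.cen + β x.vec x.vec⟩⟩

theorem vec_mul (x y : CentralExt β) : (x * y).vec = x.vec + y.vec := rfl
theorem cen_mul (x y : CentralExt β) : (x * y).cen = x.cen + y.cen + β x.vec y.vec := rfl
theorem vec_one : (1 : CentralExt β).vec = 0 := rfl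
theorem cen_one : (1 : CentralExt β).cen = 0 := rfl
theorem vec_inv (x : CentralExt β) : x⁻¹.vec = -x.vec := rfl
theorem cen_inv (x : CentralExt β) : x⁻¹.cen = -x.cen + β x.vec x.vec := rfl

instance : Group (CentralExt β) where
  mul_assoc x y z := by
    ext
    · simp only [vec_mul, add_assoc]
    · simp only [cen_mul, vec_mul, map_add, LinearMap.add_apply]
      ring
  one_mul x := by ext <;> simp [vec_mul, cen_mul, vec_one, cen_one]
  mul_one x := by ext <;> simp [vec_mul, cen_mul, vec_one, cen_one]
  inv_mul_cancel x := by ext <;> simp [vec_mul, cen_mul, vec_one, cen_one, vec_inv, cen_inv]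

/-- The projection to `V`. -/
def proj (β : V →ₗ[ZMod p] V →ₗ[ZMod p] ZMod p) : CentralExt β →* Multiplicative V where
  toFun x := Multiplicative.ofAdd x.vec
  map_one' := rfl
  map_mul' _ _ := rfl

theorem proj_surjective : Function.Surjective (proj β) := fun v => ⟨⟨v.toAdd, 0⟩, rfl⟩

/-- The underlying set of a central extension. -/
def equivProd (β : V →ₗ[ZMod p] V →ₗ[ZMod p] ZMod p) : CentralExt β ≃ V × ZMod p where
  toFun x := (x.vec, x.cen)
  invFun x := ⟨x.1, x.2⟩
  left_inv _ := rfl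
  right_inv _ := rfl

theorem card_eq : Nat.card (CentralExt β) = Nat.card V * p := by
  rw [Nat.card_congr (equivProd β), Nat.card_prod, Nat.card_zmod]

/-- Commutators are measured by `β v w - β w v`, whose radical is trivial by `hβ`. -/
theorem mem_center_iff (hβ : ∀ v, (∀ w, β v w = β w v) → v = 0) {x : CentralExt β} :
    x ∈ Subgroup.center (CentralExt β) ↔ x.vec = 0 := by
  rw [Subgroup.mem_center_iff]
  constructor
  · intro h
    refine hβ _ fun w => ?_
    have := congrArg cen (h ⟨w, 0⟩)
    simp only [cen_mul] at this
    linear_combination -this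
  · intro h y
    ext
    · simp [vec_mul, h]
    · simp [cen_mul, h, add_comm]

theorem proj_ker (hβ : ∀ v, (∀ w, β v w = β w v) → v = 0) :
    (proj β).ker = Subgroup.center (CentralExt β) := by
  ext x
  rw [mem_center_iff hβ]
  exact Iff.rfl

theorem card_center (hβ : ∀ v, (∀ w, β v w = β w v) → v = 0) :
    Nat.card (Subgroup.center (CentralExt β)) = p := by
  refine (Nat.card_congr (β := ZMod p)
    { toFun := fun x => x.1.cen
      invFun := fun t => ⟨⟨0, t⟩, (mem_center_iff hβ).2 rfl⟩
      left_inv := fun x => Subtype.ext (CentralExt.ext ((mem_center_iff hβ).1 x.2).symm rfl)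
      right_inv := fun t => rfl }).trans (Nat.card_zmod p)

theorem vec_pow (x : CentralExt β) (n : ℕ) : (x ^ n).vec = n • x.vec := by
  induction n with
  | zero => simp [vec_one]
  | succ n ih => rw [pow_succ, vec_mul, ih, succ_nsmul]

theorem isExtraspecial [hp : Fact p.Prime] (hβ : ∀ v, (∀ w, β v w = β w v) → v = 0)
    [Nontrivial V] {n : ℕ} (hV : Nat.card V = p ^ n) : IsExtraspecial p (CentralExt β) := by
  have hcle : commutator (CentralExt β) ≤ Subgroup.center (CentralExt β) := by
    refine Subgroup.commutator_le.2 fun a _ b _ => ?_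
    rw [mem_center_iff hβ, commutatorElement_def]
    simp only [vec_mul, vec_inv]
    abel
  refine isExtraspecial_of (IsPGroup.of_card (n := n + 1) (by rw [card_eq, hV, pow_succ]))
    (card_center hβ) ?_ fun x => ?_
  · have : Fact (Nat.card (Subgroup.center (CentralExt β))).Prime := ⟨(card_center hβ).symm ▸ hp.out⟩
    rcases Subgroup.eq_bot_or_eq_top_of_prime_card
      ((commutator (CentralExt β)).subgroupOf (Subgroup.center (CentralExt β))) with h | h
    · obtain ⟨v, hv⟩ := exists_ne (0 : V)
      refine absurd (hβ v fun w => ?_) hv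
      rw [Subgroup.subgroupOf_eq_bot, disjoint_iff, inf_eq_left.2 hcle] at h
      have h1 : ⁅(⟨v, 0⟩ : CentralExt β), ⟨w, 0⟩⁆ ∈ commutator (CentralExt β) :=
        Subgroup.commutator_mem_commutator (Subgroup.mem_top _) (Subgroup.mem_top _)
      rw [h, Subgroup.mem_bot, commutatorElement_eq_one_iff_mul_comm] at h1
      simpa [cen_mul] using congrArg cen h1
    · exact le_antisymm hcle (Subgroup.subgroupOf_eq_top.1 h)
  · rw [mem_center_iff hβ, vec_pow, ← Nat.cast_smul_eq_nsmul (ZMod p), CharP.cast_eq_zero, zero_smul]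

end CentralExt

/-! ### Existence of extraspecial groups of minus type -/

section Existence

/-- Totally singular subspaces are not larger than one whose orthogonal complement contains no
further singular vectors. -/
theorem finrank_le_of_anisotropic {V : Type*} [AddCommGroup V] [Module (ZMod 2) V] [Finite V]
    {Q : QuadraticForm (ZMod 2) V} {L W : Submodule (ZMod 2) V}
    (hL : ∀ x ∈ polarOrthogonal Q L, Q x = 0 → x ∈ L) (hW : ∀ x ∈ W, Q x = 0) :
    Module.finrank (ZMod 2) W ≤ Module.finrank (ZMod 2) L := by
  -- The polar pairing of `W` with `L`: its kernel lies in `W ∩ L` by `hL`, and its image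
  -- annihilates `W ∩ L` since `W` is totally singular.
  let f : W →ₗ[ZMod 2] Module.Dual (ZMod 2) L :=
    (LinearMap.lcomp (ZMod 2) (ZMod 2) L.subtype) ∘ₗ Q.polarBilin ∘ₗ W.subtype
  have hf : ∀ (w : W) (x : L), f w x = QuadraticMap.polar Q w x := fun w x => rfl
  have h1 := f.finrank_range_add_finrank_ker
  have hker : Module.finrank (ZMod 2) (LinearMap.ker f) ≤
      Module.finrank (ZMod 2) (W.comap L.subtype) := by
    have h2 : (LinearMap.ker f).map W.subtype ≤ (W.comap L.subtype).map L.subtype := by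
      rintro _ ⟨w, hw, rfl⟩
      have hwL : (w : V) ∈ L := hL w (fun x hx => LinearMap.congr_fun hw (⟨x, hx⟩ : L)) (hW w w.2)
      exact ⟨⟨w, hwL⟩, w.2, rfl⟩
    have h3 := Submodule.finrank_mono h2
    rwa [Submodule.finrank_map_subtype_eq, Submodule.finrank_map_subtype_eq] at h3
  have hrange : Module.finrank (ZMod 2) (LinearMap.range f) ≤
      Module.finrank (ZMod 2) (W.comap L.subtype).dualAnnihilator := by
    refine Submodule.finrank_mono ?_
    rintro _ ⟨w, rfl⟩
    rw [Submodule.mem_dualAnnihilator]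
    intro x hx
    have h2 := map_add_eq Q (w : V) x
    have hx' : (x : V) ∈ W := hx
    rw [hW _ (W.add_mem w.2 hx'), hW w w.2, hW x hx', zero_add, zero_add] at h2
    rw [hf, ← h2]
  have h4 := Subspace.finrank_add_finrank_dualAnnihilator_eq (W.comap L.subtype)
  omega

variable (l : ℕ)

/-- A bilinear form whose associated quadratic form is of minus type. -/
def minusBilin : ((Fin (l + 1) → ZMod 2) × (Fin (l + 1) → ZMod 2)) →ₗ[ZMod 2]
    ((Fin (l + 1) → ZMod 2) × (Fin (l + 1) → ZMod 2)) →ₗ[ZMod 2] ZMod 2 :=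
  LinearMap.mk₂ (ZMod 2) (fun x y => x.1 ⬝ᵥ y.2 + x.1 0 * y.1 0 + x.2 0 * y.2 0)
    (fun x x' y => by simp [add_dotProduct]; ring) (fun c x y => by simp [smul_dotProduct]; ring)
    (fun x y y' => by simp [dotProduct_add]; ring) (fun c x y => by simp [dotProduct_smul]; ring)

theorem minusBilin_apply (x y : (Fin (l + 1) → ZMod 2) × (Fin (l + 1) → ZMod 2)) :
    minusBilin l x y = x.1 ⬝ᵥ y.2 + x.1 0 * y.1 0 + x.2 0 * y.2 0 := rfl

theorem polar_minusBilin (x y : (Fin (l + 1) → ZMod 2) × (Fin (l + 1) → ZMod 2)) :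
    QuadraticMap.polar (LinearMap.BilinMap.toQuadraticMap (minusBilin l)) x y =
      x.1 ⬝ᵥ y.2 + y.1 ⬝ᵥ x.2 := by
  rw [LinearMap.BilinMap.polar_toQuadraticMap, minusBilin_apply, minusBilin_apply]
  linear_combination (x.1 0 * y.1 0 + x.2 0 * y.2 0) * (CharTwo.two_eq_zero : (2 : ZMod 2) = 0)

theorem minusBilin_nondegenerate (x : (Fin (l + 1) → ZMod 2) × (Fin (l + 1) → ZMod 2))
    (h : ∀ y : (Fin (l + 1) → ZMod 2) × (Fin (l + 1) → ZMod 2),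
      x.1 ⬝ᵥ y.2 + y.1 ⬝ᵥ x.2 = 0) : x = 0 := by
  ext i
  · simpa using h (0, Pi.single i 1)
  · simpa using h (Pi.single i 1, 0)

/-- The form is `l` hyperbolic planes plus the anisotropic plane `s ^ 2 + s t + t ^ 2`. Half of each
hyperbolic plane gives a totally singular space of dimension `l` to which
`finrank_le_of_anisotropic` applies. -/
theorem isMinusType_minusBilin :
    IsMinusType (l + 1) (LinearMap.BilinMap.toQuadraticMap (minusBilin l)) := by
  let c : (Fin l → ZMod 2) →ₗ[ZMod 2] (Fin (l + 1) → ZMod 2) × (Fin (l + 1) → ZMod 2) :=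
    { toFun := fun b => (0, Fin.cons 0 b)
      map_add' := fun a b => by
        ext i
        · simp
        · refine Fin.cases ?_ (fun i => ?_) i <;> simp
      map_smul' := fun a b => by
        ext i
        · simp
        · refine Fin.cases ?_ (fun i => ?_) i <;> simp }
  have hc : ∀ b, c b = (0, Fin.cons 0 b) := fun b => rfl
  have hcinj : Function.Injective c := fun a b h => by
    simpa [hc] using h
  have hrank : Module.finrank (ZMod 2) (LinearMap.range c) = l := by
    rw [LinearMap.finrank_range_of_inj hcinj]
    simp
  refine ⟨by omega, by simp; ring, fun x hx => minusBilin_nondegenerate l x fun y => ?_,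
    ⟨LinearMap.range c, ?_, hrank⟩, ?_⟩
  · rw [← polar_minusBilin, hx]
  · rintro _ ⟨b, rfl⟩
    simp [LinearMap.BilinMap.toQuadraticMap_apply, minusBilin_apply, hc]
  · rintro _ ⟨W, hW, rfl⟩
    change _ ≤ l
    refine (finrank_le_of_anisotropic
      (Q := LinearMap.BilinMap.toQuadraticMap (minusBilin l)) ?_ hW).trans hrank.le
    rintro ⟨a, b⟩ hab hQ
    have ha : ∀ i : Fin l, a i.succ = 0 := fun i => by
      have := hab (c (Pi.single i 1)) ⟨_, rfl⟩
      rw [polar_minusBilin] at this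
      simpa [hc, dotProduct, Fin.sum_univ_succ, Pi.single_apply] using this
    have hQ' : a 0 * b 0 + a 0 * a 0 + b 0 * b 0 = 0 := by
      simpa [LinearMap.BilinMap.toQuadraticMap_apply, minusBilin_apply, dotProduct,
        Fin.sum_univ_succ, ha] using hQ
    have h0 : a 0 = 0 ∧ b 0 = 0 := by
      revert hQ'
      generalize a 0 = s
      generalize b 0 = t
      revert s t
      decide
    refine ⟨fun i => b i.succ, ?_⟩
    rw [hc]
    ext i
    · refine Fin.cases ?_ (fun i => ?_) i
      · exact h0.1.symm
      · exact (ha i).symm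
    · refine Fin.cases ?_ (fun i => ?_) i
      · exact h0.2.symm
      · rfl

/-- Squaring an element over `v` cancels everything but the cocycle value `β v v = Q v`. -/
theorem isExtraspecialMinus_centralExt :
    IsExtraspecialMinus (l + 1) (CentralExt.proj (minusBilin l))
      (LinearMap.BilinMap.toQuadraticMap (minusBilin l)) := by
  have hm := isMinusType_minusBilin l
  have hβ : ∀ v, (∀ w, minusBilin l v w = minusBilin l w v) → v = 0 := fun v h =>
    hm.2.2.1 v fun w => by
      rw [LinearMap.BilinMap.polar_toQuadraticMap, h, CharTwo.add_self_eq_zero]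
  have hcard := hm.card_eq
  refine ⟨CentralExt.isExtraspecial hβ hcard, ?_, ⟨CentralExt.proj_surjective,
    CentralExt.proj_ker hβ, fun x => ?_⟩, hm⟩
  · rw [CentralExt.card_eq, hcard, pow_add, mul_comm, pow_one]
  · rw [CentralExt.ext_iff, sq, CentralExt.vec_mul, CentralExt.cen_mul, ZMod.add_self_eq_zero,
      CharTwo.add_self_eq_zero, zero_add]
    exact and_iff_right rfl

theorem IsExtraspecialMinus.congr {m : ℕ} {E V V' : Type*} [Group E] [AddCommGroup V]
    [Module (ZMod 2) V] [AddCommGroup V'] [Module (ZMod 2) V'] {π : E →* Multiplicative V}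
    {Q : QuadraticForm (ZMod 2) V} (h : IsExtraspecialMinus m π Q) (e : V ≃ₗ[ZMod 2] V') :
    IsExtraspecialMinus m ((AddMonoidHom.toMultiplicative e.toAddEquiv.toAddMonoidHom).comp π)
      (Q.comp e.symm.toLinearMap) := by
  obtain ⟨hE, hcard, ⟨hsurj, hker, hsq⟩, h1, h2, h3, ⟨W, hW, hr⟩, h5⟩ := h
  refine ⟨hE, hcard, ⟨fun v => ?_, ?_, fun x => ?_⟩, h1, e.finrank_eq ▸ h2, fun x hx => ?_,
    ⟨W.map e.toLinearMap, ?_, ?_⟩, ?_⟩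
  · obtain ⟨x, hx⟩ := hsurj (Multiplicative.ofAdd (e.symm v.toAdd))
    refine ⟨x, ?_⟩
    change Multiplicative.ofAdd (e (π x).toAdd) = v
    rw [hx]
    exact congrArg Multiplicative.ofAdd (e.apply_symm_apply _)
  · rw [← hker]
    ext x
    change e (π x).toAdd = 0 ↔ (π x).toAdd = 0
    exact e.map_eq_zero_iff
  · rw [hsq]
    change _ ↔ Q (e.symm (e (π x).toAdd)) = 0
    rw [e.symm_apply_apply]
  · refine e.symm.map_eq_zero_iff.1 (h3 _ fun y => ?_)
    have := hx (e y)
    simpa [QuadraticMap.polar] using this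
  · rintro _ ⟨w, hw, rfl⟩
    simpa using hW w hw
  · rw [← hr]
    exact LinearEquiv.finrank_map_eq e W
  · rintro _ ⟨U, hU, rfl⟩
    refine h5 ⟨U.map e.symm.toLinearMap, ?_, LinearEquiv.finrank_map_eq e.symm U⟩
    rintro _ ⟨u, hu, rfl⟩
    exact hU u hu

theorem exists_isExtraspecialMinus {m : ℕ} (hm : 1 ≤ m) :
    ∃ (E : Type) (_ : Group E) (Q : QuadraticForm (ZMod 2) (Fin (2 * m) → ZMod 2))
      (π : E →* Multiplicative (Fin (2 * m) → ZMod 2)), IsExtraspecialMinus m π Q := by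
  obtain ⟨l, rfl⟩ : ∃ l, m = l + 1 := ⟨m - 1, by omega⟩
  let e : ((Fin (l + 1) → ZMod 2) × (Fin (l + 1) → ZMod 2)) ≃ₗ[ZMod 2]
      (Fin (2 * (l + 1)) → ZMod 2) := LinearEquiv.ofFinrankEq _ _ (by simp; ring)
  exact ⟨_, inferInstance, _, _, (isExtraspecialMinus_centralExt l).congr e⟩

end Existence

/-! ### Extraspecial groups of minus type with a lifted action -/

section MinusSemidirect

variable {p m : ℕ} [hp : Fact p.Prime] {E V : Type*} [Group E] [AddCommGroup V]
  [Module (ZMod 2) V] {Q : QuadraticForm (ZMod 2) V} {π : E →* Multiplicative V}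

theorem IsExtraspecialMinus.finite (h : IsExtraspecialMinus m π Q) : Finite E :=
  Nat.finite_of_card_ne_zero (h.2.1 ▸ by positivity)

theorem IsExtraspecialMinus.exists_center (h : IsExtraspecialMinus m π Q) :
    ∃ z : E, z ≠ 1 ∧ z ∈ Subgroup.center E ∧ ∀ x ∈ Subgroup.center E, x = 1 ∨ x = z := by
  obtain ⟨z, hz, hz'⟩ := (Nat.card_eq_two_iff' (1 : Subgroup.center E)).1 h.1.2.1
  refine ⟨z, fun h1 => hz (Subtype.ext h1), z.2, fun x hx => ?_⟩
  by_cases h1 : x = 1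
  · exact Or.inl h1
  · exact Or.inr (congrArg Subtype.val (hz' ⟨x, hx⟩ fun h2 => h1 (congrArg Subtype.val h2)))

theorem two_pow_ne_zero_of_eq (hpm : p = 2 ^ m + 1) (hm : 1 ≤ m) (j : ℕ) :
    (2 ^ j : ZMod p) ≠ 0 := by
  refine pow_ne_zero _ fun h => ?_
  have h2 : p ∣ 2 := (ZMod.natCast_eq_zero_iff 2 p).1 (by exact_mod_cast h)
  have := Nat.le_of_dvd two_pos h2
  have : 2 ≤ 2 ^ m := Nat.le_self_pow (by omega) 2
  omega

/-- The order of `E` is a power of `2`, prime to the odd `p`. -/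
theorem IsExtraspecialMinus.cp_semidirect (h : IsExtraspecialMinus m π Q) (hpm : p = 2 ^ m + 1)
    {P : Type*} [Group P] (hP : Nat.card P = p) (φ : P →* MulAut E) : cp p (E ⋊[φ] P) = 1 := by
  have := h.finite
  have : Finite P := Nat.finite_of_card_ne_zero (hP ▸ hp.out.ne_zero)
  rw [cp_semidirectProduct, cp_eq_one_of_card_eq hP, cp_eq_zero_of_not_dvd]
  intro hd
  rw [h.2.1, ← ZMod.natCast_eq_zero_iff] at hd
  exact two_pow_ne_zero_of_eq hpm h.2.2.2.1 _ (by exact_mod_cast hd)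

theorem IsExtraspecialMinus.exists_rep (h : IsExtraspecialMinus m π Q) (hpm : p = 2 ^ m + 1)
    {P : Subgroup (isometryGroup Q)} (hP : Nat.card P = p) {φ : P →* MulAut E}
    (hφ : IsLiftedAction π φ) :
    ∃ ρ : E ⋊[φ] P →* GL (Fin (2 ^ m)) (ZMod p), Function.Injective ρ ∧
      Submodule.span (ZMod p) {A : Matrix (Fin (2 ^ m)) (Fin (2 ^ m)) (ZMod p) |
        ∃ g ∈ ρ.range, (g : Matrix _ _ (ZMod p)) = A} = ⊤ := by
  have := h.finite
  obtain ⟨z, hz1, hz, hZ⟩ := h.exists_center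
  have h2 := two_pow_ne_zero_of_eq hpm h.2.2.2.1
  refine exists_semidirect_rep hP (fun q hq => ?_) hz1 hz hZ h.1.2.2.1.le ?_ ?_ ?_
  -- An element of `P` acting trivially modulo the centre is the identity isometry, because `φ`
  -- lifts the action on `V`.
  · refine Subtype.ext (Subtype.ext (LinearEquiv.ext fun v => ?_))
    obtain ⟨x, hx⟩ := h.2.2.1.1 (Multiplicative.ofAdd v)
    have h1 := hφ q x
    have h3 := hq x
    rw [← h.2.2.1.2.1, MonoidHom.mem_ker, map_mul, map_inv, mul_inv_eq_one] at h3
    rw [h3, hx] at h1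
    exact h1.symm
  · rw [h.2.1]
    have := h2 (1 + (1 + 2 * m))
    rw [pow_add, pow_one] at this
    exact_mod_cast this
  · have := h2 (1 + m)
    rw [pow_add, pow_one] at this
    exact_mod_cast this
  · have h1 := Subgroup.card_eq_card_quotient_mul_card_subgroup (Subgroup.center E)
    rw [h.2.1, h.1.2.1] at h1
    refine Nat.eq_of_mul_eq_mul_right two_pos ?_
    rw [← h1]
    ring

theorem IsExtraspecialMinus.exists_rep_tower (h : IsExtraspecialMinus m π Q)
    (hpm : p = 2 ^ m + 1) {P : Subgroup (isometryGroup Q)} (hP : Nat.card P = p)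
    {φ : P →* MulAut E} (hφ : IsLiftedAction π φ) :
    ∃ ρ : (E ⋊[φ] P) →* GL (Fin (2 ^ m)) (ZMod p), Function.Injective ρ ∧
      IsAbsolutelyIrreducibleGroup ρ.range ∧
      ∀ (F : Type*) [Field F] [Finite F] [CharP F p] (n : ℕ),
        IsIrreducibleGroup (wreathTower p (extendScalars (ZMod.castHom dvd_rfl F) ρ.range) n) ∧
        (cp p (wreathTower p (extendScalars (ZMod.castHom dvd_rfl F) ρ.range) n) : ℚ) =
          ((p / (p - 1) : ℚ) * ((p - 1) * p ^ n : ℕ) - 1) / (p - 1) := by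
  obtain ⟨ρ, hρ, hspan⟩ := h.exists_rep hpm hP hφ
  refine ⟨ρ, hρ, isAbsolutelyIrreducibleGroup_of_span_eq_top hspan, fun F _ _ _ n => ?_⟩
  have := h.finite
  have : Finite P := Nat.finite_of_card_ne_zero (hP ▸ hp.out.ne_zero)
  have : Finite (E ⋊[φ] P) := Finite.of_equiv _ SemidirectProduct.equivProd.symm
  have hcp : cp p ρ.range = 1 :=
    (cp_congr (MonoidHom.ofInjective hρ)).symm.trans (h.cp_semidirect hpm hP φ)
  have hne : ρ.range ≠ ⊥ := fun h1 => by
    rw [h1, cp_eq_of_subsingleton] at hcp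
    exact zero_ne_one hcp
  obtain ⟨h1, h2⟩ := wreathTower_extendScalars_of_span_eq_top p hspan hne
    (ZMod.castHom dvd_rfl F) n
  refine ⟨h1, h2.trans ?_⟩
  have hp1 : (p : ℚ) - 1 ≠ 0 := sub_ne_zero.2 (by exact_mod_cast hp.out.ne_one)
  rw [hcp, Nat.cast_mul, Nat.cast_pow, Nat.cast_sub hp.out.one_lt.le]
  field_simp
  push_cast
  ring

end MinusSemidirect

theorem IsFermatPrime.one_le {p m : ℕ} (h : IsFermatPrime p) (hpm : p = 2 ^ m + 1) : 1 ≤ m := by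
  obtain ⟨-, n, hn⟩ := h
  rcases m with - | m
  · have h1 : 2 ^ 2 ^ n + 1 = 2 ^ 0 + 1 := hn.symm.trans hpm
    have : 2 ≤ 2 ^ 2 ^ n := Nat.le_self_pow (by positivity) 2
    omega
  · omega

theorem minusSemidirect_properties (p m : ℕ) [hp : Fact p.Prime] (hF : IsFermatPrime p)
    (hpm : p = 2 ^ m + 1) :
    (∃ (E : Type) (_ : Group E) (Q : QuadraticForm (ZMod 2) (Fin (2 * m) → ZMod 2))
        (π : E →* Multiplicative (Fin (2 * m) → ZMod 2)), IsExtraspecialMinus m π Q) ∧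
      ∀ (E V : Type*) [Group E] [AddCommGroup V] [Module (ZMod 2) V]
        (Q : QuadraticForm (ZMod 2) V) (π : E →* Multiplicative V), IsExtraspecialMinus m π Q →
        ∀ P : Sylow p (isometryGroup Q),
          Nat.card P = p ∧
          (∃ φ : P →* MulAut E, IsLiftedAction π φ) ∧
          ∀ φ : P →* MulAut E, IsLiftedAction π φ →
            cp p (E ⋊[φ] P) = 1 ∧
            ∃ ρ : (E ⋊[φ] P) →* GL (Fin (2 ^ m)) (ZMod p), Function.Injective ρ ∧
              IsAbsolutelyIrreducibleGroup ρ.range ∧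
              ∀ (F : Type*) [Field F] [Finite F] [CharP F p] (n : ℕ),
                IsIrreducibleGroup
                  (wreathTower p (extendScalars (ZMod.castHom dvd_rfl F) ρ.range) n) ∧
                (cp p (wreathTower p (extendScalars (ZMod.castHom dvd_rfl F) ρ.range) n) : ℚ) =
                  ((p / (p - 1) : ℚ) * ((p - 1) * p ^ n : ℕ) - 1) / (p - 1) := by
  have hm := hF.one_le hpm
  refine ⟨exists_isExtraspecialMinus hm, fun E V _ _ _ Q π h P => ?_⟩
  have := h.finite
  have hP := h.2.2.2.card_sylow hpm P
  obtain ⟨z, hz1, hz, hZ⟩ := h.exists_center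
  have hp2 : p ≠ 2 := by
    have : 2 ≤ 2 ^ m := Nat.le_self_pow (by omega) 2
    omega
  exact ⟨hP, exists_lift_action hz1 hz hZ h.2.2.1 hp2 hP, fun φ hφ =>
    ⟨h.cp_semidirect hpm hP φ, h.exists_rep_tower hpm hP hφ⟩⟩

/-! ### A concrete field of order four -/

/-- The field of order `4`, with `none = 0` and `some t = ω ^ t`, where `ω ^ 2 + ω + 1 = 0`. -/
def FourField : Type := Option (ZMod 3)

namespace FourField

instance : DecidableEq FourField := inferInstanceAs (DecidableEq (Option (ZMod 3)))
instance : Fintype FourField := inferInstanceAs (Fintype (Option (ZMod 3)))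

/-- The powers of the primitive element `ω`. -/
def pow (t : ZMod 3) : FourField := some t

/-- Addition in the field of order four. -/
def add : FourField → FourField → FourField
  | none, y => y
  | some s, none => some s
  -- Two distinct powers of `ω` sum to the third, and the three exponents add up to `0` modulo `3`.
  | some s, some t => if s = t then none else some (-(s + t))

/-- Multiplication in the field of order four. -/
def mul : FourField → FourField → FourField
  | some s, some t => some (s + t)
  | _, _ => none

/-- The inverse in the field of order four. -/
def inv : FourField → FourField
  | none => none
  | some t => some (-t)

instance : Zero FourField := ⟨none⟩
instance : One FourField := ⟨some 0⟩
instance : Add FourField := ⟨add⟩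
instance : Mul FourField := ⟨mul⟩
instance : Neg FourField := ⟨id⟩
instance : Inv FourField := ⟨inv⟩

instance : Field FourField where
  add_assoc := by decide
  zero_add := by decide
  add_zero := by decide
  add_comm := by decide
  nsmul := nsmulRec
  zsmul := zsmulRec
  neg_add_cancel := by decide
  left_distrib := by decide
  right_distrib := by decide
  zero_mul := by decide
  mul_zero := by decide
  mul_assoc := by decide
  one_mul := by decide
  mul_one := by decide
  mul_comm := by decide
  exists_pair_ne := ⟨0, 1, by decide⟩
  mul_inv_cancel := by decide
  inv_zero := by decide
  nnqsmul := _
  qsmul := _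

theorem card_eq : Fintype.card FourField = 4 := by decide

theorem pow_add (s t : ZMod 3) : pow (s + t) = pow s * pow t := rfl

end FourField

/-! ### The Weil representation of `3^{1+2} ⋊ SL(2,3)` over the field of order four -/

section Weil

/-- The entries of the Heisenberg matrices. -/
def heisenbergEntry (a b t : ZMod 3) (x y : Fin 3) : FourField :=
  let x : ZMod 3 := x
  let y : ZMod 3 := y
  -- The phase `2ab = -ab` normalises the cocycle to the alternating form `a b' - b a'`.
  if x = y + a then FourField.pow (t + 2 * a * b + b * y) else 0

/-- The entries of the matrices in the Weil representation. -/
def weilEntry (a b c d : ZMod 3) (x y : Fin 3) : FourField :=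
  let x : ZMod 3 := x
  let y : ZMod 3 := y
  -- Monomial matrices for `b = 0`, quadratic-phase kernels otherwise. No normalising scalar is
  -- needed: the Gauss sums `1 + 2 ω ^ (±1)` equal `1` in characteristic two.
  if b = 0 then if x = a * y then FourField.pow (-(a * c * y * y)) else 0
  else FourField.pow (-(b * (d * x * x + x * y + a * y * y)))

theorem heisenbergEntry_mul : ∀ (a b a' b' : ZMod 3) (x y : Fin 3),
    ∑ z, heisenbergEntry a b 0 x z * heisenbergEntry a' b' 0 z y =
      heisenbergEntry (a + a') (b + b') (a * b' - b * a') x y := by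
  decide

set_option maxRecDepth 100000 in
theorem weilEntry_mul : ∀ a b c d : ZMod 3, a * d - b * c = 1 → ∀ a' b' c' d' : ZMod 3,
    a' * d' - b' * c' = 1 → ∀ x y : Fin 3, ∑ z, weilEntry a b c d x z * weilEntry a' b' c' d' z y =
      weilEntry (a * a' + b * c') (a * b' + b * d') (c * a' + d * c') (c * b' + d * d') x y := by
  decide
theorem heisenbergEntry_eq : ∀ (a b t : ZMod 3) (x y : Fin 3),
    heisenbergEntry a b t x y = FourField.pow t * heisenbergEntry a b 0 x y := by
  decide

theorem heisenbergEntry_zero : ∀ x y : Fin 3,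
    heisenbergEntry 0 0 0 x y = if x = y then 1 else 0 := by
  decide

theorem weilEntry_one : ∀ x y : Fin 3, weilEntry 1 0 0 1 x y = if x = y then 1 else 0 := by
  decide

set_option maxRecDepth 100000 in
theorem weilEntry_mul_heisenbergEntry : ∀ a b c d : ZMod 3, a * d - b * c = 1 →
    ∀ (v w : ZMod 3) (x y : Fin 3), ∑ z, weilEntry a b c d x z * heisenbergEntry v w 0 z y =
      ∑ z, heisenbergEntry (a * v + b * w) (c * v + d * w) 0 x z * weilEntry a b c d z y := by
  decide

set_option maxRecDepth 100000 in
set_option synthInstance.maxHeartbeats 200000 in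
set_option synthInstance.maxSize 1000 in
theorem eq_one_of_heisenbergEntry_mul_weilEntry : ∀ a b c d : ZMod 3, a * d - b * c = 1 →
    ∀ v w t : ZMod 3, (∀ x y : Fin 3, ∑ z, heisenbergEntry v w t x z * weilEntry a b c d z y =
      if x = y then 1 else 0) →
      (a = 1 ∧ b = 0 ∧ c = 0 ∧ d = 1) ∧ v = 0 ∧ w = 0 ∧ t = 0 := by
  decide

theorem heisenbergEntry_unitary : ∀ (v w t : ZMod 3) (x y : Fin 3),
    ∑ z, heisenbergEntry v w t x z * heisenbergEntry v w t y z ^ 2 = if x = y then 1 else 0 := by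
  decide

set_option maxRecDepth 100000 in
theorem weilEntry_unitary : ∀ a b c d : ZMod 3, a * d - b * c = 1 → ∀ x y : Fin 3,
    ∑ z, weilEntry a b c d x z * weilEntry a b c d y z ^ 2 = if x = y then 1 else 0 := by
  decide

/-- Fourier inversion in `b` isolates a matrix unit; the usual factor `3` is `1` in this field. -/
theorem sum_heisenbergEntry : ∀ i j x y : Fin 3,
    ∑ b : ZMod 3, FourField.pow (-(b * j.val) - 2 * (i.val - j.val) * b) *
      heisenbergEntry (i.val - j.val) b 0 x y =
      if i = x ∧ j = y then 1 else 0 := by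
  decide

theorem heisenbergEntry_mul_cen (a b t a' b' t' : ZMod 3) (x y : Fin 3) :
    ∑ z, heisenbergEntry a b t x z * heisenbergEntry a' b' t' z y =
      heisenbergEntry (a + a') (b + b') (t + t' + (a * b' - b * a')) x y := by
  rw [heisenbergEntry_eq _ _ (_ + _), FourField.pow_add, FourField.pow_add, mul_assoc,
    ← heisenbergEntry_eq, ← heisenbergEntry_mul, Finset.mul_sum]
  refine Finset.sum_congr rfl fun z _ => ?_
  rw [heisenbergEntry_eq _ _ t, heisenbergEntry_eq _ _ t', mul_mul_mul_comm]

theorem weilEntry_mul_heisenbergEntry_cen (a b c d : ZMod 3) (h : a * d - b * c = 1)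
    (v w t : ZMod 3) (x y : Fin 3) : ∑ z, weilEntry a b c d x z * heisenbergEntry v w t z y =
      ∑ z, heisenbergEntry (a * v + b * w) (c * v + d * w) t x z * weilEntry a b c d z y := by
  simp only [heisenbergEntry_eq _ _ t, mul_assoc, mul_left_comm (weilEntry a b c d _ _)]
  rw [← Finset.mul_sum, ← Finset.mul_sum, weilEntry_mul_heisenbergEntry a b c d h]

/-- The alternating form on the plane over `𝔽₃`. -/
def planeForm : (Fin 2 → ZMod 3) →ₗ[ZMod 3] (Fin 2 → ZMod 3) →ₗ[ZMod 3] ZMod 3 :=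
  LinearMap.mk₂ (ZMod 3) (fun v w => v 0 * w 1 - v 1 * w 0)
    (fun x x' y => by simp; ring) (fun c x y => by simp; ring)
    (fun x y y' => by simp; ring) (fun c x y => by simp; ring)

theorem planeForm_apply (v w : Fin 2 → ZMod 3) : planeForm v w = v 0 * w 1 - v 1 * w 0 := rfl

theorem planeForm_nondegenerate (v : Fin 2 → ZMod 3)
    (h : ∀ w, planeForm v w = planeForm w v) : v = 0 := by
  have key : ∀ s : ZMod 3, s = -s → s = 0 := by decide
  have h0 := h (Pi.single 0 1)
  have h1 := h (Pi.single 1 1)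
  simp only [planeForm_apply, Pi.single_eq_same, ne_eq, zero_ne_one, one_ne_zero,
    not_false_eq_true, Pi.single_eq_of_ne, mul_zero, mul_one, zero_mul, one_mul, zero_sub,
    sub_zero] at h0 h1
  ext i
  fin_cases i
  · exact key _ h1
  · exact key _ h0.symm

/-- The extraspecial group of order `27` and exponent `3`. -/
abbrev HeisenbergThree : Type := CentralExt planeForm

theorem isExtraspecial_heisenbergThree : IsExtraspecial 3 HeisenbergThree :=
  CentralExt.isExtraspecial planeForm_nondegenerate (n := 2) (by simp)

theorem card_heisenbergThree : Nat.card HeisenbergThree = 3 ^ (1 + 2) := by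
  rw [CentralExt.card_eq]
  simp

theorem SL2_det (g : SL(2, ZMod 3)) : g 0 0 * g 1 1 - g 0 1 * g 1 0 = 1 := by
  have := g.2
  rwa [Matrix.det_fin_two] at this

/-- The action of `SL(2,3)` on the Heisenberg group. -/
def slAction : SL(2, ZMod 3) →* MulAut HeisenbergThree where
  toFun g :=
    { toFun := fun x => ⟨g.1.mulVec x.vec, x.cen⟩
      invFun := fun x => ⟨g⁻¹.1.mulVec x.vec, x.cen⟩
      left_inv := fun x => by
        ext1
        · simp only [Matrix.mulVec_mulVec]
          rw [← Matrix.SpecialLinearGroup.coe_mul, inv_mul_cancel]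
          simp
        · rfl
      right_inv := fun x => by
        ext1
        · simp only [Matrix.mulVec_mulVec]
          rw [← Matrix.SpecialLinearGroup.coe_mul, mul_inv_cancel]
          simp
        · rfl
      map_mul' := fun x y => by
        ext1
        · simp [CentralExt.vec_mul, Matrix.mulVec_add]
        · simp only [CentralExt.cen_mul, planeForm_apply, Matrix.mulVec, dotProduct,
            Fin.sum_univ_two]
          linear_combination -(x.vec 0 * y.vec 1 - x.vec 1 * y.vec 0) * SL2_det g }
  map_one' := by
    ext1 x
    ext1 <;> simp
  map_mul' g h := by
    ext1 x
    change CentralExt.mk ((g * h).1.mulVec x.vec) x.cen =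
      ⟨g.1.mulVec (h.1.mulVec x.vec), x.cen⟩
    rw [Matrix.mulVec_mulVec]
    rfl

theorem slAction_vec_zero (g : SL(2, ZMod 3)) (e : HeisenbergThree) :
    (slAction g e).vec 0 = g 0 0 * e.vec 0 + g 0 1 * e.vec 1 := by
  simp [slAction]

theorem slAction_vec_one (g : SL(2, ZMod 3)) (e : HeisenbergThree) :
    (slAction g e).vec 1 = g 1 0 * e.vec 0 + g 1 1 * e.vec 1 := by
  simp [slAction]

/-- The Heisenberg representation. -/
def heisenbergRep : HeisenbergThree →* GL (Fin 3) FourField :=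
  MonoidHom.toHomUnits
    { toFun := fun e => Matrix.of fun x y : Fin 3 =>
        heisenbergEntry (e.vec 0) (e.vec 1) e.cen x y
      map_one' := by
        ext x y
        exact heisenbergEntry_zero x y
      map_mul' := fun e f => by
        ext x y
        rw [Matrix.mul_apply]
        exact (heisenbergEntry_mul_cen _ _ _ _ _ _ x y).symm }

theorem heisenbergRep_apply (e : HeisenbergThree) (x y : Fin 3) :
    (heisenbergRep e).1 x y = heisenbergEntry (e.vec 0) (e.vec 1) e.cen x y := rfl

/-- The Weil representation. -/
def weilRep : SL(2, ZMod 3) →* GL (Fin 3) FourField :=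
  MonoidHom.toHomUnits
    { toFun := fun g => Matrix.of fun x y : Fin 3 =>
        weilEntry (g 0 0) (g 0 1) (g 1 0) (g 1 1) x y
      map_one' := by
        ext x y
        exact weilEntry_one x y
      map_mul' := fun g h => by
        ext x y
        rw [Matrix.mul_apply]
        simp only [Matrix.of_apply, Matrix.SpecialLinearGroup.coe_mul, Matrix.mul_apply,
          Fin.sum_univ_two]
        exact (weilEntry_mul _ _ _ _ (SL2_det g) _ _ _ _ (SL2_det h) x y).symm }

theorem weilRep_mul_heisenbergRep (g : SL(2, ZMod 3)) (e : HeisenbergThree) :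
    weilRep g * heisenbergRep e = heisenbergRep (slAction g e) * weilRep g := by
  refine Units.ext (Matrix.ext fun x y => ?_)
  rw [Units.val_mul, Units.val_mul, Matrix.mul_apply, Matrix.mul_apply]
  refine (weilEntry_mul_heisenbergEntry_cen _ _ _ _ (SL2_det g) (e.vec 0) (e.vec 1) e.cen
    x y).trans (Finset.sum_congr rfl fun z _ => ?_)
  rw [heisenbergRep_apply, slAction_vec_zero, slAction_vec_one]
  rfl

/-- The representation of `3^{1+2} ⋊ SL(2,3)` over the field of order four. -/
def heisenbergWeilRep : HeisenbergThree ⋊[slAction] SL(2, ZMod 3) →* GL (Fin 3) FourField :=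
  SemidirectProduct.lift heisenbergRep weilRep fun g => by
    ext1 e
    change heisenbergRep (slAction g e) = weilRep g * heisenbergRep e * (weilRep g)⁻¹
    rw [weilRep_mul_heisenbergRep, mul_inv_cancel_right]

theorem heisenbergWeilRep_apply (x : HeisenbergThree ⋊[slAction] SL(2, ZMod 3)) :
    heisenbergWeilRep x = heisenbergRep x.left * weilRep x.right := rfl

theorem heisenbergWeilRep_injective : Function.Injective heisenbergWeilRep := by
  rw [injective_iff_map_eq_one]
  intro x hx
  rw [heisenbergWeilRep_apply] at hx
  obtain ⟨⟨h1, h2, h3, h4⟩, h5, h6, h7⟩ := eq_one_of_heisenbergEntry_mul_weilEntry _ _ _ _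
    (SL2_det x.right) (x.left.vec 0) (x.left.vec 1) x.left.cen fun i j => by
      have := congrArg (fun A : GL (Fin 3) FourField => A.1 i j) hx
      simp only [Units.val_mul, Matrix.one_apply, Units.val_one] at this
      exact this
  refine SemidirectProduct.ext (CentralExt.ext ?_ h7) (Subtype.ext ?_)
  · ext i
    fin_cases i
    · exact h5
    · exact h6
  · ext i j
    fin_cases i <;> fin_cases j
    · exact h1
    · exact h2
    · exact h3
    · exact h4

/-- The hermitian form on three-dimensional space over the field of order four. -/
def FourField.dot (v w : FourField × FourField × FourField) : FourField :=
  v.1 * w.1 ^ 2 + v.2.1 * w.2.1 ^ 2 + v.2.2 * w.2.2 ^ 2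

/-- The vectors of three-dimensional space. -/
def FourField.vectors : List (FourField × FourField × FourField) :=
  let l : List FourField := [0, FourField.pow 0, FourField.pow 1, FourField.pow 2]
  l ×ˢ (l ×ˢ l)

/-- The orthonormal bases of three-dimensional unitary space. -/
def FourField.orthonormalBases : List ((FourField × FourField × FourField) ×
    (FourField × FourField × FourField) × (FourField × FourField × FourField)) :=
  let l := FourField.vectors.filter fun v => FourField.dot v v = 1
  l.flatMap fun u => (l.filter fun v => FourField.dot u v = 0).flatMap fun v =>
    ((l.filter fun w => FourField.dot u w = 0).filter fun w => FourField.dot v w = 0).map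
      fun w => (u, v, w)

set_option maxRecDepth 100000 in
-- The value is `27 * 24`, the order of `3^{1+2} ⋊ SL(2,3)`.
theorem FourField.length_orthonormalBases : FourField.orthonormalBases.length = 648 := by
  decide +kernel

theorem FourField.mem_vectors (v : FourField × FourField × FourField) :
    v ∈ FourField.vectors := by
  have h : ∀ x : FourField, x ∈ [0, FourField.pow 0, FourField.pow 1, FourField.pow 2] := by
    decide
  exact List.mem_product.2 ⟨h _, List.mem_product.2 ⟨h _, h _⟩⟩

/-- The homomorphism from `SL(2,3)` onto the group of order `3`. -/
def slThreeHom : SL(2, ZMod 3) →* Multiplicative (ZMod 3) where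
  -- With lower left entry `c`, this is `b d` if `c = 0` and `c (a + d)` otherwise, since `c ^ 2` is
  -- `0` or `1`.
  toFun g := Multiplicative.ofAdd ((1 - g 1 0 ^ 2) * g 0 1 * g 1 1 + g 1 0 * (g 0 0 + g 1 1))
  map_one' := by simp
  map_mul' g h := by
    have key : ∀ a b c d : ZMod 3, a * d - b * c = 1 → ∀ a' b' c' d' : ZMod 3,
        a' * d' - b' * c' = 1 → (1 - (c * a' + d * c') ^ 2) * (a * b' + b * d') *
          (c * b' + d * d') + (c * a' + d * c') * ((a * a' + b * c') + (c * b' + d * d')) =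
        ((1 - c ^ 2) * b * d + c * (a + d)) + ((1 - c' ^ 2) * b' * d' + c' * (a' + d')) := by
      decide
    rw [← ofAdd_add, ← key _ _ _ _ (SL2_det g) _ _ _ _ (SL2_det h)]
    simp only [Matrix.SpecialLinearGroup.coe_mul, Matrix.mul_apply, Fin.sum_univ_two]


theorem slThreeHom_surjective : Function.Surjective slThreeHom := fun t => by
  refine ⟨⟨!![1, t.toAdd; 0, 1], by simp⟩, ?_⟩
  simp [slThreeHom]

theorem card_SL2 : Nat.card SL(2, ZMod 3) = 24 := by
  rw [Nat.card_eq_fintype_card]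
  decide +kernel

/-- The kernel of `slThreeHom` has order `8`, and the quotient has odd order. -/
theorem cp_SL2 : cp 2 SL(2, ZMod 3) = 3 := by
  have h3 : Nat.card (Multiplicative (ZMod 3)) = 3 := Nat.card_zmod 3
  have h := Subgroup.card_mul_index slThreeHom.ker
  rw [Subgroup.index_ker, MonoidHom.range_eq_top_of_surjective _ slThreeHom_surjective,
    Subgroup.card_top, h3, card_SL2] at h
  rw [cp_eq_ker_add slThreeHom_surjective, cp_eq_of_card_eq_pow 3, cp_eq_zero_of_not_dvd]
  · rw [h3]
    decide
  · omega

theorem exists_fourField_ringEquiv : Nonempty (FourField ≃+* GaloisField 2 2) := by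
  have := Fintype.ofFinite (GaloisField 2 2)
  refine ⟨FiniteField.ringEquivOfCardEq ?_⟩
  rw [FourField.card_eq, ← Nat.card_eq_fintype_card, GaloisField.card 2 2 two_ne_zero]
  rfl

variable (e : FourField ≃+* GaloisField 2 2)

/-- The bar is squaring, so the unitary condition becomes one on entries of `FourField`, where it
can be evaluated. -/
theorem map_mem_unitaryGU_iff (A : GL (Fin 3) FourField) :
    Matrix.GeneralLinearGroup.map e.toRingHom A ∈ unitaryGU 3 2 ↔
      ∀ x y, ∑ z, A.1 x z * A.1 y z ^ 2 = if x = y then 1 else 0 := by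
  have h : ∀ x y, ((Matrix.GeneralLinearGroup.map e.toRingHom A).1 *
      ((Matrix.GeneralLinearGroup.map e.toRingHom A).1.map
        (frobenius (GaloisField 2 2) 2)).transpose) x y = e (∑ z, A.1 x z * A.1 y z ^ 2) := by
    intro x y
    rw [Matrix.mul_apply, map_sum]
    exact Finset.sum_congr rfl fun z _ => by simp [frobenius_def]
  change _ = _ ↔ _
  rw [← Matrix.ext_iff]
  refine forall₂_congr fun x y => ?_
  rw [h, Matrix.one_apply, ← e.injective.eq_iff, apply_ite e, map_one, map_zero]

theorem map_heisenbergWeilRep_mem (x : HeisenbergThree ⋊[slAction] SL(2, ZMod 3)) :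
    Matrix.GeneralLinearGroup.map e.toRingHom (heisenbergWeilRep x) ∈ unitaryGU 3 2 := by
  rw [heisenbergWeilRep_apply, map_mul]
  exact mul_mem ((map_mem_unitaryGU_iff e _).2 (heisenbergEntry_unitary _ _ _))
    ((map_mem_unitaryGU_iff e _).2 (weilEntry_unitary _ _ _ _ (SL2_det _)))

/-- A unitary matrix is determined by its rows, which form an orthonormal basis. -/
theorem card_unitaryGU_le : Nat.card (unitaryGU 3 2) ≤ 648 := by
  obtain ⟨e⟩ := exists_fourField_ringEquiv
  let row : Matrix (Fin 3) (Fin 3) FourField → Fin 3 → FourField × FourField × FourField :=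
    fun A i => (A i 0, A i 1, A i 2)
  let r : GL (Fin 3) (GaloisField 2 2) → GL (Fin 3) FourField :=
    Matrix.GeneralLinearGroup.map e.symm.toRingHom
  have hr : ∀ A, Matrix.GeneralLinearGroup.map e.toRingHom (r A) = A := fun A => by
    refine Units.ext (Matrix.ext fun i j => ?_)
    exact e.apply_symm_apply _
  let f : unitaryGU 3 2 → {x // x ∈ FourField.orthonormalBases.toFinset} := fun A =>
    ⟨(row (r A).1 0, row (r A).1 1, row (r A).1 2), by
      have h := (map_mem_unitaryGU_iff e (r A)).1 ((hr A).symm ▸ A.2)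
      have h' : ∀ i j, FourField.dot (row (r A).1 i) (row (r A).1 j) = if i = j then 1 else 0 :=
        fun i j => by
          rw [← h, Fin.sum_univ_three]
          rfl
      simp only [List.mem_toFinset, FourField.orthonormalBases, List.mem_flatMap, List.mem_map,
        List.mem_filter, decide_eq_true_eq]
      exact ⟨_, ⟨FourField.mem_vectors _, h' 0 0⟩, _, ⟨⟨FourField.mem_vectors _, h' 1 1⟩, h' 0 1⟩,
        _, ⟨⟨⟨FourField.mem_vectors _, h' 2 2⟩, h' 0 2⟩, h' 1 2⟩, rfl⟩⟩
  have hf : Function.Injective f := fun A B h => by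
    have h1 := congrArg Subtype.val h
    simp only [f, row, Prod.mk.injEq] at h1
    have h2 : r A = r B := by
      refine Units.ext (Matrix.ext fun i j => ?_)
      fin_cases i <;> fin_cases j
      exacts [h1.1.1, h1.1.2.1, h1.1.2.2, h1.2.1.1, h1.2.1.2.1, h1.2.1.2.2, h1.2.2.1,
        h1.2.2.2.1, h1.2.2.2.2]
    exact Subtype.ext (by rw [← hr A, h2, hr])
  refine (Nat.card_le_card_of_injective f hf).trans ?_
  rw [Nat.card_eq_fintype_card, Fintype.card_coe]
  exact (List.toFinset_card_le _).trans FourField.length_orthonormalBases.le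

theorem unitaryGU_mulEquiv :
    Nonempty (unitaryGU 3 2 ≃* HeisenbergThree ⋊[slAction] SL(2, ZMod 3)) := by
  obtain ⟨e⟩ := exists_fourField_ringEquiv
  let Φ : HeisenbergThree ⋊[slAction] SL(2, ZMod 3) →* unitaryGU 3 2 :=
    ((Matrix.GeneralLinearGroup.map e.toRingHom).comp heisenbergWeilRep).codRestrict _
      (map_heisenbergWeilRep_mem e)
  have hΦ : Function.Injective Φ := fun x y h => heisenbergWeilRep_injective
    (Units.map_injective (Matrix.map_injective e.injective) (congrArg Subtype.val h))
  have : Finite (unitaryGU 3 2) := inferInstance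
  have hcard : Nat.card (HeisenbergThree ⋊[slAction] SL(2, ZMod 3)) = 648 := by
    rw [Nat.card_congr SemidirectProduct.equivProd, Nat.card_prod, card_heisenbergThree, card_SL2]
    norm_num
  exact ⟨(MulEquiv.ofBijective Φ
    (hΦ.bijective_of_nat_card_le (card_unitaryGU_le.trans hcard.ge))).symm⟩

theorem cp_unitaryGU : cp 2 (unitaryGU 3 2) = 3 := by
  obtain ⟨f⟩ := unitaryGU_mulEquiv
  have : Finite HeisenbergThree :=
    Nat.finite_of_card_ne_zero (card_heisenbergThree ▸ by positivity)
  rw [cp_congr f, cp_semidirectProduct, cp_SL2, cp_eq_zero_of_not_dvd]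
  rw [card_heisenbergThree]
  decide

theorem span_unitaryGU_eq_top :
    Submodule.span (GaloisField 2 2) {A : Matrix (Fin 3) (Fin 3) (GaloisField 2 2) |
      ∃ g ∈ unitaryGU 3 2, (g : Matrix _ _ (GaloisField 2 2)) = A} = ⊤ := by
  obtain ⟨e⟩ := exists_fourField_ringEquiv
  refine eq_top_iff.2 fun A _ => ?_
  rw [Matrix.matrix_eq_sum_single A]
  refine Submodule.sum_mem _ fun i _ => Submodule.sum_mem _ fun j _ => ?_
  -- By `sum_heisenbergEntry` the Heisenberg matrices, which are unitary, already span all matrix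
  -- units.
  have h : Matrix.single i j (A i j) = A i j • ∑ b : ZMod 3,
      e (FourField.pow (-(b * j.val) - 2 * (i.val - j.val) * b)) •
        (Matrix.GeneralLinearGroup.map e.toRingHom
          (heisenbergRep ⟨![i.val - j.val, b], 0⟩)).1 := by
    ext x y
    have h1 := congrArg e (sum_heisenbergEntry i j x y)
    rw [map_sum, apply_ite e, map_one, map_zero] at h1
    simp only [map_mul] at h1
    rw [Matrix.smul_apply, Matrix.sum_apply, Matrix.single_apply]
    refine Eq.trans ?_ (congrArg (A i j • ·) h1.symm)
    simp
  rw [h]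
  refine Submodule.smul_mem _ _ (Submodule.sum_mem _ fun b _ => Submodule.smul_mem _ _
    (Submodule.subset_span ⟨_, ?_, rfl⟩))
  exact (map_mem_unitaryGU_iff e _).2 (heisenbergEntry_unitary _ _ _)

theorem unitaryGU_ne_bot : unitaryGU 3 2 ≠ ⊥ := fun h => by
  have := cp_unitaryGU
  rw [h, cp_eq_of_subsingleton] at this
  omega

end Weil

/-! ### Fields of definition and the unitary tower -/

theorem charP_of_natCard_eq {p f : ℕ} [hp : Fact p.Prime] {F : Type*} [Field F]
    (hF : Nat.card F = p ^ f) : Finite F ∧ CharP F p := by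
  have hfin : Finite F := Nat.finite_of_card_ne_zero (hF ▸ pow_ne_zero _ hp.out.ne_zero)
  have := Fintype.ofFinite F
  exact ⟨hfin, charP_of_card_eq_prime_pow (f := f) (by rw [← Nat.card_eq_fintype_card, hF])⟩

theorem nonempty_galoisField_ringHom {F : Type*} [Field F] {f : ℕ} (hF : Nat.card F = 2 ^ f)
    (h2 : Even f) : Nonempty (GaloisField 2 2 →+* F) := by
  obtain ⟨_, _⟩ := charP_of_natCard_eq hF
  let _ := ZMod.algebra F 2
  have hf : Module.finrank (ZMod 2) F = f := by
    have := Module.natCard_eq_pow_finrank (K := ZMod 2) (V := F)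
    rw [hF, Nat.card_zmod] at this
    exact (Nat.pow_right_injective le_rfl this).symm
  obtain ⟨i⟩ := FiniteField.nonempty_algHom_of_finrank_dvd (F := ZMod 2)
    (K := GaloisField 2 2) (L := F) (by
      rw [GaloisField.finrank 2 two_ne_zero, hf]
      exact h2.two_dvd)
  exact ⟨i.toRingHom⟩

theorem unitaryGU_tower {F : Type*} [Field F] [Finite F] (i : GaloisField 2 2 →+* F) (n : ℕ) :
    IsIrreducibleGroup (wreathTower 2 (extendScalars i (unitaryGU 3 2)) n) ∧
      (cp 2 (wreathTower 2 (extendScalars i (unitaryGU 3 2)) n) : ℚ) =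
        4 / 3 * (3 * 2 ^ n : ℕ) - 1 := by
  obtain ⟨h1, h2⟩ :=
    wreathTower_extendScalars_of_span_eq_top 2 span_unitaryGU_eq_top unitaryGU_ne_bot i n
  refine ⟨h1, h2.trans ?_⟩
  -- With `c_2 = 3` and `p = 2` the count is `(3 + 1) 2 ^ n - 1`.
  rw [cp_unitaryGU]
  push_cast
  ring

/-! ### The main theorem -/

theorem infinite_setOf_tower_attains {p r : ℕ} [hp : Fact p.Prime] (hr : 1 ≤ r) {F : Type*}
    [Field F] {ε : ℚ} {Γ : Subgroup (GL (Fin r) F)}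
    (h : ∀ n, IsIrreducibleGroup (wreathTower p Γ n) ∧
      (cp p (wreathTower p Γ n) : ℚ) = (ε * (r * p ^ n : ℕ) - 1) / (p - 1)) :
    {d : ℕ | ∃ G : Subgroup (GL (Fin d) F), IsIrreducibleGroup G ∧
      (cp p G : ℚ) = (ε * d - 1) / (p - 1)}.Infinite := by
  refine Set.infinite_of_injective_forall_mem (f := fun n => r * p ^ n) (fun a b hab => ?_)
    fun n => ⟨_, h n⟩
  exact Nat.pow_right_injective hp.out.two_le (Nat.eq_of_mul_eq_mul_left hr hab)

theorem gammaLOne_tower {p : ℕ} [hp : Fact p.Prime]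
    {Γ : Subgroup (GL (Fin p) (ZMod p))}
    (hspan : Submodule.span (ZMod p) {A : Matrix (Fin p) (Fin p) (ZMod p) |
      ∃ g ∈ Γ, (g : Matrix _ _ (ZMod p)) = A} = ⊤) (hcp : cp p Γ = 1) (hne : Γ ≠ ⊥)
    (F : Type*) [Field F] [Finite F] [CharP F p] (n : ℕ) :
    IsIrreducibleGroup (wreathTower p (extendScalars (ZMod.castHom dvd_rfl F) Γ) n) ∧
      (cp p (wreathTower p (extendScalars (ZMod.castHom dvd_rfl F) Γ) n) : ℚ) =
        ((p * p ^ n : ℕ) - 1) / (p - 1) := by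
  have : NeZero p := ⟨hp.out.ne_zero⟩
  obtain ⟨h1, h2⟩ := wreathTower_extendScalars_of_span_eq_top p hspan hne
    (ZMod.castHom dvd_rfl F) n
  refine ⟨h1, h2.trans ?_⟩
  rw [hcp]
  push_cast
  ring

theorem exists_fermat_eq {p : ℕ} (h : IsFermatPrime p) : ∃ m, p = 2 ^ m + 1 :=
  let ⟨_, n, hn⟩ := h
  ⟨2 ^ n, hn⟩

/-- Each case of `epsilonQ` is realised by one tower, whose dimensions `r p ^ n` are distinct. -/
theorem infinite_setOf_attains (p f : ℕ) [hp : Fact p.Prime] (F : Type*) [Field F]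
    (hF : Nat.card F = p ^ f) :
    {d : ℕ | ∃ G : Subgroup (GL (Fin d) F), IsIrreducibleGroup G ∧
      (cp p G : ℚ) = (epsilonQ p f * d - 1) / (p - 1)}.Infinite := by
  obtain ⟨_, _⟩ := charP_of_natCard_eq hF
  unfold epsilonQ
  split_ifs with h1 h2
  · obtain ⟨rfl, hev⟩ := h1
    obtain ⟨i⟩ := nonempty_galoisField_ringHom hF hev
    refine infinite_setOf_tower_attains (r := 3) (by norm_num)
      (Γ := extendScalars i (unitaryGU 3 2)) fun n => ?_
    obtain ⟨h1, h2⟩ := unitaryGU_tower i n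
    refine ⟨h1, h2.trans ?_⟩
    norm_num
  · obtain ⟨m, hpm⟩ := exists_fermat_eq h2
    obtain ⟨⟨E, _, Q, π, h⟩, h3⟩ := minusSemidirect_properties p m h2 hpm
    -- Any Sylow subgroup serves; `default` picks one.
    obtain ⟨-, ⟨φ, hφ⟩, h4⟩ := h3 E _ Q π h default
    obtain ⟨-, ρ, -, -, h5⟩ := h4 φ hφ
    refine infinite_setOf_tower_attains (r := 2 ^ m) (Nat.one_le_two_pow)
      (Γ := extendScalars (ZMod.castHom dvd_rfl F) ρ.range) fun n => ?_
    have hpm' : 2 ^ m = p - 1 := Nat.eq_sub_of_add_eq hpm.symm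
    have h6 := h5 F n
    rw [← hpm'] at h6
    exact h6
  · let b : Module.Basis (Fin p) (ZMod p) (GaloisField p p) :=
      Module.finBasisOfFinrankEq _ _ (GaloisField.finrank p hp.out.ne_zero)
    obtain ⟨-, hspan, hcp, hne⟩ := matrixGroup_gammaLOne_properties p b _ rfl
    refine infinite_setOf_tower_attains hp.out.one_lt.le (Γ := extendScalars
      (ZMod.castHom dvd_rfl F) (matrixGroup b (gammaLOne (ZMod p) (GaloisField p p)))) fun n => ?_
    have h := gammaLOne_tower hspan hcp hne F n
    rw [one_mul]
    exact h

theorem lemma3p1 :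
    -- The iterated wreath product lemma: `wreathTower p Γ n` is the paper's `Γ_{n+1}`.
    (∀ (p : ℕ) [Fact p.Prime] (r : ℕ) (F : Type*) [Field F] [Finite F]
      (Γ : Subgroup (GL (Fin r) F)), 1 ≤ r → IsIrreducibleGroup Γ →
      (Γ ≠ ⊥ → ∀ n : ℕ, IsIrreducibleGroup (wreathTower p Γ n) ∧
        (1 ≤ n → IsImprimitiveGroup (wreathTower p Γ n))) ∧
      ∀ n : ℕ, (cp p (wreathTower p Γ n) : ℚ) =
        (((cp p Γ : ℚ) * (p - 1) + 1) / r * (r * p ^ n : ℕ) - 1) / (p - 1)) ∧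
    -- The base group `ΓL(1, p^p)`, for any `q = |F|` that is a power of `p`.
    (∀ (p : ℕ) [Fact p.Prime] (b : Module.Basis (Fin p) (ZMod p) (GaloisField p p))
      (Γ : Subgroup (GL (Fin p) (ZMod p))),
      Γ = matrixGroup b (gammaLOne (ZMod p) (GaloisField p p)) →
      (∃ φ : Multiplicative (ZMod p) →* MulAut (GL (Fin 1) (GaloisField p p)),
        Nonempty (Γ ≃* GL (Fin 1) (GaloisField p p) ⋊[φ] Multiplicative (ZMod p))) ∧
      IsAbsolutelyIrreducibleGroup Γ ∧ cp p Γ = 1 ∧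
      ∀ (F : Type*) [Field F] [Finite F] [CharP F p] (n : ℕ),
        IsIrreducibleGroup (wreathTower p (extendScalars (ZMod.castHom dvd_rfl F) Γ) n) ∧
        (cp p (wreathTower p (extendScalars (ZMod.castHom dvd_rfl F) Γ) n) : ℚ) =
          ((p * p ^ n : ℕ) - 1) / (p - 1)) ∧
    -- The base group `GU(3, 2)`, for any `q = |F|` that is an even power of `2`.
    ((∃ (E : Type) (_ : Group E) (φ : SL(2, ZMod 3) →* MulAut E), IsExtraspecial 3 E ∧
        Nat.card E = 3 ^ (1 + 2) ∧ Nonempty (unitaryGU 3 2 ≃* E ⋊[φ] SL(2, ZMod 3))) ∧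
      IsAbsolutelyIrreducibleGroup (unitaryGU 3 2) ∧ cp 2 (unitaryGU 3 2) = 3 ∧
      ∀ (F : Type*) [Field F] (f : ℕ), Nat.card F = 2 ^ f → 1 ≤ f → Even f →
        Nonempty (GaloisField 2 2 →+* F) ∧
        ∀ (i : GaloisField 2 2 →+* F) (n : ℕ),
          IsIrreducibleGroup (wreathTower 2 (extendScalars i (unitaryGU 3 2)) n) ∧
          (cp 2 (wreathTower 2 (extendScalars i (unitaryGU 3 2)) n) : ℚ) =
            4 / 3 * (3 * 2 ^ n : ℕ) - 1) ∧
    -- The base group `E ⋊ P`, for a Fermat prime `p = 2 ^ m + 1` and any `q = |F|` that is a power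
    -- of `p`. Such `E` exist, and for each of them the Sylow subgroup `P` acts on `E`.
    (∀ (p m : ℕ) [Fact p.Prime], IsFermatPrime p → p = 2 ^ m + 1 →
      (∃ (E : Type) (_ : Group E) (Q : QuadraticForm (ZMod 2) (Fin (2 * m) → ZMod 2))
        (π : E →* Multiplicative (Fin (2 * m) → ZMod 2)), IsExtraspecialMinus m π Q) ∧
      ∀ (E V : Type*) [Group E] [AddCommGroup V] [Module (ZMod 2) V]
        (Q : QuadraticForm (ZMod 2) V) (π : E →* Multiplicative V), IsExtraspecialMinus m π Q →
        ∀ P : Sylow p (isometryGroup Q),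
          Nat.card P = p ∧
          (∃ φ : P →* MulAut E, IsLiftedAction π φ) ∧
          ∀ φ : P →* MulAut E, IsLiftedAction π φ →
            cp p (E ⋊[φ] P) = 1 ∧
            ∃ ρ : (E ⋊[φ] P) →* GL (Fin (2 ^ m)) (ZMod p), Function.Injective ρ ∧
              IsAbsolutelyIrreducibleGroup ρ.range ∧
              ∀ (F : Type*) [Field F] [Finite F] [CharP F p] (n : ℕ),
                IsIrreducibleGroup
                  (wreathTower p (extendScalars (ZMod.castHom dvd_rfl F) ρ.range) n) ∧
                (cp p (wreathTower p (extendScalars (ZMod.castHom dvd_rfl F) ρ.range) n) : ℚ) =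
                  ((p / (p - 1) : ℚ) * ((p - 1) * p ^ n : ℕ) - 1) / (p - 1)) ∧
    -- Sharpness: for every `q = p ^ f`, infinitely many dimensions `d` attain the bound.
    (∀ (p f : ℕ) [Fact p.Prime] (F : Type*) [Field F], 1 ≤ f → Nat.card F = p ^ f →
      {d : ℕ | ∃ G : Subgroup (GL (Fin d) F), IsIrreducibleGroup G ∧
        (cp p G : ℚ) = (epsilonQ p f * d - 1) / (p - 1)}.Infinite) := by
  refine ⟨fun p _ r F _ _ Γ hr hΓ => ⟨fun h1 n => ?_, fun n => ?_⟩, fun p hp b Γ hΓ => ?_,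
    ⟨⟨_, _, slAction, isExtraspecial_heisenbergThree, card_heisenbergThree, unitaryGU_mulEquiv⟩,
      isAbsolutelyIrreducibleGroup_of_span_eq_top span_unitaryGU_eq_top, cp_unitaryGU,
      fun F _ f hF h1 h2 => ⟨nonempty_galoisField_ringHom hF h2, fun i n => ?_⟩⟩,
    fun p m _ h hpm => minusSemidirect_properties p m h hpm,
    fun p f _ F _ hf hF => infinite_setOf_attains p f F hF⟩
  · have : NeZero r := ⟨by omega⟩
    exact ⟨isIrreducibleGroup_wreathTower p hΓ h1 n,
      fun hn => isImprimitiveGroup_wreathTower p hΓ h1 hn⟩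
  · have : NeZero r := ⟨by omega⟩
    have hr0 : (r : ℚ) ≠ 0 := by exact_mod_cast NeZero.ne r
    rw [cp_wreathTower, Nat.cast_mul, ← mul_assoc, div_mul_cancel₀ _ hr0, Nat.cast_pow]
  · obtain ⟨h1, h2, h3, h4⟩ := matrixGroup_gammaLOne_properties p b Γ hΓ
    have : Nonempty (Fin p) := ⟨⟨0, hp.out.pos⟩⟩
    exact ⟨h1, isAbsolutelyIrreducibleGroup_of_span_eq_top h2, h3,
      fun F _ _ _ n => gammaLOne_tower h2 h3 h4 F n⟩
  · have := (charP_of_natCard_eq hF).1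
    exact unitaryGU_tower i n
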